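/- **Setting.** A hypergraph $G=(V,E)$ is finite, and parallel hyperedges are allowed; $n=|V|$ and $p=\sum_{e\in E}|e|$ is its size. For $U\subseteq V$ let $\delta(U)$ be the set of hyperedges that meet both $U$ and $V\setminus U$, and $d(U)=|\delta(U)|$. A $k$-partition is an ordered partition $(V_1,\dots,V_k)$ of $V$ into $k$ non-empty parts; it is an *optimum minmax $k$-partition* if it minimizes $\max_{i}d(V_i)$ over all $k$-partitions. A tuple $(U_1,\dots,U_k)$ of pairwise disjoint subsets of $V$ is a *$k$-cut-set representative* of $(V_1,\dots,V_k)$ if $U_i\subseteq V_i$ and $\delta(U_i)=\delta(V_i)$ for all $i$. For disjoint non-empty $S,T\subseteq V$, a *minimum $(S,T)$-terminal cut* is a set $U$ with $S\subseteq U\subseteq V\setminus T$ and $d(U)$ minimum; it is *source minimal* if no minimum $(S,T)$-terminal cut is a proper subset of $U$. **Recover-Partition**$(G,U_1,\dots,U_k)$, for pairwise disjoint $U_i$: put $P_i\leftarrow U_i$ for all $i$. Go through the connected components $C$ of $G-\bigcup_i\delta(U_i)$ that are disjoint from $\bigcup_i U_i$; if $\delta(P_i\cup C)=\delta(P_i)$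 for some $i$, put $P_i\leftarrow P_i\cup C$ for the first such $i$. Return $(P_1,\dots,P_k)$ if it is a $k$-partition, otherwise NO. **Enum-MinMax-Reps**$(G,k)$: let $\mathcal C$ be the collection of the source minimal minimum $(S,T)$-terminal cuts over all disjoint non-empty $S,T\subseteq V$ with $|S|,|T|\le 2k-1$. Let $\mathcal D$ be the set of the tuples $(U_1,\dots,U_k)\in\mathcal C^k$ with pairwise disjoint entries for which Recover-Partition returns a $k$-partition. Let $\lambda=\min\{\max_i d(U_i):(U_1,\dots,U_k)\in\mathcal D\}$. Return the family $\mathcal F$ of all $(U_1,\dots,U_k)\in\mathcal D$ with $\max_i d(U_i)=\lambda$. **Theorem.** Let $k\ge 2$ be an integer and let $G$ be an $n$-vertex hypergraph of size $p$. Let $\mathcal F$ be the family returned by Enum-MinMax-Reps$(G,k)$. 1. Every member of $\mathcal F$ is a $k$-cut-set representative of some optimum minmax $k$-partition of $G$, and for every optimum minmax $k$-partition of $G$, the family $\mathcal F$ contains a $k$-cut-set representative of it. 2. $|\mathcal F|=O(n^{4k^2-2k})$. 3. Enum-MinMax-Reps can be implemented to run in time $O(k\,n^{4k^2-2k+1}p)$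 on hypergraphs with at least one hyperedge all of whose hyperedges are non-empty: one fixed program of a unit-cost random access machine, whose only arithmetic is adding or subtracting one, gets $k$ and $G$ as input, halts within that number of steps, and outputs the members of $\mathcal F$, each exactly once. The constants in the $O(\cdot)$ are absolute: they depend neither on $k$ nor on $G$. -/

import Mathlib

/-- A finite hypergraph with vertex set `Fin n` and hyperedges indexed by `Fin m`. Hyperedges are
indexed, so parallel hyperedges are allowed. -/
structure MultiHypergraph (n m : ℕ) where
  /-- the vertex set of a hyperedge -/
  edge : Fin m → Finset (Fin n)

namespace MultiHypergraph

open scoped Classical in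
/-- `δ(U)`: the hyperedges that meet both `U` and its complement. -/
noncomputable def delta {n m : ℕ} (G : MultiHypergraph n m) (U : Finset (Fin n)) :
    Finset (Fin m) :=
  Finset.univ.filter fun e => (∃ v ∈ G.edge e, v ∈ U) ∧ ∃ v ∈ G.edge e, v ∉ U

/-- `d(U) = |δ(U)|`. -/
noncomputable def d {n m : ℕ} (G : MultiHypergraph n m) (U : Finset (Fin n)) : ℕ :=
  (G.delta U).card

/-- The representation size `p = ∑ₑ |e|`. -/
def size {n m : ℕ} (G : MultiHypergraph n m) : ℕ := ∑ e, (G.edge e).card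

/-- `max_i d(U_i)` for a tuple of vertex sets (`0` for the empty tuple). -/
noncomputable def maxCut {n m k : ℕ} (G : MultiHypergraph n m)
    (U : Fin k → Finset (Fin n)) : ℕ :=
  Finset.univ.sup fun i => G.d (U i)

end MultiHypergraph

/-- `(V_1, …, V_k)` is an ordered partition of the vertex set into `k` non-empty parts. -/
def IsKPartition {n k : ℕ} (P : Fin k → Finset (Fin n)) : Prop :=
  (∀ i, (P i).Nonempty) ∧ (∀ i j, i ≠ j → Disjoint (P i) (P j)) ∧ ∀ v, ∃ i, v ∈ P i

namespace MultiHypergraph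

/-- An optimum `k`-partition for minmax hypergraph `k`-partition. -/
def IsOptMinmaxPartition {n m k : ℕ} (G : MultiHypergraph n m)
    (P : Fin k → Finset (Fin n)) : Prop :=
  IsKPartition P ∧ ∀ Q : Fin k → Finset (Fin n), IsKPartition Q → G.maxCut P ≤ G.maxCut Q

/-- `(U_1, …, U_k)` is a `k`-cut-set representative of `(V_1, …, V_k)`. -/
def IsCutSetRep {n m k : ℕ} (G : MultiHypergraph n m) (U P : Fin k → Finset (Fin n)) : Prop :=
  (∀ i j, i ≠ j → Disjoint (U i) (U j)) ∧ ∀ i, U i ⊆ P i ∧ G.delta (U i) = G.delta (P i)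

/-- The family `F` is a solution of the problem of enumerating `k`-cut-set representatives of the
optimum minmax `k`-partitions of `G`. -/
def SolvesEnumReps {n m k : ℕ} (G : MultiHypergraph n m)
    (F : Finset (Fin k → Finset (Fin n))) : Prop :=
  (∀ U ∈ F, ∃ P, G.IsOptMinmaxPartition P ∧ G.IsCutSetRep U P) ∧
    ∀ P : Fin k → Finset (Fin n), G.IsOptMinmaxPartition P → ∃ U ∈ F, G.IsCutSetRep U P

/-! ### Terminal cuts -/

/-- `(U, Uᶜ)` is an `(S, T)`-terminal cut: `S ⊆ U ⊆ V \ T`. For non-empty `S` and `T` both sides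
are then non-empty. -/
def IsTerminalCut {n : ℕ} (S T U : Finset (Fin n)) : Prop := S ⊆ U ∧ Disjoint U T

/-- `(U, Uᶜ)` is a minimum `(S, T)`-terminal cut. -/
def IsMinTerminalCut {n m : ℕ} (G : MultiHypergraph n m) (S T U : Finset (Fin n)) : Prop :=
  IsTerminalCut S T U ∧ ∀ W, IsTerminalCut S T W → G.d U ≤ G.d W

/-- `(U, Uᶜ)` is a source minimal minimum `(S, T)`-terminal cut: no minimum `(S, T)`-terminal cut
has a source set strictly inside `U`. -/
def IsSourceMinimalMinCut {n m : ℕ} (G : MultiHypergraph n m) (S T U : Finset (Fin n)) : Prop :=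
  Minimal (G.IsMinTerminalCut S T) U

/-! ### Algorithm Recover-Partition -/

/-- Two vertices lie in a common hyperedge of `G - X`. -/
def AdjAvoiding {n m : ℕ} (G : MultiHypergraph n m) (X : Finset (Fin m)) (u v : Fin n) : Prop :=
  ∃ e, e ∉ X ∧ u ∈ G.edge e ∧ v ∈ G.edge e

open scoped Classical in
/-- The connected component of `v` in `G - X`. -/
noncomputable def component {n m : ℕ} (G : MultiHypergraph n m) (X : Finset (Fin m))
    (v : Fin n) : Finset (Fin n) :=
  Finset.univ.filter fun w => Relation.ReflTransGen (G.AdjAvoiding X) v w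

open scoped Classical in
/-- The components of `G - X` that are disjoint from `Y`, each listed once, in the order of their
smallest vertices. -/
noncomputable def componentsOff {n m : ℕ} (G : MultiHypergraph n m) (X : Finset (Fin m))
    (Y : Finset (Fin n)) : List (Finset (Fin n)) :=
  (((List.finRange n).filter fun v => ∀ w ∈ G.component X v, v ≤ w).map (G.component X)).filter
    fun C => Disjoint C Y

/-- One iteration of the loop of Recover-Partition: if there is an index `i` with
`δ(P_i ∪ C) = δ(P_i)`, then `C` is added to `P_i` for the first such `i`. -/
noncomputable def absorb {n m k : ℕ} (G : MultiHypergraph n m) (P : Fin k → Finset (Fin n))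
    (C : Finset (Fin n)) : Fin k → Finset (Fin n) :=
  match (List.finRange k).find? fun i => G.delta (P i ∪ C) = G.delta (P i) with
  | some i => Function.update P i (P i ∪ C)
  | none => P

open scoped Classical in
/-- Algorithm Recover-Partition; `none` is the answer NO. -/
noncomputable def recoverPartition {n m k : ℕ} (G : MultiHypergraph n m)
    (U : Fin k → Finset (Fin n)) : Option (Fin k → Finset (Fin n)) :=
  let comps := G.componentsOff (Finset.univ.biUnion fun i => G.delta (U i)) (Finset.univ.biUnion U)
  let P := comps.foldl G.absorb U
  if IsKPartition P then some P else none

/-! ### Algorithm Enum-MinMax-Reps -/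

open scoped Classical in
/-- The collection `𝒞` of the source sets of the source minimal minimum `(S, T)`-terminal cuts,
over all disjoint non-empty `S` and `T` with at most `2k - 1` vertices each. -/
noncomputable def candidates {n m : ℕ} (G : MultiHypergraph n m) (k : ℕ) :
    Finset (Finset (Fin n)) :=
  Finset.univ.filter fun U => ∃ S T : Finset (Fin n), S.Nonempty ∧ T.Nonempty ∧ Disjoint S T ∧
    S.card ≤ 2 * k - 1 ∧ T.card ≤ 2 * k - 1 ∧ G.IsSourceMinimalMinCut S T U

open scoped Classical in
/-- The collection `𝒟` of the tuples in `𝒞^k` with pairwise disjoint entries for which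
Recover-Partition returns a `k`-partition. -/
noncomputable def recoverableTuples {n m : ℕ} (G : MultiHypergraph n m) (k : ℕ) :
    Finset (Fin k → Finset (Fin n)) :=
  (Fintype.piFinset fun _ : Fin k => G.candidates k).filter fun U =>
    (∀ i j, i ≠ j → Disjoint (U i) (U j)) ∧ (G.recoverPartition U).isSome

/-- `λ = min {max_i d(U_i) : (U_1, …, U_k) ∈ 𝒟}` (`⊤` if `𝒟` is empty). -/
noncomputable def lam {n m : ℕ} (G : MultiHypergraph n m) (k : ℕ) : WithTop ℕ :=
  ((G.recoverableTuples k).image G.maxCut).min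

/-- The family `ℱ` returned by Algorithm Enum-MinMax-Reps on input `(G, k)`. -/
noncomputable def enumMinMaxReps {n m : ℕ} (G : MultiHypergraph n m) (k : ℕ) :
    Finset (Fin k → Finset (Fin n)) :=
  (G.recoverableTuples k).filter fun U => (G.maxCut U : WithTop ℕ) = G.lam k

end MultiHypergraph

/-! ### Random access machines

Programs are while-programs over finitely many registers and finitely many random access arrays of
natural numbers, with an output tape. Each elementary instruction and each evaluation of a test
costs one step. The only arithmetic is adding or subtracting one, so that no number exceeds the
largest of the input numbers and program constants by more than the number of steps: unit cost
does not hide arithmetic on long numbers. -/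

namespace Ram

/-- The memory: registers, arrays, and what has been written on the output tape. -/
structure Store where
  reg : ℕ → ℕ
  arr : ℕ → ℕ → ℕ
  out : List ℕ

/-- Tests compare two registers. -/
inductive Test where
  | eq (x y : ℕ)
  | lt (x y : ℕ)

/-- Programs; `x`, `y` name registers, `a` names an array, `c` is a fixed numeral. -/
inductive Prog where
  | skip
  | const (x c : ℕ)
  | copy (x y : ℕ)
  | succ (x : ℕ)
  | pred (x : ℕ)
  | load (x a y : ℕ)
  | store (a x y : ℕ)
  | write (x : ℕ)
  | seq (P Q : Prog)
  | ite (b : Test) (P Q : Prog)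
  | while (b : Test) (P : Prog)

/-- The meaning of a test. -/
def Test.Holds : Test → Store → Prop
  | .eq x y, s => s.reg x = s.reg y
  | .lt x y, s => s.reg x < s.reg y

/-- Assign the value `v` to the register `x`. -/
def Store.setReg (s : Store) (x v : ℕ) : Store :=
  { s with reg := Function.update s.reg x v }

/-- Assign the value `v` to the cell with address `i` of the array `a`. -/
def Store.setArr (s : Store) (a i v : ℕ) : Store :=
  { s with arr := Function.update s.arr a (Function.update (s.arr a) i v) }

/-- `Exec P s t s'`: started in `s`, the program `P` halts after `t` steps in `s'`. -/
inductive Exec : Prog → Store → ℕ → Store → Prop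
  | skip (s : Store) : Exec .skip s 1 s
  | const (s : Store) (x c : ℕ) : Exec (.const x c) s 1 (s.setReg x c)
  | copy (s : Store) (x y : ℕ) : Exec (.copy x y) s 1 (s.setReg x (s.reg y))
  | succ (s : Store) (x : ℕ) : Exec (.succ x) s 1 (s.setReg x (s.reg x + 1))
  | pred (s : Store) (x : ℕ) : Exec (.pred x) s 1 (s.setReg x (s.reg x - 1))
  | load (s : Store) (x a y : ℕ) : Exec (.load x a y) s 1 (s.setReg x (s.arr a (s.reg y)))
  | store (s : Store) (a x y : ℕ) : Exec (.store a x y) s 1 (s.setArr a (s.reg x) (s.reg y))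
  | write (s : Store) (x : ℕ) : Exec (.write x) s 1 { s with out := s.out ++ [s.reg x] }
  | seq {P Q : Prog} {s s' s'' : Store} {t t' : ℕ} :
      Exec P s t s' → Exec Q s' t' s'' → Exec (.seq P Q) s (t + t') s''
  | iteTrue {b : Test} {P Q : Prog} {s s' : Store} {t : ℕ} :
      b.Holds s → Exec P s t s' → Exec (.ite b P Q) s (t + 1) s'
  | iteFalse {b : Test} {P Q : Prog} {s s' : Store} {t : ℕ} :
      ¬ b.Holds s → Exec Q s t s' → Exec (.ite b P Q) s (t + 1) s'
  | whileTrue {b : Test} {P : Prog} {s s' s'' : Store} {t t' : ℕ} :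
      b.Holds s → Exec P s t s' → Exec (.while b P) s' t' s'' →
        Exec (.while b P) s (t + t' + 1) s''
  | whileFalse {b : Test} {P : Prog} {s : Store} :
      ¬ b.Holds s → Exec (.while b P) s 1 s

/-- The initial memory: the input word stands in array `0`, all else is zero, the output tape is
empty. -/
def initial (w : List ℕ) : Store where
  reg := fun _ => 0
  arr := fun a i => if a = 0 then w.getD i 0 else 0
  out := []

/-- On the input word `w` the program halts after `t` steps with the output word `o`. -/
def Computes (P : Prog) (w : List ℕ) (t : ℕ) (o : List ℕ) : Prop :=
  ∃ s, Exec P (initial w) t s ∧ s.out = o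

end Ram

namespace MultiHypergraph

/-- The input `(G, k)` as a word: `k`, `n`, `m`, and then, for each hyperedge, its cardinality
followed by its vertices in increasing order. Its length is `3 + m + p`. -/
def inputWord {n m : ℕ} (G : MultiHypergraph n m) (k : ℕ) : List ℕ :=
  k :: n :: m :: (List.finRange m).flatMap fun e =>
    (G.edge e).card :: ((G.edge e).sort (· ≤ ·)).map Fin.val

end MultiHypergraph

/-- A tuple of vertex sets as a word: the `k` characteristic vectors, one after the other. -/
def tupleWord {n k : ℕ} (U : Fin k → Finset (Fin n)) : List ℕ :=
  (List.finRange k).flatMap fun i => (List.finRange n).map fun v => if v ∈ U i then 1 else 0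

/-- The word `o` lists the members of the family `F`, each exactly once, in some order. -/
def ListsFamily {n k : ℕ} (o : List ℕ) (F : Finset (Fin k → Finset (Fin n))) : Prop :=
  ∃ L : List (Fin k → Finset (Fin n)),
    L.Nodup ∧ (∀ U, U ∈ L ↔ U ∈ F) ∧ o = L.flatMap tupleWord

/-! Let `U` be a part of an optimum partition, so that `d(U)` is at most the value of every
k-partition. The heart of the proof is `exists_pins`: a set `S ⊆ U` of at most `2k - 1` vertices
forces `δ(A) = δ(U)` for all `A` with `S ⊆ A ⊆ U` and `d(A) ≤ d(U)`. Take an inclusion-minimal such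
`S` and suppose that it has at least `2k` elements. Each `u ∈ S` then has a set `B u` between `S \
{u}` and `U` that violates the conclusion and has least cut value in this interval. For every
hyperedge count the complements of the sets `B u` that it meets and those that contain it, both
counts truncated at two. Uncrossing the complements one by one (`sum_meetCount_le`) shows that the
two totals differ by at most `2 d(U)`. Conversely, call a vertex private to `i` if it lies in the
complement of `B i` and of no other `B j`. The private parts of any `k - 1` elements of `S`,
together with the remaining vertices, form a k-partition, so at least `d(U)` hyperedges are cut by
these private parts (`opt_le_cutBy`); and two disjoint choices of `k - 1` elements fit side by side
into the same difference (`cutBy_le`). Hence equality holds at every hyperedge. Varying the choices,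
every hyperedge cut by the overlap, the set of vertices in at least two complements, meets two
private parts. It follows that the overlap has the cut set of `U`, and then a hyperedge of `δ(U)`
missing from `δ(B u)` yields a contradiction.

Pinning both `U` and its complement gives `S` and `T`. By submodularity `U` is a minimum `(S,
T)`-terminal cut, and the source minimal one lies between `S` and `U`, so it has the cut set of `U`
(`exists_candidate`). Thus every optimum partition has a representative made of candidates. Source
minimal cuts are unique, so there are at most `n ^ (4k - 2)` candidates, and the k-th power of this
bounds the family.

Recover-Partition succeeds on a tuple of non-empty sets whenever the tuple represents some
k-partition: the part that contains a loose component can always absorb it, however the earlier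
components were distributed (`recoverPartition_isSome`). So `𝒟` consists of the candidate tuples
that represent a k-partition (`mem_recoverableTuples`). A representative has the same value as its
partition, hence minimizing over `𝒟` is minimizing over k-partitions (`solvesEnumReps`).

For the running time, source minimal cuts are found by a push-relabel algorithm on hypergraphs: a
preflow without active vertices has as its set of vertices with a residual path to `S` the source
minimal cut (`Preflow.Inv.isSourceMinimalMinCut`). Membership in `𝒟` is decided without building a
partition, by the criterion `exists_partition_iff`, which needs one closure per index and hence `O(k
n p)` steps per tuple. One sweep over all tuples finds the least value, a second one writes the
tuples that attain it. Listing the candidates is not more expensive than the sweeps, because `8k - 3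
≤ 4k² - 2k + 1` for `k ≥ 2`. -/

namespace MultiHypergraph

/-! ### Uncrossing: few vertices determine the cut set of a part. -/

section Uncrossing

variable {n m : ℕ} (G : MultiHypergraph n m)

theorem mem_delta {U : Finset (Fin n)} {e : Fin m} :
    e ∈ G.delta U ↔ (∃ v ∈ G.edge e, v ∈ U) ∧ ∃ v ∈ G.edge e, v ∉ U := by
  simp [delta]

theorem delta_compl (U : Finset (Fin n)) : G.delta Uᶜ = G.delta U := by
  ext e
  simp [mem_delta, and_comm]

theorem d_compl (U : Finset (Fin n)) : G.d Uᶜ = G.d U := by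
  simp [d, delta_compl]

open scoped Classical in
theorem d_eq_sum (U : Finset (Fin n)) : G.d U = ∑ e, if e ∈ G.delta U then 1 else 0 := by
  simp [d]

open scoped Classical in
/-- The number of `u ∈ T` such that the hyperedge `e` meets the complement of `B u`. -/
noncomputable def meetCount (B : Fin n → Finset (Fin n)) (T : Finset (Fin n)) (e : Fin m) : ℕ :=
  (T.filter fun u => ∃ v ∈ G.edge e, v ∉ B u).card

open scoped Classical in
/-- The number of `u ∈ T` such that the non-empty hyperedge `e` lies in the complement of `B u`. -/
noncomputable def insideCount (B : Fin n → Finset (Fin n)) (T : Finset (Fin n)) (e : Fin m) : ℕ :=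
  (T.filter fun u => (∃ v ∈ G.edge e, v ∉ B u) ∧ ∀ v ∈ G.edge e, v ∉ B u).card

open scoped Classical in
/-- The vertices that lie in the complements of at least two of the sets `B u`, `u ∈ T`. -/
noncomputable def overlap (B : Fin n → Finset (Fin n)) (T : Finset (Fin n)) : Finset (Fin n) :=
  Finset.univ.filter fun v => 2 ≤ (T.filter fun u => v ∉ B u).card

theorem insideCount_le_meetCount (B : Fin n → Finset (Fin n)) (T : Finset (Fin n)) (e : Fin m) :
    G.insideCount B T e ≤ G.meetCount B T e := by
  classical
  exact Finset.card_le_card (Finset.monotone_filter_right _ fun _ _ h => h.1)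

-- This is submodularity at a single hyperedge. The complement of `B u ∪ (overlap B T)ᶜ` is the
-- intersection of the complement of `B u` with the overlap. A hyperedge that meets the overlap
-- already has `meetCount` at least two, so its truncated count no longer grows; a hyperedge with
-- `insideCount` at least two lies in the overlap entirely.
open scoped Classical in
theorem insert_step (B : Fin n → Finset (Fin n)) (T : Finset (Fin n)) (e : Fin m) {u : Fin n}
    (hu : u ∉ T) :
    min 2 (G.meetCount B (insert u T) e) + min 2 (G.insideCount B T e) +
        (if e ∈ G.delta (B u ∪ (overlap B T)ᶜ) then 1 else 0) ≤
      min 2 (G.meetCount B T e) + min 2 (G.insideCount B (insert u T) e) +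
        (if e ∈ G.delta (B u) then 1 else 0) := by
  have h1 : G.meetCount B (insert u T) e =
      G.meetCount B T e + if (∃ v ∈ G.edge e, v ∉ B u) then 1 else 0 := by
    unfold meetCount
    rw [Finset.filter_insert]
    split_ifs with h
    · rw [Finset.card_insert_of_notMem (by simp [hu])]
    · rfl
  have h2 : G.insideCount B (insert u T) e =
      G.insideCount B T e +
        if ((∃ v ∈ G.edge e, v ∉ B u) ∧ ∀ v ∈ G.edge e, v ∉ B u) then 1 else 0 := by
    unfold insideCount
    rw [Finset.filter_insert]
    split_ifs with h
    · rw [Finset.card_insert_of_notMem (by simp [hu])]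
    · rfl
  have h3 : ∀ v ∈ G.edge e, v ∈ overlap B T → 2 ≤ G.meetCount B T e := by
    intro v hv hvW
    simp only [overlap, Finset.mem_filter, Finset.mem_univ, true_and] at hvW
    refine hvW.trans (Finset.card_le_card ?_)
    exact Finset.monotone_filter_right _ fun w _ hw => ⟨v, hv, hw⟩
  have h4 : 2 ≤ G.insideCount B T e → ∀ v ∈ G.edge e, v ∈ overlap B T := by
    intro h v hv
    simp only [overlap, Finset.mem_filter, Finset.mem_univ, true_and]
    refine h.trans (Finset.card_le_card ?_)
    exact Finset.monotone_filter_right _ fun w _ hw => hw.2 v hv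
  have h5 := G.insideCount_le_meetCount B T e
  rw [h1, h2]
  by_cases hA : ∃ v ∈ G.edge e, v ∉ B u
  · by_cases hB : ∀ v ∈ G.edge e, v ∉ B u
    · have hd : e ∉ G.delta (B u) := by
        rw [mem_delta]; rintro ⟨⟨v, hv, hv'⟩, -⟩; exact hB v hv hv'
      by_cases hC : e ∈ G.delta (B u ∪ (overlap B T)ᶜ)
      · have hC' := hC
        rw [mem_delta] at hC'
        obtain ⟨⟨v, hv, hv'⟩, ⟨w, hw, hw'⟩⟩ := hC'
        have := h3 w hw (by simpa using fun h : w ∉ overlap B T => hw' (by simp [h]))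
        have h6 : ¬ 2 ≤ G.insideCount B T e := fun h => by
          have := h4 h v hv
          simp [this, hB v hv] at hv'
        rw [if_pos hA, if_pos (And.intro hA hB), if_pos hC, if_neg hd]
        omega
      · rw [if_pos hA, if_pos (And.intro hA hB), if_neg hC, if_neg hd]
        by_cases h6 : 2 ≤ G.insideCount B T e
        · omega
        · omega
    · have hd : e ∈ G.delta (B u) := by
        rw [mem_delta]; push Not at hB; exact ⟨hB, hA⟩
      have hAB : ¬((∃ v ∈ G.edge e, v ∉ B u) ∧ ∀ v ∈ G.edge e, v ∉ B u) := fun h => hB h.2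
      rw [if_pos hA, if_neg hAB, if_pos hd]
      by_cases hC : e ∈ G.delta (B u ∪ (overlap B T)ᶜ)
      · have hC' := hC
        rw [mem_delta] at hC'
        obtain ⟨-, ⟨w, hw, hw'⟩⟩ := hC'
        have := h3 w hw (by simpa using fun h : w ∉ overlap B T => hw' (by simp [h]))
        rw [if_pos hC]; omega
      · rw [if_neg hC]; omega
  · have hd : e ∉ G.delta (B u) := by
      rw [mem_delta]; rintro ⟨-, h⟩; exact hA h
    have hC : e ∉ G.delta (B u ∪ (overlap B T)ᶜ) := by
      rw [mem_delta]; rintro ⟨-, ⟨v, hv, h⟩⟩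
      exact hA ⟨v, hv, fun h' => h (by simp [h'])⟩
    have hAB : ¬((∃ v ∈ G.edge e, v ∉ B u) ∧ ∀ v ∈ G.edge e, v ∉ B u) := fun h => hA h.1
    rw [if_neg hA, if_neg hAB, if_neg hd, if_neg hC]
    exact le_rfl

/-- Sum `insert_step` over the hyperedges while `T` is built up element by element. The first two
elements cost at most `c` each. From then on `B u` is no worse than `B u ∪ (overlap B T)ᶜ`, so an
insertion costs nothing. This is the reason for truncating at two. -/
theorem sum_meetCount_le (B : Fin n → Finset (Fin n)) (S T : Finset (Fin n)) (c : ℕ)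
    (hBc : ∀ u ∈ S, G.d (B u) ≤ c)
    (hmin : ∀ u ∈ S, ∀ T ⊆ S, 2 ≤ T.card → G.d (B u) ≤ G.d (B u ∪ (overlap B T)ᶜ))
    (hT : T ⊆ S) :
    ∑ e, min 2 (G.meetCount B T e) ≤
      ∑ e, min 2 (G.insideCount B T e) + c * min 2 T.card := by
  classical
  induction T using Finset.induction_on with
  | empty => simp [meetCount, insideCount]
  | insert u T hu ih =>
    have ih := ih fun x hx => hT (Finset.mem_insert_of_mem hx)
    have huS : u ∈ S := hT (Finset.mem_insert_self _ _)
    have hstep := Finset.sum_le_sum fun e (_ : e ∈ Finset.univ) => G.insert_step B T e hu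
    simp only [Finset.sum_add_distrib, ← d_eq_sum] at hstep
    rw [Finset.card_insert_of_notMem hu]
    have hc := hBc u huS
    by_cases h2 : 2 ≤ T.card
    · have := hmin u huS T (fun x hx => hT (Finset.mem_insert_of_mem hx)) h2
      have e1 : min 2 (T.card + 1) = 2 := by omega
      have e2 : min 2 T.card = 2 := by omega
      rw [e1]; rw [e2] at ih; omega
    · have e1 : min 2 (T.card + 1) = min 2 T.card + 1 := by omega
      rw [e1, Nat.mul_add, Nat.mul_one]; omega

/-- `v` lies in the complement of `B i` and in `B j` for all other `j ∈ S`. -/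
def OnlyIn (B : Fin n → Finset (Fin n)) (S : Finset (Fin n)) (i v : Fin n) : Prop :=
  v ∉ B i ∧ ∀ j ∈ S, j ≠ i → v ∈ B j

/-- The hyperedge `e` meets the private part of some `i ∈ I` without being contained in it. -/
def CutBy (B : Fin n → Finset (Fin n)) (S I : Finset (Fin n)) (e : Fin m) : Prop :=
  ∃ i ∈ I, (∃ v ∈ G.edge e, OnlyIn B S i v) ∧ ∃ v ∈ G.edge e, ¬ OnlyIn B S i v

theorem two_meet {B : Fin n → Finset (Fin n)} {S : Finset (Fin n)} {e : Fin m} {i j : Fin n}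
    (hi : i ∈ S) (hj : j ∈ S) (hij : i ≠ j)
    (h1 : ∃ v ∈ G.edge e, v ∉ B i) (h2 : ∃ v ∈ G.edge e, v ∉ B j) : 2 ≤ G.meetCount B S e := by
  classical
  unfold meetCount
  rw [← Finset.card_pair hij]
  apply Finset.card_le_card
  intro x hx
  simp only [Finset.mem_insert, Finset.mem_singleton] at hx
  rcases hx with rfl | rfl <;> simp [*]

theorem insideCount_eq_zero {B : Fin n → Finset (Fin n)} {S : Finset (Fin n)} {e : Fin m}
    (h : ∀ u ∈ S, ∃ v ∈ G.edge e, v ∈ B u) : G.insideCount B S e = 0 := by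
  classical
  unfold insideCount
  rw [Finset.card_eq_zero, Finset.filter_eq_empty_iff]
  rintro u hu ⟨-, h'⟩
  obtain ⟨v, hv, hv'⟩ := h u hu
  exact h' v hv hv'

/-- A private vertex of `i` lies in `B u` for all other `u`. Private vertices of two different
elements therefore leave no `u` whose complement could contain the hyperedge. -/
theorem count_of_two_private {B : Fin n → Finset (Fin n)} {S : Finset (Fin n)} {e : Fin m}
    {i j : Fin n} (hi : i ∈ S) (hj : j ∈ S) (hij : i ≠ j)
    (h1 : ∃ v ∈ G.edge e, OnlyIn B S i v) (h2 : ∃ v ∈ G.edge e, OnlyIn B S j v) :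
    2 ≤ G.meetCount B S e ∧ G.insideCount B S e = 0 := by
  obtain ⟨v, hv, hv'⟩ := h1
  obtain ⟨w, hw, hw'⟩ := h2
  refine ⟨G.two_meet hi hj hij ⟨v, hv, hv'.1⟩ ⟨w, hw, hw'.1⟩, G.insideCount_eq_zero ?_⟩
  intro u hu
  by_cases hui : u = i
  · subst hui; exact ⟨w, hw, hw'.2 u hu hij⟩
  · exact ⟨v, hv, hv'.2 u hu hui⟩

theorem inside_le_one {B : Fin n → Finset (Fin n)} {S : Finset (Fin n)} {e : Fin m}
    (i : Fin n) (h : ∀ u ∈ S, u ≠ i → ∃ v ∈ G.edge e, v ∈ B u) : G.insideCount B S e ≤ 1 := by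
  classical
  unfold insideCount
  rw [← Finset.card_singleton i]
  apply Finset.card_le_card
  intro u hu
  simp only [Finset.mem_filter] at hu
  rw [Finset.mem_singleton]
  by_contra hne
  obtain ⟨v, hv, hv'⟩ := h u hu.1 hne
  exact hu.2.2 v hv hv'

-- If both `I` and `I'` cut the hyperedge, it meets two private parts, and `count_of_two_private`
-- applies. If only one does, through a private vertex of `i`, then only the complement of `B i` can
-- contain the hyperedge. A vertex outside the private part lies either in every `B u`, which makes
-- the inside count zero, or in a complement other than that of `B i`, which makes the meet count at
-- least two.
open scoped Classical in
theorem cutBy_le {B : Fin n → Finset (Fin n)} {S I I' : Finset (Fin n)} (e : Fin m)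
    (hI : I ⊆ S) (hI' : I' ⊆ S) (hd : Disjoint I I') :
    (if G.CutBy B S I e then 1 else 0) + (if G.CutBy B S I' e then 1 else 0) +
      min 2 (G.insideCount B S e) ≤ min 2 (G.meetCount B S e) := by
  have h5 := G.insideCount_le_meetCount B S e
  have key : ∀ i ∈ S, (∃ v ∈ G.edge e, OnlyIn B S i v) → (∃ v ∈ G.edge e, ¬ OnlyIn B S i v) →
      1 + min 2 (G.insideCount B S e) ≤ min 2 (G.meetCount B S e) := by
    rintro i hi ⟨v, hv, hv'⟩ ⟨w, hw, hw'⟩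
    have hK := G.inside_le_one (e := e) i fun u hu hne => ⟨v, hv, hv'.2 u hu hne⟩
    by_cases hZ : ∀ u ∈ S, w ∈ B u
    · have := G.insideCount_eq_zero (e := e) fun u hu => ⟨w, hw, hZ u hu⟩
      have h1 : 1 ≤ G.meetCount B S e := by
        unfold meetCount
        exact Finset.card_pos.2 ⟨i, by simp only [Finset.mem_filter]; exact ⟨hi, v, hv, hv'.1⟩⟩
      omega
    · have : ∃ j ∈ S, j ≠ i ∧ w ∉ B j := by
        push Not at hZ
        obtain ⟨j, hj, hwj⟩ := hZ
        by_cases hji : j = i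
        · subst hji
          by_contra hcon
          push Not at hcon
          exact hw' ⟨hwj, hcon⟩
        · exact ⟨j, hj, hji, hwj⟩
      obtain ⟨j, hj, hji, hwj⟩ := this
      have := G.two_meet hj hi hji ⟨w, hw, hwj⟩ ⟨v, hv, hv'.1⟩
      omega
  split_ifs with h1 h2 h2
  · obtain ⟨i, hi, hv, -⟩ := h1
    obtain ⟨j, hj, hw, -⟩ := h2
    have hij : i ≠ j := fun h => by
      subst h; exact Finset.disjoint_left.1 hd hi hj
    have := G.count_of_two_private (hI hi) (hI' hj) hij hv hw
    omega
  · obtain ⟨i, hi, hv, hw⟩ := h1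
    have := key i (hI hi) hv hw
    omega
  · obtain ⟨i, hi, hv, hw⟩ := h2
    have := key i (hI' hi) hv hw
    omega
  · omega

open scoped Classical in
/-- The partition formed by the private parts of the members of `I` and the rest has a part of
cut value at most the number of hyperedges cut. -/
theorem opt_le_cutBy {k : ℕ} {c : ℕ} {B : Fin n → Finset (Fin n)} {S I : Finset (Fin n)}
    (hopt : ∀ Q : Fin k → Finset (Fin n), IsKPartition Q → c ≤ G.maxCut Q)
    (hI : I ⊆ S) (hk : I.card + 1 = k) (hown : ∀ i ∈ S, OnlyIn B S i i)
    (hrest : ∃ v, ∀ i ∈ S, ¬ OnlyIn B S i v) :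
    c ≤ ∑ e, if G.CutBy B S I e then 1 else 0 := by
  subst hk
  let f := I.equivFin.symm
  let Y : Fin I.card → Finset (Fin n) := fun j => Finset.univ.filter fun v => OnlyIn B S (f j) v
  let R : Finset (Fin n) := Finset.univ.filter fun v => ∀ i ∈ I, ¬ OnlyIn B S i v
  let Q : Fin (I.card + 1) → Finset (Fin n) := Fin.cons R Y
  have hfI : ∀ j, (f j : Fin n) ∈ I := fun j => (f j).2
  have hYY : ∀ i j, i ≠ j → Disjoint (Y i) (Y j) := by
    intro i j hij
    rw [Finset.disjoint_left]
    intro v hv hw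
    simp only [Y, Finset.mem_filter, Finset.mem_univ, true_and] at hv hw
    have : (f i : Fin n) ≠ f j := fun h => hij (f.injective (Subtype.ext h))
    exact hw.1 (hv.2 _ (hI (hfI j)) (Ne.symm this))
  have hRY : ∀ i, Disjoint R (Y i) := by
    intro i
    rw [Finset.disjoint_left]
    intro v hv hw
    simp only [Y, R, Finset.mem_filter, Finset.mem_univ, true_and] at hv hw
    exact hv _ (hfI i) hw
  have hQ : IsKPartition Q := by
    refine ⟨?_, ?_, ?_⟩
    · intro i
      refine Fin.cases ?_ (fun j => ?_) i
      · obtain ⟨v, hv⟩ := hrest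
        exact ⟨v, by simpa [Q, R] using fun i hi => hv i (hI hi)⟩
      · exact ⟨f j, by simpa [Q, Y] using hown _ (hI (hfI j))⟩
    · intro i
      refine Fin.cases ?_ (fun i => ?_) i <;> intro j <;> refine Fin.cases ?_ (fun j => ?_) j
      · simp
      · intro _; simpa [Q] using hRY j
      · intro _; simpa [Q] using (hRY i).symm
      · intro h; simpa [Q] using hYY i j fun h' => h (by rw [h'])
    · intro v
      by_cases h : ∀ i ∈ I, ¬ OnlyIn B S i v
      · exact ⟨0, by simpa [Q, R] using h⟩
      · push Not at h
        obtain ⟨i, hi, hv⟩ := h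
        refine ⟨Fin.succ (f.symm ⟨i, hi⟩), ?_⟩
        simpa [Q, Y] using hv
  -- A hyperedge cut by any one part, the rest included, meets some private part from `I` without
  -- being contained in it. So every single part obeys the same bound.
  refine (hopt Q hQ).trans (Finset.sup_le fun i _ => ?_)
  rw [d_eq_sum]
  refine Finset.sum_le_sum fun e _ => ?_
  split_ifs with h1 h2
  · exact le_rfl
  · exfalso
    apply h2
    rw [mem_delta] at h1
    revert h1
    refine Fin.cases ?_ (fun j => ?_) i
    · rintro ⟨⟨v, hv, hvR⟩, ⟨w, hw, hwR⟩⟩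
      simp only [Q, R, Fin.cons_zero, Finset.mem_filter, Finset.mem_univ, true_and] at hvR hwR
      push Not at hwR
      obtain ⟨i, hi, hwi⟩ := hwR
      exact ⟨i, hi, ⟨w, hw, hwi⟩, ⟨v, hv, hvR i hi⟩⟩
    · rintro ⟨⟨v, hv, hvR⟩, ⟨w, hw, hwR⟩⟩
      simp only [Q, Y, Fin.cons_succ, Finset.mem_filter, Finset.mem_univ, true_and] at hvR hwR
      exact ⟨f j, hfI j, ⟨v, hv, hvR⟩, ⟨w, hw, hwR⟩⟩
  · exact Nat.zero_le _
  · exact le_rfl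

theorem exists_two_disjoint {S : Finset (Fin n)} {a : ℕ} (h : 2 * a ≤ S.card) :
    ∃ I I' : Finset (Fin n), I ⊆ S ∧ I' ⊆ S ∧ Disjoint I I' ∧ I.card = a ∧ I'.card = a := by
  obtain ⟨I, hI, hIc⟩ := Finset.exists_subset_card_eq (s := S) (n := a) (by omega)
  obtain ⟨I', hI', hIc'⟩ := Finset.exists_subset_card_eq (s := S \ I) (n := a) (by
    rw [Finset.card_sdiff_of_subset hI]; omega)
  exact ⟨I, I', hI, hI'.trans Finset.sdiff_subset,
    (Finset.disjoint_sdiff).mono_right hI', hIc, hIc'⟩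

/-- Every `A` between `S` and `U` of cut value at most that of `U` has the same cut set as `U`. -/
def Pins (U S : Finset (Fin n)) : Prop :=
  ∀ A, S ⊆ A → A ⊆ U → G.d A ≤ G.d U → G.delta A = G.delta U

/-- If the cut value of `U` is at most the optimum minmax value, few vertices of `U` determine the
cut set of `U`. -/
theorem exists_pins {k : ℕ} (hk : 2 ≤ k) {U : Finset (Fin n)} (hU : U.Nonempty)
    (hU' : Uᶜ.Nonempty)
    (hopt : ∀ Q : Fin k → Finset (Fin n), IsKPartition Q → G.d U ≤ G.maxCut Q) :
    ∃ S ⊆ U, S.Nonempty ∧ S.card ≤ 2 * k - 1 ∧ G.Pins U S := by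
  classical
  -- Pinning is monotone in `S`, so an empty pinning set may be replaced by any single vertex of
  -- `U`.
  suffices h : ∃ S ⊆ U, S.card ≤ 2 * k - 1 ∧ G.Pins U S by
    obtain ⟨S, hSU, hc, hS⟩ := h
    rcases S.eq_empty_or_nonempty with rfl | hne
    · obtain ⟨x, hx⟩ := hU
      refine ⟨{x}, by simpa using hx, by simp, by simp; omega, fun A _ => hS A (by simp)⟩
    · exact ⟨S, hSU, hne, hc, hS⟩
  have hex : ∃ S, S ⊆ U ∧ G.Pins U S :=
    ⟨U, subset_rfl, fun A h1 h2 _ => by rw [Finset.Subset.antisymm h2 h1]⟩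
  obtain ⟨S, hSmin⟩ := Set.Finite.exists_minimal (s := {S | S ⊆ U ∧ G.Pins U S})
    (Set.toFinite _) hex
  obtain ⟨hSU, hS⟩ := hSmin.1
  refine ⟨S, hSU, ?_, hS⟩
  by_contra hcard
  have hcard : 2 * k ≤ S.card := by omega
  -- a bad set for every `u`
  have hbad : ∀ u ∈ S, ∃ B, S.erase u ⊆ B ∧ B ⊆ U ∧ G.d B ≤ G.d U ∧ G.delta B ≠ G.delta U ∧
      ∀ B', S.erase u ⊆ B' → B' ⊆ U → G.d B ≤ G.d B' := by
    intro u hu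
    have hne : ({B | S.erase u ⊆ B ∧ B ⊆ U ∧ G.d B ≤ G.d U ∧ G.delta B ≠ G.delta U} :
        Set (Finset (Fin n))).Nonempty := by
      by_contra hcon
      have : G.Pins U (S.erase u) := by
        intro A h1 h2 h3
        by_contra h4
        exact hcon ⟨A, h1, h2, h3, h4⟩
      have := hSmin.2 (y := S.erase u) ⟨(Finset.erase_subset _ _).trans hSU, this⟩
        (Finset.erase_subset _ _) hu
      simp at this
    -- A violator of least cut value is best in the whole interval: a set of smaller value has value
    -- below `d(U)`, so its cut set differs from `δ(U)` and it is a violator as well.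
    obtain ⟨B, ⟨h1, h2, h3, h4⟩, hmin⟩ := Set.exists_min_image _ G.d (Set.toFinite _) hne
    refine ⟨B, h1, h2, h3, h4, fun B' h1' h2' => ?_⟩
    by_contra hlt
    push Not at hlt
    refine absurd (hmin B' ⟨h1', h2', by omega, fun h => ?_⟩) (by omega)
    have : G.d B' = G.d U := by simp [d, h]
    omega
  choose! B hB1 hB2 hB3 hB4 hB5 using hbad
  -- Otherwise `S ⊆ B u ⊆ U`, and the pinning property of `S` would apply to `B u`.
  have huB : ∀ u ∈ S, u ∉ B u := by
    intro u hu hmem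
    refine hB4 u hu (hS _ (fun x hx => ?_) (hB2 u hu) (hB3 u hu))
    by_cases h : x = u
    · rwa [h]
    · exact hB1 u hu (Finset.mem_erase.2 ⟨h, hx⟩)
  have hown : ∀ i ∈ S, OnlyIn B S i i := fun i hi =>
    ⟨huB i hi, fun j hj hji => hB1 j hj (Finset.mem_erase.2 ⟨hji.symm, hi⟩)⟩
  -- All complements contain `Uᶜ`, so any two of them overlap there. Hence the uncrossed sets stay
  -- inside `U` and compete with `B u`.
  have hout : ∀ v, v ∉ U → ∀ T ⊆ S, 2 ≤ T.card → v ∈ overlap B T := by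
    intro v hv T hT h2
    simp only [overlap, Finset.mem_filter, Finset.mem_univ, true_and]
    rwa [Finset.filter_true_of_mem]
    exact fun u hu h => hv (hB2 u (hT hu) h)
  obtain ⟨z, hz⟩ := hU'
  rw [Finset.mem_compl] at hz
  have hrest : ∃ v, ∀ i ∈ S, ¬ OnlyIn B S i v := by
    refine ⟨z, fun i hi hzi => ?_⟩
    obtain ⟨j, hj⟩ : (S.erase i).Nonempty := by
      rw [← Finset.card_pos, Finset.card_erase_of_mem hi]; omega
    rw [Finset.mem_erase] at hj
    exact hz (hB2 j hj.2 (hzi.2 j hj.2 hj.1))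
  have hsum := G.sum_meetCount_le B S S (G.d U) hB3 (fun u hu T hT h2 => by
    refine hB5 u hu _ ((hB1 u hu).trans Finset.subset_union_left)
      (Finset.union_subset (hB2 u hu) fun v hv => ?_)
    by_contra hvU
    exact Finset.mem_compl.1 hv (hout v hvU T hT h2)) subset_rfl
  have hmin2 : min 2 S.card = 2 := by omega
  rw [hmin2] at hsum
  -- tightness
  have htight : ∀ I I' : Finset (Fin n), I ⊆ S → I' ⊆ S → Disjoint I I' → I.card = k - 1 →
      I'.card = k - 1 → ∀ e, (if G.CutBy B S I e then 1 else 0) +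
        (if G.CutBy B S I' e then 1 else 0) + min 2 (G.insideCount B S e) =
          min 2 (G.meetCount B S e) := by
    intro I I' hI hI' hd hc hc' e
    have h1 := G.opt_le_cutBy hopt hI (by omega) hown hrest
    have h2 := G.opt_le_cutBy hopt hI' (by omega) hown hrest
    refine (Finset.sum_eq_sum_iff_of_le (s := Finset.univ)
      (fun e _ => G.cutBy_le e hI hI' hd)).1 ?_ e (Finset.mem_univ _)
    refine le_antisymm (Finset.sum_le_sum fun e _ => G.cutBy_le e hI hI' hd) ?_
    rw [Finset.sum_add_distrib, Finset.sum_add_distrib]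
    omega
  obtain ⟨I0, I0', hI0, hI0', hd0, hc0, hc0'⟩ := exists_two_disjoint (S := S) (a := k - 1) (by omega)
  -- hyperedges cut by the overlap
  have hW : ∀ e ∈ G.delta (overlap B S), ∃ i ∈ S, ∃ j ∈ S, i ≠ j ∧
      (∃ v ∈ G.edge e, OnlyIn B S i v) ∧ ∃ v ∈ G.edge e, OnlyIn B S j v := by
    intro e he
    rw [mem_delta] at he
    obtain ⟨⟨v, hv, hvW⟩, ⟨w, hw, hwW⟩⟩ := he
    simp only [overlap, Finset.mem_filter, Finset.mem_univ, true_and] at hvW hwW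
    have hJ : 2 ≤ G.meetCount B S e :=
      hvW.trans (Finset.card_le_card (Finset.monotone_filter_right _ fun _ _ h => ⟨v, hv, h⟩))
    have hK : G.insideCount B S e < 2 := by
      refine lt_of_le_of_lt (Finset.card_le_card (Finset.monotone_filter_right _
        fun u _ h => ?_)) (not_le.1 hwW)
      exact h.2 w hw
    -- At this hyperedge the meet count is at least two and the inside count at most one, so the
    -- equality `htight` requires that one of the two cut indicators is one.
    have step : ∀ I I' : Finset (Fin n), I ⊆ S → I' ⊆ S → Disjoint I I' → I.card = k - 1 →
        I'.card = k - 1 → ∃ i ∈ S, (i ∈ I ∨ i ∈ I') ∧ ∃ v ∈ G.edge e, OnlyIn B S i v := by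
      intro I I' hI hI' hd hc hc'
      have := htight I I' hI hI' hd hc hc' e
      by_cases h1 : G.CutBy B S I e
      · obtain ⟨i, hi, h, -⟩ := h1
        exact ⟨i, hI hi, .inl hi, h⟩
      by_cases h2 : G.CutBy B S I' e
      · obtain ⟨i, hi, h, -⟩ := h2
        exact ⟨i, hI' hi, .inr hi, h⟩
      rw [if_neg h1, if_neg h2] at this
      omega
    obtain ⟨i, hi, -, hiv⟩ := step I0 I0' hI0 hI0' hd0 hc0 hc0'
    -- Choosing both index sets away from `i` produces a second private part met by the same
    -- hyperedge.
    obtain ⟨I1, I1', hI1, hI1', hd1, hc1, hc1'⟩ :=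
      exists_two_disjoint (S := S.erase i) (a := k - 1) (by
        rw [Finset.card_erase_of_mem hi]; omega)
    obtain ⟨j, hj, hj', hjv⟩ := step I1 I1' (hI1.trans (Finset.erase_subset _ _))
      (hI1'.trans (Finset.erase_subset _ _)) hd1 hc1 hc1'
    refine ⟨i, hi, j, hj, ?_, hiv, hjv⟩
    rcases hj' with h | h
    · exact (Finset.ne_of_mem_erase (hI1 h)).symm
    · exact (Finset.ne_of_mem_erase (hI1' h)).symm
  -- A hyperedge cut by the overlap contributes two to the difference of the totals, and this
  -- difference is at most `2 d(U)`.
  have hdW : G.d (overlap B S) ≤ G.d U := by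
    have : ∑ e, (2 * (if e ∈ G.delta (overlap B S) then 1 else 0) + min 2 (G.insideCount B S e)) ≤
        ∑ e, min 2 (G.meetCount B S e) := by
      refine Finset.sum_le_sum fun e _ => ?_
      split_ifs with h
      · obtain ⟨i, hi, j, hj, hij, hv, hw⟩ := hW e h
        have := G.count_of_two_private hi hj hij hv hw
        omega
      · have := G.insideCount_le_meetCount B S e
        omega
    rw [Finset.sum_add_distrib, ← Finset.mul_sum, ← d_eq_sum] at this
    omega
  -- Each `u ∈ S` is missing from `B u` only, so the complement of the overlap contains `S`; it also
  -- lies in `U`, and `S` pins it.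
  have hδ : G.delta (overlap B S) = G.delta U := by
    rw [← delta_compl]
    refine hS _ (fun u hu => ?_) (fun v hv => ?_) (by rwa [d_compl])
    · simp only [overlap, Finset.mem_compl, Finset.mem_filter, Finset.mem_univ, true_and, not_le]
      refine lt_of_le_of_lt (Finset.card_le_card (t := {u}) fun x hx => ?_) (by simp)
      rw [Finset.mem_filter] at hx
      rw [Finset.mem_singleton]
      by_contra hne
      exact hx.2 ((hown u hu).2 x hx.1 hne)
    · by_contra hvU
      exact Finset.mem_compl.1 hv (hout v hvU S subset_rfl (by omega))
  obtain ⟨u, hu⟩ : S.Nonempty := by rw [← Finset.card_pos]; omega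
  -- As `d(B u) ≤ d(U)` and the cut sets differ, a hyperedge of `δ(U)` is missing from `δ(B u)`. It
  -- is cut by the overlap, so it meets the private part of some `i ≠ u`, which lies in `B u`; and
  -- it leaves `U ⊇ B u`. So it is in `δ(B u)` after all.
  obtain ⟨e, heU, heB⟩ : ∃ e ∈ G.delta U, e ∉ G.delta (B u) := by
    by_contra hcon
    push Not at hcon
    exact hB4 u hu (Finset.eq_of_subset_of_card_le hcon (hB3 u hu)).symm
  have hpriv : ∃ v ∈ G.edge e, v ∈ B u := by
    obtain ⟨i, hi, j, hj, hij, ⟨v, hv, hv'⟩, ⟨w, hw, hw'⟩⟩ := hW e (hδ ▸ heU)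
    by_cases h : i = u
    · exact ⟨w, hw, hw'.2 u hu (fun h' => hij (h.trans h'))⟩
    · exact ⟨v, hv, hv'.2 u hu (fun h' => h h'.symm)⟩
  rw [mem_delta] at heU heB
  obtain ⟨-, x, hx, hxU⟩ := heU
  exact heB ⟨hpriv, x, hx, fun h => hxU (hB2 u hu h)⟩

end Uncrossing

end MultiHypergraph

namespace MultiHypergraph

/-! ### Submodularity, the candidates, and the correctness of the enumeration. -/

section Recover

variable {n m k : ℕ} (G : MultiHypergraph n m)

theorem d_inter_add_d_union_le (A B : Finset (Fin n)) :
    G.d (A ∩ B) + G.d (A ∪ B) ≤ G.d A + G.d B := by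
  classical
  simp only [d_eq_sum, ← Finset.sum_add_distrib]
  refine Finset.sum_le_sum fun e _ => ?_
  have h1 : e ∈ G.delta (A ∩ B) → e ∈ G.delta A ∨ e ∈ G.delta B := by
    simp only [mem_delta, Finset.mem_inter]
    rintro ⟨⟨v, hv, hvA, hvB⟩, w, hw, hw'⟩
    by_cases h : w ∈ A
    · exact .inr ⟨⟨v, hv, hvB⟩, w, hw, fun h' => hw' ⟨h, h'⟩⟩
    · exact .inl ⟨⟨v, hv, hvA⟩, w, hw, h⟩
  have h2 : e ∈ G.delta (A ∪ B) → e ∈ G.delta A ∨ e ∈ G.delta B := by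
    simp only [mem_delta, Finset.mem_union, not_or]
    rintro ⟨⟨v, hv, hvA | hvB⟩, w, hw, hwA, hwB⟩
    · exact .inl ⟨⟨v, hv, hvA⟩, w, hw, hwA⟩
    · exact .inr ⟨⟨v, hv, hvB⟩, w, hw, hwB⟩
  have h3 : e ∈ G.delta (A ∩ B) → e ∈ G.delta (A ∪ B) → e ∈ G.delta A ∧ e ∈ G.delta B := by
    simp only [mem_delta, Finset.mem_inter, Finset.mem_union, not_or]
    rintro ⟨⟨v, hv, hvA, hvB⟩, -⟩ ⟨-, w, hw, hwA, hwB⟩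
    exact ⟨⟨⟨v, hv, hvA⟩, w, hw, hwA⟩, ⟨v, hv, hvB⟩, w, hw, hwB⟩
  by_cases a : e ∈ G.delta (A ∩ B) <;> by_cases b : e ∈ G.delta (A ∪ B) <;>
    by_cases c : e ∈ G.delta A <;> by_cases f : e ∈ G.delta B <;> simp_all

/-- By submodularity the intersection of two minimum terminal cuts is again one, so a minimal one
lies inside every other. -/
theorem sourceMinimal_subset {S T U W : Finset (Fin n)} (hU : G.IsSourceMinimalMinCut S T U)
    (hW : G.IsMinTerminalCut S T W) : U ⊆ W := by
  have h1 : IsTerminalCut S T (U ∩ W) :=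
    ⟨Finset.subset_inter hU.1.1.1 hW.1.1, hW.1.2.mono_left Finset.inter_subset_right⟩
  have h2 : IsTerminalCut S T (U ∪ W) :=
    ⟨hW.1.1.trans Finset.subset_union_right, Finset.disjoint_union_left.2 ⟨hU.1.1.2, hW.1.2⟩⟩
  have h3 := G.d_inter_add_d_union_le U W
  have h4 := hU.1.2 _ h2
  have h5 := hW.2 _ h1
  have h6 := hU.1.2 _ hW.1
  have h7 := hW.2 _ hU.1.1
  have h8 : G.IsMinTerminalCut S T (U ∩ W) := ⟨h1, fun X hX => by
    have := hW.2 _ hX; omega⟩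
  exact (hU.2 h8 Finset.inter_subset_left).trans Finset.inter_subset_right

theorem sourceMinimal_unique {S T U W : Finset (Fin n)} (hU : G.IsSourceMinimalMinCut S T U)
    (hW : G.IsSourceMinimalMinCut S T W) : U = W :=
  Finset.Subset.antisymm (G.sourceMinimal_subset hU hW.1) (G.sourceMinimal_subset hW hU.1)

theorem exists_sourceMinimal_subset {S T U : Finset (Fin n)} (hU : G.IsMinTerminalCut S T U) :
    ∃ A ⊆ U, G.IsSourceMinimalMinCut S T A := by
  obtain ⟨A, hA, hmin⟩ := (Set.toFinite {A | G.IsMinTerminalCut S T A}).exists_le_minimal hU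
  exact ⟨A, hA, hmin⟩

theorem mem_candidates {U : Finset (Fin n)} : U ∈ G.candidates k ↔
    ∃ S T : Finset (Fin n), S.Nonempty ∧ T.Nonempty ∧ Disjoint S T ∧
      S.card ≤ 2 * k - 1 ∧ T.card ≤ 2 * k - 1 ∧ G.IsSourceMinimalMinCut S T U := by
  simp [candidates]

theorem candidates_nonempty {U : Finset (Fin n)} (hU : U ∈ G.candidates k) : U.Nonempty := by
  obtain ⟨S, T, hS, -, -, -, -, h⟩ := G.mem_candidates.1 hU
  exact hS.mono h.1.1.1

/-- Pin `U` by `S` and its complement by `T`. For a terminal cut `W` pinning gives `d(W ∩ U) ≥ d(U)`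
and `d(W ∪ U) ≥ d(U)`, and submodularity turns this into `d(W) ≥ d(U)`. The source minimal cut
inside `U` contains `S`, so it has the cut set of `U`. -/
theorem exists_candidate (hk : 2 ≤ k) {U : Finset (Fin n)} (hU : U.Nonempty) (hU' : Uᶜ.Nonempty)
    (hopt : ∀ Q : Fin k → Finset (Fin n), IsKPartition Q → G.d U ≤ G.maxCut Q) :
    ∃ A ∈ G.candidates k, A ⊆ U ∧ G.delta A = G.delta U := by
  obtain ⟨S, hSU, hSne, hSc, hS⟩ := G.exists_pins hk hU hU' hopt
  obtain ⟨T, hTU, hTne, hTc, hT⟩ := G.exists_pins (U := Uᶜ) hk hU' (by simpa using hU)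
    (by simpa only [d_compl] using hopt)
  -- Pinning yields equal cut sets, hence equal values, for every set of value at most `d(U)`; a
  -- strictly smaller value is thereby impossible.
  have hpinS : ∀ A, S ⊆ A → A ⊆ U → G.d U ≤ G.d A := by
    intro A h1 h2
    by_contra h
    have := hS A h1 h2 (by omega)
    simp [d, this] at h
  have hpinT : ∀ A, Disjoint A T → U ⊆ A → G.d U ≤ G.d A := by
    intro A h1 h2
    by_contra h
    have := hT Aᶜ (fun x hx => by
      rw [Finset.mem_compl]; exact fun hA => Finset.disjoint_left.1 h1 hA hx)
      (Finset.compl_subset_compl.2 h2) (by simp only [d_compl]; omega)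
    simp only [delta_compl] at this
    simp [d, this] at h
  have hUmin : G.IsMinTerminalCut S T U := by
    have hUT : Disjoint U T := by
      rw [Finset.disjoint_left]
      exact fun x hx hx' => Finset.mem_compl.1 (hTU hx') hx
    refine ⟨⟨hSU, hUT⟩, fun W hW => ?_⟩
    have h1 := G.d_inter_add_d_union_le W U
    have h2 := hpinS (W ∩ U) (Finset.subset_inter hW.1 hSU) Finset.inter_subset_right
    have h3 := hpinT (W ∪ U) (Finset.disjoint_union_left.2 ⟨hW.2, hUT⟩) Finset.subset_union_right
    omega
  obtain ⟨A, hAU, hA⟩ := G.exists_sourceMinimal_subset hUmin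
  refine ⟨A, G.mem_candidates.2 ⟨S, T, hSne, hTne, ?_, hSc, hTc, hA⟩, hAU,
    hS A hA.1.1.1 hAU (hA.1.2 _ hUmin.1)⟩
  exact hUmin.1.2.mono_left hSU

/-! ### The cardinality of the family -/

/-- Words of length `r` may repeat letters, so they spell the smaller non-empty sets too. -/
theorem exists_image_eq {S : Finset (Fin n)} {r : ℕ} (hS : S.Nonempty) (hc : S.card ≤ r) :
    ∃ f : Fin r → Fin n, Finset.univ.image f = S := by
  obtain ⟨s, hs⟩ := hS
  refine ⟨fun j => if h : j.1 < S.card then (S.equivFin.symm ⟨j, h⟩ : Fin n) else s, ?_⟩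
  ext x
  simp only [Finset.mem_image, Finset.mem_univ, true_and]
  constructor
  · rintro ⟨j, rfl⟩
    split_ifs with h
    · exact (S.equivFin.symm ⟨j, h⟩).2
    · exact hs
  · intro hx
    refine ⟨⟨S.equivFin ⟨x, hx⟩, (S.equivFin ⟨x, hx⟩).2.trans_le hc⟩, ?_⟩
    simp

-- A candidate is determined by `(S, T)`, and each of the two sets is spelled by a word of length
-- `2k - 1`.
open scoped Classical in
theorem card_candidates_le : (G.candidates k).card ≤ n ^ (4 * k - 2) := by
  let cut : (Fin (2 * k - 1) → Fin n) × (Fin (2 * k - 1) → Fin n) → Finset (Fin n) := fun p =>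
    if h : ∃ U, G.IsSourceMinimalMinCut (Finset.univ.image p.1) (Finset.univ.image p.2) U then
      h.choose else ∅
  have hsub : G.candidates k ⊆ Finset.univ.image cut := by
    intro U hU
    obtain ⟨S, T, hS, hT, -, hSc, hTc, h⟩ := G.mem_candidates.1 hU
    obtain ⟨f, rfl⟩ := exists_image_eq hS hSc
    obtain ⟨g, rfl⟩ := exists_image_eq hT hTc
    refine Finset.mem_image.2 ⟨(f, g), Finset.mem_univ _, ?_⟩
    have hex : ∃ U, G.IsSourceMinimalMinCut (Finset.univ.image f) (Finset.univ.image g) U := ⟨U, h⟩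
    simp only [cut, dif_pos hex]
    exact G.sourceMinimal_unique hex.choose_spec h
  refine (Finset.card_le_card hsub).trans (Finset.card_image_le.trans ?_)
  rw [Finset.card_univ, Fintype.card_prod, Fintype.card_fun, Fintype.card_fin, Fintype.card_fin,
    ← pow_add]
  exact (congrArg (n ^ ·) (by omega)).le

theorem card_candidates_pow_le : (G.candidates k).card ^ k ≤ n ^ (4 * k ^ 2 - 2 * k) := by
  refine (Nat.pow_le_pow_left G.card_candidates_le k).trans ?_
  rw [← pow_mul, Nat.sub_mul, pow_two, mul_assoc]

theorem card_enumMinMaxReps_le : (G.enumMinMaxReps k).card ≤ n ^ (4 * k ^ 2 - 2 * k) := by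
  classical
  refine le_trans ?_ (G.card_candidates_pow_le (k := k))
  refine (Finset.card_filter_le _ _).trans ((Finset.card_filter_le _ _).trans ?_)
  simp

/-! ### Recovering a partition -/

theorem adjAvoiding_symm {X : Finset (Fin m)} {u v : Fin n} (h : G.AdjAvoiding X u v) :
    G.AdjAvoiding X v u := by
  obtain ⟨e, h1, h2, h3⟩ := h
  exact ⟨e, h1, h3, h2⟩

theorem mem_component {X : Finset (Fin m)} {u v : Fin n} :
    v ∈ G.component X u ↔ Relation.ReflTransGen (G.AdjAvoiding X) u v := by
  simp [component]

theorem reach_symm {X : Finset (Fin m)} {u v : Fin n}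
    (h : Relation.ReflTransGen (G.AdjAvoiding X) u v) :
    Relation.ReflTransGen (G.AdjAvoiding X) v u := by
  induction h with
  | refl => exact .refl
  | tail _ h ih => exact .head (G.adjAvoiding_symm h) ih

theorem component_eq {X : Finset (Fin m)} {u v : Fin n} (h : v ∈ G.component X u) :
    G.component X v = G.component X u := by
  rw [mem_component] at h
  ext w
  rw [mem_component, mem_component]
  exact ⟨h.trans, (G.reach_symm h).trans⟩

theorem mem_of_reach {X : Finset (Fin m)} {A : Finset (Fin n)} (hA : G.delta A ⊆ X) {u v : Fin n}
    (h : Relation.ReflTransGen (G.AdjAvoiding X) u v) (hu : u ∈ A) : v ∈ A := by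
  induction h with
  | refl => exact hu
  | tail _ h ih =>
    obtain ⟨e, he, h1, h2⟩ := h
    by_contra hv
    exact he (hA (G.mem_delta.2 ⟨⟨_, h1, ih⟩, _, h2, hv⟩))

theorem pairwise_componentsOff (X : Finset (Fin m)) (Y : Finset (Fin n)) :
    (G.componentsOff X Y).Pairwise Disjoint := by
  classical
  unfold componentsOff
  refine List.Pairwise.filter _ ?_
  rw [List.pairwise_map]
  have : ((List.finRange n).filter fun v => ∀ w ∈ G.component X v, v ≤ w).Pairwise (· ≠ ·) :=
    (List.nodup_finRange n).filter _
  refine this.imp_of_mem fun {a b} ha hb hne => ?_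
  simp only [List.mem_filter, decide_eq_true_eq] at ha hb
  rw [Finset.disjoint_left]
  intro x hxa hxb
  have h := (G.component_eq hxa).symm.trans (G.component_eq hxb)
  have h1 : a ∈ G.component X a := G.mem_component.2 .refl
  have h2 : b ∈ G.component X b := G.mem_component.2 .refl
  exact hne (le_antisymm (ha.2 b (h ▸ h2)) (hb.2 a (h ▸ h1)))

theorem of_mem_componentsOff {X : Finset (Fin m)} {Y C : Finset (Fin n)}
    (h : C ∈ G.componentsOff X Y) : Disjoint C Y ∧ ∃ v, C = G.component X v := by
  simp only [componentsOff, List.mem_filter, List.mem_map, decide_eq_true_eq] at h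
  obtain ⟨⟨v, -, rfl⟩, h⟩ := h
  exact ⟨h, v, rfl⟩

theorem component_mem_componentsOff {X : Finset (Fin m)} {Y : Finset (Fin n)} {v : Fin n}
    (h : Disjoint (G.component X v) Y) : G.component X v ∈ G.componentsOff X Y := by
  simp only [componentsOff, List.mem_filter, List.mem_map, decide_eq_true_eq]
  refine ⟨?_, h⟩
  have hne : (G.component X v).Nonempty := ⟨v, G.mem_component.2 .refl⟩
  refine ⟨(G.component X v).min' hne, ⟨List.mem_finRange _, fun w hw => ?_⟩, ?_⟩
  · rw [G.component_eq ((G.component X v).min'_mem hne)] at hw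
    exact Finset.min'_le _ _ hw
  · exact G.component_eq ((G.component X v).min'_mem hne)

/-- `P` arises from `U` by enlarging the members without changing their cut sets. -/
structure Extends (U P : Fin k → Finset (Fin n)) : Prop where
  delta_eq : ∀ i, G.delta (P i) = G.delta (U i)
  subset : ∀ i, U i ⊆ P i
  disjoint : ∀ i j, i ≠ j → Disjoint (P i) (P j)

theorem absorb_spec (P : Fin k → Finset (Fin n)) (C : Finset (Fin n)) :
    (∃ i, G.delta (P i ∪ C) = G.delta (P i) ∧ G.absorb P C = Function.update P i (P i ∪ C)) ∨
      (∀ i, G.delta (P i ∪ C) ≠ G.delta (P i)) ∧ G.absorb P C = P := by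
  unfold absorb
  split
  · next i h =>
    exact .inl ⟨i, by simpa using List.find?_some h, rfl⟩
  · next h =>
    exact .inr ⟨by simpa using h, rfl⟩

theorem subset_absorb (P : Fin k → Finset (Fin n)) (C : Finset (Fin n)) (i : Fin k) :
    P i ⊆ G.absorb P C i := by
  rcases G.absorb_spec P C with ⟨j, -, h⟩ | ⟨-, h⟩
  · rw [h]
    by_cases hij : i = j
    · subst hij; simp
    · rw [Function.update_of_ne hij]
  · rw [h]

theorem absorb_subset (P : Fin k → Finset (Fin n)) (C : Finset (Fin n)) (i : Fin k) :
    G.absorb P C i ⊆ P i ∪ C := by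
  rcases G.absorb_spec P C with ⟨j, -, h⟩ | ⟨-, h⟩
  · rw [h]
    by_cases hij : i = j
    · subst hij; simp
    · rw [Function.update_of_ne hij]; exact Finset.subset_union_left
  · rw [h]; exact Finset.subset_union_left

theorem Extends.absorb {U P : Fin k → Finset (Fin n)} (h : G.Extends U P) {C : Finset (Fin n)}
    (hC : ∀ i, Disjoint (P i) C) : G.Extends U (G.absorb P C) := by
  rcases G.absorb_spec P C with ⟨i, hi, h'⟩ | ⟨-, h'⟩
  · refine ⟨fun j => ?_, fun j => (h.subset j).trans (G.subset_absorb P C j), fun a b hab => ?_⟩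
    · rw [h', ← h.delta_eq]
      by_cases hij : j = i
      · subst hij; simpa using hi
      · rw [Function.update_of_ne hij]
    · rw [h']
      by_cases ha : a = i
      · subst ha
        rw [Function.update_self, Function.update_of_ne hab.symm]
        exact Finset.disjoint_union_left.2 ⟨h.disjoint _ _ hab, (hC b).symm⟩
      · rw [Function.update_of_ne ha]
        by_cases hb : b = i
        · subst hb
          rw [Function.update_self]
          exact Finset.disjoint_union_right.2 ⟨h.disjoint _ _ hab, hC a⟩
        · rw [Function.update_of_ne hb]; exact h.disjoint _ _ hab
  · rwa [h']

/-- The last clause serves completeness. Its hypothesis speaks of every tuple that extends `U`,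
because nothing is known about where the earlier components went. -/
theorem Extends.foldl {U : Fin k → Finset (Fin n)} (L : List (Finset (Fin n)))
    (hL : L.Pairwise Disjoint) : ∀ P : Fin k → Finset (Fin n), G.Extends U P →
      (∀ C ∈ L, ∀ i, Disjoint (P i) C) →
      G.Extends U (L.foldl G.absorb P) ∧ (∀ i, P i ⊆ L.foldl G.absorb P i) ∧
      ((∀ P, G.Extends U P → (∀ C ∈ L, (∀ i, Disjoint (P i) C) →
        ∃ i, G.delta (P i ∪ C) = G.delta (P i))) →
          ∀ C ∈ L, ∃ i, C ⊆ L.foldl G.absorb P i) := by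
  induction L with
  | nil => intro P h _; exact ⟨h, fun _ => subset_rfl, by simp⟩
  | cons C L ih =>
    intro P h hdisj
    rw [List.pairwise_cons] at hL
    have h1 := Extends.absorb G h (hdisj C (by simp))
    obtain ⟨h2, h3, h4⟩ := ih hL.2 (G.absorb P C) h1 fun D hD i =>
      (Finset.disjoint_union_left.2 ⟨hdisj D (by simp [hD]) i, hL.1 D hD⟩).mono_left
        (G.absorb_subset P C i)
    refine ⟨h2, fun i => (G.subset_absorb P C i).trans (h3 i), fun hex D hD => ?_⟩
    rcases List.mem_cons.1 hD with rfl | hD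
    · obtain ⟨i, hi⟩ := hex P h D (by simp) (hdisj D (by simp))
      rcases G.absorb_spec P D with ⟨j, -, h'⟩ | ⟨h', -⟩
      · refine ⟨j, subset_trans ?_ (h3 j)⟩
        rw [h', Function.update_self]
        exact Finset.subset_union_right
      · exact absurd hi (h' i)
    · exact h4 (fun P hP C hC => hex P hP C (by simp [hC])) D hD

/-- The hyperedges cut by a member of the tuple. -/
noncomputable def crossing (U : Fin k → Finset (Fin n)) : Finset (Fin m) :=
  Finset.univ.biUnion fun i => G.delta (U i)

theorem mem_crossing {U : Fin k → Finset (Fin n)} {e : Fin m} :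
    e ∈ G.crossing U ↔ ∃ i, e ∈ G.delta (U i) := by simp [crossing]

theorem disjoint_componentsOff {U : Fin k → Finset (Fin n)} {C : Finset (Fin n)}
    (hC : C ∈ G.componentsOff (G.crossing U) (Finset.univ.biUnion U)) (i : Fin k) :
    Disjoint (U i) C :=
  ((G.of_mem_componentsOff hC).1.mono_right
    (Finset.subset_biUnion_of_mem U (Finset.mem_univ i))).symm

theorem recoverPartition_sound {U P : Fin k → Finset (Fin n)}
    (hU : ∀ i j, i ≠ j → Disjoint (U i) (U j)) (h : G.recoverPartition U = some P) :
    IsKPartition P ∧ G.IsCutSetRep U P := by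
  unfold recoverPartition at h
  simp only [Option.ite_none_right_eq_some, Option.some.injEq] at h
  obtain ⟨h1, h2⟩ := h
  rw [h2] at h1
  refine ⟨h1, hU, ?_⟩
  have := (Extends.foldl G (U := U) _ (G.pairwise_componentsOff (G.crossing U)
    (Finset.univ.biUnion U)) U ⟨fun _ => rfl, fun _ => subset_rfl, hU⟩
      (fun C hC i => G.disjoint_componentsOff hC i)).1
  change G.Extends U (List.foldl G.absorb U
    (G.componentsOff (Finset.univ.biUnion fun i => G.delta (U i)) (Finset.univ.biUnion U))) at this
  rw [h2] at this
  exact fun i => ⟨this.subset i, (this.delta_eq i).symm⟩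

/-- A member of a partition whose cut set is that of `U i` absorbs the components it contains. -/
theorem delta_union_component {U V P : Fin k → Finset (Fin n)} (hV : IsKPartition V)
    (hUV : G.IsCutSetRep U V) (hP : G.Extends U P) {x : Fin n} {i : Fin k} (hx : x ∈ V i)
    (hdisj : ∀ j, Disjoint (P j) (G.component (G.crossing U) x)) :
    G.delta (P i ∪ G.component (G.crossing U) x) = G.delta (P i) := by
  have hCV : G.component (G.crossing U) x ⊆ V i := by
    intro v hv
    refine G.mem_of_reach (X := G.crossing U) ?_ (G.mem_component.1 hv) hx
    intro e he
    rw [← (hUV.2 i).2] at he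
    exact G.mem_crossing.2 ⟨i, he⟩
  ext e
  constructor
  · intro he
    by_contra hne
    rw [mem_delta] at he
    obtain ⟨⟨v, hv, hv'⟩, ⟨w, hw, hw'⟩⟩ := he
    rw [Finset.mem_union, not_or] at hw'
    have hPe : ∀ y ∈ G.edge e, y ∉ P i := fun y hy hyP =>
      hne (G.mem_delta.2 ⟨⟨y, hy, hyP⟩, w, hw, hw'.1⟩)
    have hvC : v ∈ G.component (G.crossing U) x :=
      (Finset.mem_union.1 hv').resolve_left (hPe v hv)
    -- A hyperedge that leaves the component has been removed, so it is cut by some `U j`. Here `j ≠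
    -- i`, so it meets both `V j` and `V i` and lies in `δ(V i) = δ(P i)`.
    have hX : e ∈ G.crossing U := by
      by_contra hX
      refine hw'.2 (G.mem_component.2 ?_)
      exact (G.mem_component.1 hvC).tail ⟨e, hX, hv, hw⟩
    obtain ⟨j, hj⟩ := G.mem_crossing.1 hX
    have hji : j ≠ i := by
      rintro rfl
      exact hne (by rwa [hP.delta_eq])
    rw [(hUV.2 j).2, mem_delta] at hj
    obtain ⟨y, hy, hyV⟩ := hj.1
    apply hne
    rw [hP.delta_eq, (hUV.2 i).2, mem_delta]
    exact ⟨⟨v, hv, hCV hvC⟩, y, hy, fun h => Finset.disjoint_left.1 (hV.2.1 j i hji) hyV h⟩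
  -- A hyperedge of `δ(P i)` reaches another part `V j`, so it is cut by `U j` and has a vertex in
  -- `U j`. This vertex is neither in `P i` nor in the component, and keeps the hyperedge cut.
  · intro he
    have heV := he
    rw [hP.delta_eq, (hUV.2 i).2, mem_delta] at heV
    obtain ⟨⟨v, hv, hvV⟩, ⟨w, hw, hwV⟩⟩ := heV
    obtain ⟨j, hj⟩ := hV.2.2 w
    have hji : j ≠ i := fun h => hwV (h ▸ hj)
    have hjd : e ∈ G.delta (U j) := by
      rw [(hUV.2 j).2, mem_delta]
      exact ⟨⟨w, hw, hj⟩, v, hv, fun h => Finset.disjoint_left.1 (hV.2.1 j i hji) h hvV⟩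
    obtain ⟨⟨y, hy, hyU⟩, -⟩ := G.mem_delta.1 hjd
    obtain ⟨⟨z, hz, hzP⟩, -⟩ := G.mem_delta.1 he
    refine G.mem_delta.2 ⟨⟨z, hz, Finset.mem_union_left _ hzP⟩, y, hy, ?_⟩
    have hyP := hP.subset j hyU
    rw [Finset.mem_union, not_or]
    exact ⟨Finset.disjoint_left.1 (hP.disjoint j i hji) hyP, Finset.disjoint_left.1 (hdisj j) hyP⟩

/-- A component disjoint from the tuple is accepted by the part of `V` that contains it. A component
that meets `U i` lies in `U i`, since all of `δ(U i)` has been removed. So all vertices are covered.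
-/
theorem recoverPartition_isSome {U V : Fin k → Finset (Fin n)} (hU : ∀ i, (U i).Nonempty)
    (hV : IsKPartition V) (hUV : G.IsCutSetRep U V) : (G.recoverPartition U).isSome := by
  set L := G.componentsOff (G.crossing U) (Finset.univ.biUnion U) with hL
  obtain ⟨h1, h2, h3⟩ := Extends.foldl G (U := U) L (G.pairwise_componentsOff _ _) U
    ⟨fun _ => rfl, fun _ => subset_rfl, hUV.1⟩ (fun C hC i => G.disjoint_componentsOff hC i)
  have h4 := h3 (by
    intro P hP C hC hd
    obtain ⟨-, x, rfl⟩ := G.of_mem_componentsOff hC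
    obtain ⟨i, hi⟩ := hV.2.2 x
    exact ⟨i, G.delta_union_component hV hUV hP hi hd⟩)
  have hpart : IsKPartition (L.foldl G.absorb U) := by
    refine ⟨fun i => (hU i).mono (h2 i), h1.disjoint, fun v => ?_⟩
    by_cases hv : Disjoint (G.component (G.crossing U) v) (Finset.univ.biUnion U)
    · obtain ⟨i, hi⟩ := h4 _ (G.component_mem_componentsOff hv)
      exact ⟨i, hi (G.mem_component.2 .refl)⟩
    · rw [Finset.not_disjoint_iff] at hv
      obtain ⟨w, hw, hwU⟩ := hv
      rw [Finset.mem_biUnion] at hwU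
      obtain ⟨i, -, hi⟩ := hwU
      refine ⟨i, h2 i (G.mem_of_reach (X := G.crossing U) ?_
        (G.reach_symm (G.mem_component.1 hw)) hi)⟩
      exact fun e he => G.mem_crossing.2 ⟨i, he⟩
  have : G.recoverPartition U = some (L.foldl G.absorb U) := if_pos hpart
  rw [this]
  rfl

theorem maxCut_eq {U P : Fin k → Finset (Fin n)} (h : G.IsCutSetRep U P) :
    G.maxCut U = G.maxCut P := by
  unfold maxCut d
  simp only [fun i => (h.2 i).2]

/-- Soundness and completeness of Recover-Partition together remove the procedure from the
description of `𝒟`. Completeness needs non-empty entries, and candidates contain their non-empty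
source `S`. -/
theorem mem_recoverableTuples {U : Fin k → Finset (Fin n)} : U ∈ G.recoverableTuples k ↔
    (∀ i, U i ∈ G.candidates k) ∧ ∃ P, IsKPartition P ∧ G.IsCutSetRep U P := by
  simp only [recoverableTuples, Finset.mem_filter, Fintype.mem_piFinset]
  constructor
  · rintro ⟨h1, h2, h3⟩
    obtain ⟨P, hP⟩ := Option.isSome_iff_exists.1 h3
    exact ⟨h1, P, G.recoverPartition_sound h2 hP⟩
  · rintro ⟨h1, P, hP, h⟩
    exact ⟨h1, h.1, G.recoverPartition_isSome (fun i => G.candidates_nonempty (h1 i)) hP h⟩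

theorem mem_enumMinMaxReps {U : Fin k → Finset (Fin n)} : U ∈ G.enumMinMaxReps k ↔
    U ∈ G.recoverableTuples k ∧ ∀ W ∈ G.recoverableTuples k, G.maxCut U ≤ G.maxCut W := by
  simp only [enumMinMaxReps, Finset.mem_filter, and_congr_right_iff]
  intro hU
  constructor
  · intro h W hW
    have : G.lam k ≤ (G.maxCut W : WithTop ℕ) :=
      Finset.min_le (Finset.mem_image_of_mem _ hW)
    rw [← h] at this
    exact WithTop.coe_le_coe.1 this
  · intro h
    refine le_antisymm (Finset.le_min fun c hc => ?_)
      (Finset.min_le (Finset.mem_image_of_mem _ hU))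
    obtain ⟨W, hW, rfl⟩ := Finset.mem_image.1 hc
    exact WithTop.coe_le_coe.2 (h W hW)

theorem solvesEnumReps (hk : 2 ≤ k) : G.SolvesEnumReps (G.enumMinMaxReps k) := by
  have key : ∀ P : Fin k → Finset (Fin n), G.IsOptMinmaxPartition P →
      ∃ U ∈ G.recoverableTuples k, G.IsCutSetRep U P := by
    rintro P ⟨hP, hopt⟩
    have : ∀ i, ∃ A ∈ G.candidates k, A ⊆ P i ∧ G.delta A = G.delta (P i) := by
      intro i
      refine G.exists_candidate hk (hP.1 i) ?_ fun Q hQ =>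
        (Finset.le_sup (f := fun i => G.d (P i)) (Finset.mem_univ i)).trans (hopt Q hQ)
      obtain ⟨j, hj⟩ : ∃ j : Fin k, j ≠ i := by
        have : Nontrivial (Fin k) := Fin.nontrivial_iff_two_le.2 hk
        exact exists_ne i
      obtain ⟨v, hv⟩ := hP.1 j
      exact ⟨v, Finset.mem_compl.2 (Finset.disjoint_left.1 (hP.2.1 j i hj) hv)⟩
    choose U hU1 hU2 hU3 using this
    have hrep : G.IsCutSetRep U P :=
      ⟨fun i j hij => ((hP.2.1 i j hij).mono_left (hU2 i)).mono_right (hU2 j),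
        fun i => ⟨hU2 i, hU3 i⟩⟩
    exact ⟨U, G.mem_recoverableTuples.2 ⟨hU1, P, hP, hrep⟩, hrep⟩
  constructor
  · intro U hU
    rw [mem_enumMinMaxReps] at hU
    obtain ⟨h1, h2⟩ := hU
    obtain ⟨P, hP, hrep⟩ := (G.mem_recoverableTuples.1 h1).2
    refine ⟨P, ⟨hP, fun Q hQ => ?_⟩, hrep⟩
    -- There are finitely many k-partitions, so an optimum exists. Its representative in `𝒟` shows
    -- that the least value on `𝒟` is the optimum value.
    obtain ⟨Q', hQ', hmin⟩ := Set.exists_min_image {Q : Fin k → Finset (Fin n) | IsKPartition Q}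
      G.maxCut (Set.toFinite _) ⟨P, hP⟩
    obtain ⟨W, hW, hWQ⟩ := key Q' ⟨hQ', hmin⟩
    have := h2 W hW
    rw [G.maxCut_eq hrep, G.maxCut_eq hWQ] at this
    exact this.trans (hmin Q hQ)
  · intro P hP
    obtain ⟨U, hU, hrep⟩ := key P hP
    refine ⟨U, G.mem_enumMinMaxReps.2 ⟨hU, fun W hW => ?_⟩, hrep⟩
    obtain ⟨Q, hQ, hWQ⟩ := (G.mem_recoverableTuples.1 hW).2
    rw [G.maxCut_eq hrep, G.maxCut_eq hWQ]
    exact hP.2 Q hQ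

/-! ### A local criterion -/

/-- `v` is joined in `G - X` to a cut hyperedge that avoids `U i`. -/
def Blocked (U : Fin k → Finset (Fin n)) (i : Fin k) (v : Fin n) : Prop :=
  ∃ s, (∃ e ∈ G.crossing U, s ∈ G.edge e ∧ Disjoint (G.edge e) (U i)) ∧
    Relation.ReflTransGen (G.AdjAvoiding (G.crossing U)) s v

/-- Necessity: a cut hyperedge of a represented partition meets two parts, hence is cut by both
representatives and meets both. If `v ∈ P i` were joined to a cut hyperedge avoiding `U i`, that
hyperedge would have a vertex in `P i` and a vertex in another part, so it would be in `δ(P i) = δ(U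
i)` and meet `U i`. Sufficiency: give every remaining vertex to the first index for which it is not
blocked. Vertices of one component are blocked for the same indices, so components are not split. -/
theorem exists_partition_iff {U : Fin k → Finset (Fin n)} (hne : ∀ i, (U i).Nonempty)
    (hU : ∀ i j, i ≠ j → Disjoint (U i) (U j)) :
    (∃ P, IsKPartition P ∧ G.IsCutSetRep U P) ↔
      (∀ e ∈ G.crossing U, ∃ i j, i ≠ j ∧ ¬ Disjoint (G.edge e) (U i) ∧
        ¬ Disjoint (G.edge e) (U j)) ∧
      ∀ v, (∃ i, v ∈ U i) ∨ ∃ i, ¬ G.Blocked U i v := by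
  classical
  constructor
  · rintro ⟨P, hP, -, hrep⟩
    have h1 : ∀ e ∈ G.crossing U, ∃ i j, i ≠ j ∧ ¬ Disjoint (G.edge e) (U i) ∧
        ¬ Disjoint (G.edge e) (U j) := by
      intro e he
      obtain ⟨i, hi⟩ := G.mem_crossing.1 he
      have hi' := hi
      rw [(hrep i).2, mem_delta] at hi'
      obtain ⟨⟨v, hv, hvP⟩, w, hw, hwP⟩ := hi'
      obtain ⟨j, hj⟩ := hP.2.2 w
      have hij : i ≠ j := by rintro rfl; exact hwP hj
      have hj' : e ∈ G.delta (U j) := by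
        rw [(hrep j).2, mem_delta]
        exact ⟨⟨w, hw, hj⟩, v, hv, Finset.disjoint_left.1 (hP.2.1 i j hij) hvP⟩
      refine ⟨i, j, hij, ?_, ?_⟩
      · obtain ⟨⟨x, hx, hx'⟩, -⟩ := G.mem_delta.1 hi
        exact Finset.not_disjoint_iff.2 ⟨x, hx, hx'⟩
      · obtain ⟨⟨x, hx, hx'⟩, -⟩ := G.mem_delta.1 hj'
        exact Finset.not_disjoint_iff.2 ⟨x, hx, hx'⟩
    refine ⟨h1, fun v => .inr ?_⟩
    obtain ⟨i, hi⟩ := hP.2.2 v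
    refine ⟨i, ?_⟩
    rintro ⟨s, ⟨e, he, hs, hd⟩, hsv⟩
    have hsP : s ∈ P i := by
      refine G.mem_of_reach (X := G.crossing U) ?_ (G.reach_symm hsv) hi
      intro e he
      rw [← (hrep i).2] at he
      exact G.mem_crossing.2 ⟨i, he⟩
    obtain ⟨a, b, hab, ha, hb⟩ := h1 e he
    obtain ⟨c, hci, hc⟩ : ∃ c, c ≠ i ∧ ¬ Disjoint (G.edge e) (U c) := by
      by_cases h : a = i
      · exact ⟨b, fun h' => hab (h.trans h'.symm), hb⟩
      · exact ⟨a, h, ha⟩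
    obtain ⟨x, hx, hxU⟩ := Finset.not_disjoint_iff.1 hc
    have : e ∈ G.delta (U i) := by
      rw [(hrep i).2, mem_delta]
      exact ⟨⟨s, hs, hsP⟩, x, hx,
        Finset.disjoint_left.1 (hP.2.1 c i hci) ((hrep c).1 hxU)⟩
    obtain ⟨⟨y, hy, hyU⟩, -⟩ := G.mem_delta.1 this
    exact Finset.disjoint_left.1 hd hy hyU
  · rintro ⟨h1, h2⟩
    -- the part of a vertex outside all `U i`
    have hsel : ∀ v, ∃ i, (∀ j, v ∉ U j) → ¬ G.Blocked U i v ∧ ∀ j < i, G.Blocked U j v := by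
      intro v
      by_cases hv : ∃ j, v ∈ U j
      · obtain ⟨j, hj⟩ := hv
        exact ⟨j, fun h => absurd hj (h j)⟩
      · obtain ⟨i, hi, hmin⟩ := (Set.toFinite {i | ¬ G.Blocked U i v}).exists_minimal
          ((h2 v).resolve_left hv)
        refine ⟨i, fun _ => ⟨hi, fun j hj => ?_⟩⟩
        by_contra hb
        exact absurd (hmin (y := j) hb hj.le) (not_le.2 hj)
    choose f hf using hsel
    let P : Fin k → Finset (Fin n) := fun i =>
      U i ∪ Finset.univ.filter fun v => (∀ j, v ∉ U j) ∧ f v = i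
    have hmem : ∀ i v, v ∈ P i ↔ v ∈ U i ∨ (∀ j, v ∉ U j) ∧ f v = i := by simp [P]
    have hPd : ∀ i j, i ≠ j → Disjoint (P i) (P j) := by
      intro i j hij
      rw [Finset.disjoint_left]
      intro v hv hw
      rw [hmem] at hv hw
      rcases hv with hv | ⟨hv, hv'⟩ <;> rcases hw with hw | ⟨hw, hw'⟩
      · exact Finset.disjoint_left.1 (hU i j hij) hv hw
      · exact hw i hv
      · exact hv j hw
      · exact hij (hv'.symm.trans hw')
    have hsub : ∀ i, U i ⊆ P i := fun i v hv => (hmem i v).2 (.inl hv)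
    refine ⟨P, ⟨fun i => (hne i).mono (hsub i), hPd, fun v => ?_⟩, hU, fun i => ⟨hsub i, ?_⟩⟩
    · by_cases hv : ∃ j, v ∈ U j
      · obtain ⟨j, hj⟩ := hv
        exact ⟨j, hsub j hj⟩
      · push Not at hv
        exact ⟨f v, (hmem _ v).2 (.inr ⟨hv, rfl⟩)⟩
    · ext e
      constructor
      · intro he
        obtain ⟨a, b, hab, ha, hb⟩ := h1 e (G.mem_crossing.2 ⟨i, he⟩)
        obtain ⟨c, hci, hc⟩ : ∃ c, c ≠ i ∧ ¬ Disjoint (G.edge e) (U c) := by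
          by_cases h : a = i
          · exact ⟨b, fun h' => hab (h.trans h'.symm), hb⟩
          · exact ⟨a, h, ha⟩
        obtain ⟨x, hx, hxU⟩ := Finset.not_disjoint_iff.1 hc
        obtain ⟨⟨v, hv, hvU⟩, -⟩ := G.mem_delta.1 he
        exact G.mem_delta.2 ⟨⟨v, hv, hsub i hvU⟩, x, hx,
          Finset.disjoint_left.1 (hPd c i hci) (hsub c hxU)⟩
      · intro he
        rw [mem_delta] at he
        obtain ⟨⟨v, hv, hvP⟩, w, hw, hwP⟩ := he
        by_cases hX : e ∈ G.crossing U
        -- If the cut hyperedge avoided `U i`, each of its vertices would be blocked for `i` by a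
        -- path of length zero, and none could have been given to `i`.
        · have hnd : ¬ Disjoint (G.edge e) (U i) := by
            intro hd
            rcases (hmem i v).1 hvP with hvU | ⟨hvU, hfv⟩
            · exact Finset.disjoint_left.1 hd hv hvU
            · exact (hf v hvU).1 ⟨v, ⟨e, hX, hv, hfv ▸ hd⟩, .refl⟩
          obtain ⟨y, hy, hyU⟩ := Finset.not_disjoint_iff.1 hnd
          exact G.mem_delta.2 ⟨⟨y, hy, hyU⟩, w, hw, fun h => hwP (hsub i h)⟩
        -- A hyperedge that has not been removed lies within one component, so its vertices all go
        -- to the same part.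
        · exfalso
          have hall : ∀ j, ∀ x ∈ G.edge e, ∀ y ∈ G.edge e, x ∈ U j → y ∈ U j := by
            intro j x hx y hy hxU
            by_contra hyU
            exact hX (G.mem_crossing.2 ⟨j, G.mem_delta.2 ⟨⟨x, hx, hxU⟩, y, hy, hyU⟩⟩)
          rcases (hmem i v).1 hvP with hvU | ⟨hvU, hfv⟩
          · exact hwP (hsub i (hall i v hv w hw hvU))
          · have hwU : ∀ j, w ∉ U j := fun j h => hvU j (hall j w hw v hv h)
            have hadj : G.AdjAvoiding (G.crossing U) v w := ⟨e, hX, hv, hw⟩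
            have hblk : ∀ j, G.Blocked U j v ↔ G.Blocked U j w := fun j =>
              ⟨fun ⟨s, h, h'⟩ => ⟨s, h, h'.tail hadj⟩,
                fun ⟨s, h, h'⟩ => ⟨s, h, h'.tail (G.adjAvoiding_symm hadj)⟩⟩
            have hfw : f w = f v := by
              have hv1 := hf v hvU
              have hw1 := hf w hwU
              rcases lt_trichotomy (f w) (f v) with h | h | h
              · exact absurd ((hblk _).1 (hv1.2 _ h)) hw1.1
              · exact h
              · exact absurd ((hblk _).2 (hw1.2 _ h)) hv1.1
            exact hwP ((hmem i w).2 (.inr ⟨hwU, hfw.trans hfv⟩))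

end Recover

end MultiHypergraph

/-! ### Preflows in hypergraphs -/

/-- Each hyperedge carries a unit from its tail to its head (nothing if they coincide); `exc` is
the excess of a vertex, `lab` its distance label. -/
structure Preflow (n m : ℕ) where
  tail : Fin m → Fin n
  head : Fin m → Fin n
  exc : Fin n → ℕ
  lab : Fin n → ℕ

namespace Preflow

variable {n m : ℕ}

/-- The set `A` is closed under reversed residual arcs of the enabled hyperedges. -/
def Closed (G : MultiHypergraph n m) (en : Fin m → Prop) (t h : Fin m → Fin n)
    (A : Finset (Fin n)) : Prop :=
  ∀ e, en e → (t e ∈ A → G.edge e ⊆ A) ∧ ∀ w ∈ G.edge e, w ∈ A → h e ∈ A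

/-- `A` is the least closed set that contains `S`. -/
def IsClosure (G : MultiHypergraph n m) (en : Fin m → Prop) (t h : Fin m → Fin n)
    (S A : Finset (Fin n)) : Prop :=
  S ⊆ A ∧ Closed G en t h A ∧ ∀ A', S ⊆ A' → Closed G en t h A' → A ⊆ A'

/-- The number of hyperedges that `f` sends to `v`. -/
def fiberCard (f : Fin m → Fin n) (v : Fin n) : ℕ := (Finset.univ.filter fun e => f e = v).card

/-- A preflow with sources `T` and sinks `S` and a valid labelling. -/
structure Inv (G : MultiHypergraph n m) (S T : Finset (Fin n)) (σ : Preflow n m) : Prop where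
  tail_mem : ∀ e, σ.tail e ∈ G.edge e
  head_mem : ∀ e, σ.head e ∈ G.edge e
  lab_tail : ∀ e, ∀ u ∈ G.edge e, σ.lab u ≤ σ.lab (σ.tail e) + 1
  lab_head : ∀ e, ∀ w ∈ G.edge e, σ.lab (σ.head e) ≤ σ.lab w + 1
  lab_pos : ∀ v, 1 ≤ σ.lab v
  lab_le : ∀ v, σ.lab v ≤ n + 1
  lab_source : ∀ v ∈ T, σ.lab v = n + 1
  lab_sink : ∀ v ∈ S, σ.lab v = 1
  exc_eq : ∀ v ∉ T, σ.exc v + fiberCard σ.tail v = fiberCard σ.head v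

theorem sum_card_fiber (f : Fin m → Fin n) (A : Finset (Fin n)) :
    ∑ v ∈ A, fiberCard f v =
      (Finset.univ.filter fun e => f e ∈ A).card := by
  rw [Finset.card_eq_sum_card_fiberwise (f := f) (t := A) (by intro e he; simpa using he)]
  refine Finset.sum_congr rfl fun v hv => ?_
  unfold fiberCard
  congr 1
  ext e
  simp only [Finset.mem_filter, Finset.mem_univ, true_and]
  constructor
  · rintro rfl; exact ⟨hv, rfl⟩
  · exact fun h => h.2

variable {G : MultiHypergraph n m} {S T : Finset (Fin n)} {σ : Preflow n m}

/-- Conservation summed over `A`: units that start and end in `A` cancel. -/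
theorem Inv.sum_exc (h : Inv G S T σ) {A : Finset (Fin n)} (hA : Disjoint A T) :
    ∑ v ∈ A, σ.exc v + (Finset.univ.filter fun e => σ.tail e ∈ A ∧ σ.head e ∉ A).card =
      (Finset.univ.filter fun e => σ.tail e ∉ A ∧ σ.head e ∈ A).card := by
  have h1 : ∑ v ∈ A, σ.exc v + (Finset.univ.filter fun e => σ.tail e ∈ A).card =
      (Finset.univ.filter fun e => σ.head e ∈ A).card := by
    rw [← sum_card_fiber, ← sum_card_fiber, ← Finset.sum_add_distrib]
    exact Finset.sum_congr rfl fun v hv => h.exc_eq v (Finset.disjoint_left.1 hA hv)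
  have h2 := Finset.card_filter_add_card_filter_not (s := Finset.univ.filter fun e => σ.tail e ∈ A)
    (fun e => σ.head e ∈ A)
  have h3 := Finset.card_filter_add_card_filter_not (s := Finset.univ.filter fun e => σ.head e ∈ A)
    (fun e => σ.tail e ∈ A)
  simp only [Finset.filter_filter] at h2 h3
  have h4 : (Finset.univ.filter fun e => σ.head e ∈ A ∧ σ.tail e ∈ A) =
      Finset.univ.filter fun e => σ.tail e ∈ A ∧ σ.head e ∈ A := by
    ext e; simp [and_comm]
  have h5 : (Finset.univ.filter fun e => σ.head e ∈ A ∧ σ.tail e ∉ A) =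
      Finset.univ.filter fun e => σ.tail e ∉ A ∧ σ.head e ∈ A := by
    ext e; simp [and_comm]
  rw [h4, h5] at h3
  omega

theorem Inv.inflow_subset (h : Inv G S T σ) (A : Finset (Fin n)) :
    (Finset.univ.filter fun e => σ.tail e ∉ A ∧ σ.head e ∈ A) ⊆ G.delta A := by
  intro e he
  simp only [Finset.mem_filter, Finset.mem_univ, true_and] at he
  exact G.mem_delta.2 ⟨⟨_, h.head_mem e, he.2⟩, _, h.tail_mem e, he.1⟩

/-- Against a residual arc labels rise by at most one, starting from one on `S`. A vertex of the
closure with label `ℓ` thus comes with vertices of all labels from `1` to `ℓ`, and label `n + 1`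
would require `n + 1` vertices. -/
theorem Inv.lab_lt_of_mem_closure (h : Inv G S T σ) {A : Finset (Fin n)}
    (hA : IsClosure G (fun _ => True) σ.tail σ.head S A) {v : Fin n} (hv : v ∈ A) :
    σ.lab v ≤ n := by
  classical
  let D : Finset (Fin n) := Finset.univ.filter fun v => ∀ ℓ, 1 ≤ ℓ → ℓ ≤ σ.lab v → ∃ w, σ.lab w = ℓ
  have hstep : ∀ u w, σ.lab u ≤ σ.lab w + 1 → w ∈ D → u ∈ D := by
    intro u w huw hw
    simp only [D, Finset.mem_filter, Finset.mem_univ, true_and] at hw ⊢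
    intro ℓ h1 h2
    rcases Nat.lt_or_ge (σ.lab w) ℓ with h3 | h3
    · exact ⟨u, by omega⟩
    · exact hw ℓ h1 h3
  have hD : A ⊆ D := by
    refine hA.2.2 D (fun s hs => ?_) fun e _ => ⟨fun ht u hu => ?_, fun w hw hwD => ?_⟩
    · simp only [D, Finset.mem_filter, Finset.mem_univ, true_and]
      intro ℓ h1 h2
      exact ⟨s, by have := h.lab_sink s hs; omega⟩
    · exact hstep u _ (h.lab_tail e u hu) ht
    · exact hstep _ w (h.lab_head e w hw) hwD
  by_contra hlt
  have hvD := hD hv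
  simp only [D, Finset.mem_filter, Finset.mem_univ, true_and] at hvD
  have : Finset.Icc 1 (n + 1) ⊆ Finset.univ.image σ.lab := by
    intro ℓ hℓ
    rw [Finset.mem_Icc] at hℓ
    obtain ⟨w, hw⟩ := hvD ℓ hℓ.1 (by omega)
    exact Finset.mem_image.2 ⟨w, Finset.mem_univ _, hw⟩
  have h2 := (Finset.card_le_card this).trans Finset.card_image_le
  simp at h2

/-- A preflow without active vertices yields the source minimal minimum cut. -/
theorem Inv.isSourceMinimalMinCut (h : Inv G S T σ)
    (hact : ∀ v ∉ S, σ.lab v ≤ n → σ.exc v = 0) {A : Finset (Fin n)}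
    (hA : IsClosure G (fun _ => True) σ.tail σ.head S A) : G.IsSourceMinimalMinCut S T A := by
  classical
  have hAT : Disjoint A T := by
    rw [Finset.disjoint_left]
    intro v hv hvT
    have := h.lab_lt_of_mem_closure hA hv
    have := h.lab_source v hvT
    omega
  have hsum : ∑ v ∈ A, σ.exc v = ∑ v ∈ S, σ.exc v := by
    refine (Finset.sum_subset hA.1 fun v hv hvS => ?_).symm
    exact hact v hvS (h.lab_lt_of_mem_closure hA hv)
  -- Closedness makes every hyperedge cut by `A` carry a unit into `A`, and by `hout` no hyperedge
  -- carries one out: the cut is saturated.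
  have hδ : G.delta A ⊆ Finset.univ.filter fun e => σ.tail e ∉ A ∧ σ.head e ∈ A := by
    intro e he
    obtain ⟨⟨v, hv, hvA⟩, w, hw, hwA⟩ := G.mem_delta.1 he
    have hc := hA.2.1 e trivial
    simp only [Finset.mem_filter, Finset.mem_univ, true_and]
    exact ⟨fun ht => hwA (hc.1 ht hw), hc.2 v hv hvA⟩
  have hout : (Finset.univ.filter fun e => σ.tail e ∈ A ∧ σ.head e ∉ A) = ∅ := by
    rw [Finset.filter_eq_empty_iff]
    rintro e - ⟨h1, h2⟩
    exact h2 ((hA.2.1 e trivial).1 h1 (h.head_mem e))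
  have hdA : G.d A ≤ ∑ v ∈ S, σ.exc v := by
    have h1 := h.sum_exc hAT
    rw [hout, Finset.card_empty, hsum] at h1
    rw [show ∑ v ∈ S, σ.exc v = _ from h1]
    exact Finset.card_le_card hδ
  -- Weak duality: what has arrived in `S` must have entered every terminal cut.
  have hle : ∀ W, MultiHypergraph.IsTerminalCut S T W → ∑ v ∈ S, σ.exc v +
      (Finset.univ.filter fun e => σ.tail e ∈ W ∧ σ.head e ∉ W).card ≤
        (Finset.univ.filter fun e => σ.tail e ∉ W ∧ σ.head e ∈ W).card := by
    intro W hW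
    rw [← h.sum_exc hW.2]
    have := Finset.sum_le_sum_of_subset (f := σ.exc) hW.1
    omega
  have hmin : G.IsMinTerminalCut S T A := by
    refine ⟨⟨hA.1, hAT⟩, fun W hW => ?_⟩
    have h1 := hle W hW
    have h2 := Finset.card_le_card (h.inflow_subset W)
    unfold MultiHypergraph.d at hdA ⊢
    omega
  refine ⟨hmin, fun W hW _ => ?_⟩
  have h1 := hle W hW.1
  have h3 := hW.2 A hmin.1
  -- Equality in weak duality saturates every minimum cut `W`. A saturated cut is closed, so it
  -- contains the least closed set.
  have h4 : (Finset.univ.filter fun e => σ.tail e ∉ W ∧ σ.head e ∈ W) = G.delta W := by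
    refine Finset.eq_of_subset_of_card_le (h.inflow_subset W) ?_
    unfold MultiHypergraph.d at h3 hdA
    omega
  have h5 : ∀ e ∈ G.delta W, σ.tail e ∉ W ∧ σ.head e ∈ W := by
    intro e he
    rw [← h4] at he
    simpa using he
  refine hA.2.2 W hW.1.1 fun e _ => ⟨fun ht u hu => ?_, fun w hw hwW => ?_⟩
  · by_contra huW
    exact (h5 e (G.mem_delta.2 ⟨⟨_, h.tail_mem e, ht⟩, u, hu, huW⟩)).1 ht
  · by_contra hh
    exact hh (h5 e (G.mem_delta.2 ⟨⟨w, hw, hwW⟩, _, h.head_mem e, hh⟩)).2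

/-- Move a unit from the head of `e` to `w`. -/
def pushHead (σ : Preflow n m) (e : Fin m) (w : Fin n) : Preflow n m :=
  { σ with
    head := Function.update σ.head e w
    exc := Function.update (Function.update σ.exc (σ.head e) (σ.exc (σ.head e) - 1)) w
      (σ.exc w + 1) }

/-- Move a unit from `u` to the tail of `e`. -/
def pushTail (σ : Preflow n m) (e : Fin m) (u : Fin n) : Preflow n m :=
  { σ with
    tail := Function.update σ.tail e u
    exc := Function.update (Function.update σ.exc u (σ.exc u - 1)) (σ.tail e)
      (σ.exc (σ.tail e) + 1) }

theorem card_fiber_update (f : Fin m → Fin n) (e : Fin m) (w v : Fin n) :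
    fiberCard (Function.update f e w) v + (if f e = v then 1 else 0) =
      fiberCard f v + if w = v then 1 else 0 := by
  simp only [fiberCard, Finset.card_filter]
  rw [← Finset.add_sum_erase _ _ (Finset.mem_univ e),
    ← Finset.add_sum_erase (a := e) _ (fun e' => if f e' = v then 1 else 0) (Finset.mem_univ e)]
  have : ∑ x ∈ Finset.univ.erase e, (if Function.update f e w x = v then 1 else 0) =
      ∑ x ∈ Finset.univ.erase e, if f x = v then 1 else 0 := by
    refine Finset.sum_congr rfl fun x hx => ?_
    rw [Function.update_of_ne (Finset.ne_of_mem_erase hx)]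
  rw [this, Function.update_self]
  omega

/-- A unit moves down by exactly one level. The new head is lower than the old one, so the bound on
head labels only gets slacker; in `Inv.pushTail` it is the new tail that is higher. -/
theorem Inv.pushHead (h : Inv G S T σ) {e : Fin m} {w : Fin n} (hw : w ∈ G.edge e)
    (hl : σ.lab (σ.head e) = σ.lab w + 1) (hx : 0 < σ.exc (σ.head e)) :
    Inv G S T (σ.pushHead e w) where
  tail_mem := h.tail_mem
  head_mem e' := by
    by_cases he : e' = e
    · subst he; simpa [Preflow.pushHead] using hw
    · simpa [Preflow.pushHead, he] using h.head_mem e'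
  lab_tail := h.lab_tail
  lab_head e' y hy := by
    by_cases he : e' = e
    · subst he
      have := h.lab_head e' y hy
      simp only [Preflow.pushHead, Function.update_self]
      omega
    · simpa [Preflow.pushHead, he] using h.lab_head e' y hy
  lab_pos := h.lab_pos
  lab_le := h.lab_le
  lab_source := h.lab_source
  lab_sink := h.lab_sink
  exc_eq v hv := by
    have hne : σ.head e ≠ w := fun hc => by rw [hc] at hl; omega
    have h1 := card_fiber_update σ.head e w v
    have h2 := h.exc_eq v hv
    simp only [Preflow.pushHead, Function.update_apply]
    by_cases hvw : v = w
    · subst hvw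
      rw [if_pos rfl]
      rw [if_neg hne, if_pos rfl] at h1
      omega
    · by_cases hvh : v = σ.head e
      · subst hvh
        rw [if_neg hvw, if_pos rfl]
        rw [if_pos rfl, if_neg (Ne.symm hvw)] at h1
        omega
      · rw [if_neg hvw, if_neg hvh]
        rw [if_neg (Ne.symm hvh), if_neg (Ne.symm hvw)] at h1
        omega

theorem Inv.pushTail (h : Inv G S T σ) {e : Fin m} {u : Fin n} (hu : u ∈ G.edge e)
    (hl : σ.lab u = σ.lab (σ.tail e) + 1) (hx : 0 < σ.exc u) :
    Inv G S T (σ.pushTail e u) where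
  tail_mem e' := by
    by_cases he : e' = e
    · subst he; simpa [Preflow.pushTail] using hu
    · simpa [Preflow.pushTail, he] using h.tail_mem e'
  head_mem := h.head_mem
  lab_tail e' y hy := by
    by_cases he : e' = e
    · subst he
      have := h.lab_tail e' y hy
      simp only [Preflow.pushTail, Function.update_self]
      omega
    · simpa [Preflow.pushTail, he] using h.lab_tail e' y hy
  lab_head := h.lab_head
  lab_pos := h.lab_pos
  lab_le := h.lab_le
  lab_source := h.lab_source
  lab_sink := h.lab_sink
  exc_eq v hv := by
    have hne : u ≠ σ.tail e := fun hc => by rw [← hc] at hl; omega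
    have h1 := card_fiber_update σ.tail e u v
    have h2 := h.exc_eq v hv
    simp only [Preflow.pushTail, Function.update_apply]
    by_cases hvw : v = σ.tail e
    · subst hvw
      rw [if_pos rfl]
      rw [if_neg hne, if_pos rfl] at h1
      omega
    · by_cases hvh : v = u
      · subst hvh
        rw [if_neg hvw, if_pos rfl]
        rw [if_pos rfl, if_neg (Ne.symm hvw)] at h1
        omega
      · rw [if_neg hvw, if_neg hvh]
        rw [if_neg (Ne.symm hvh), if_neg (Ne.symm hvw)] at h1
        omega

/-- No unit can be moved from a vertex of level `ℓ` to the next lower level by moving the head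
of `e`. -/
def StuckHead (G : MultiHypergraph n m) (σ : Preflow n m) (ℓ : ℕ) (e : Fin m) : Prop :=
  σ.lab (σ.head e) = ℓ → 0 < σ.exc (σ.head e) → ∀ w ∈ G.edge e, σ.lab w + 1 ≠ ℓ

/-- No unit can be moved from a vertex of level `ℓ` to the next lower level by moving the tail
of `e`. -/
def StuckTail (G : MultiHypergraph n m) (σ : Preflow n m) (ℓ : ℕ) (e : Fin m) : Prop :=
  ∀ u ∈ G.edge e, σ.lab u = ℓ → 0 < σ.exc u → σ.lab (σ.tail e) + 1 ≠ ℓ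

/-- The passage from `σ` to `σ'` does not change labels, and does not increase excesses of level at
least `ℓ`. -/
structure Descends (ℓ : ℕ) (σ σ' : Preflow n m) : Prop where
  lab_eq : σ'.lab = σ.lab
  exc_le : ∀ v, ℓ ≤ σ.lab v → σ'.exc v ≤ σ.exc v

theorem Descends.refl (ℓ : ℕ) (σ : Preflow n m) : Descends ℓ σ σ := ⟨rfl, fun _ _ => le_rfl⟩

theorem Descends.trans {ℓ : ℕ} {σ σ' σ'' : Preflow n m} (h : Descends ℓ σ σ')
    (h' : Descends ℓ σ' σ'') : Descends ℓ σ σ'' :=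
  ⟨h'.lab_eq.trans h.lab_eq, fun v hv => (h'.exc_le v (by rwa [h.lab_eq])).trans (h.exc_le v hv)⟩

theorem descends_pushHead {ℓ : ℕ} {e : Fin m} {w : Fin n} (hw : σ.lab w + 1 = ℓ) :
    Descends ℓ σ (σ.pushHead e w) := by
  refine ⟨rfl, fun v hv => ?_⟩
  have hne : v ≠ w := by rintro rfl; omega
  simp only [Preflow.pushHead, Function.update_apply, if_neg hne]
  split_ifs with h
  · subst h; omega
  · exact le_rfl

theorem descends_pushTail {ℓ : ℕ} {e : Fin m} {u : Fin n} (hw : σ.lab (σ.tail e) + 1 = ℓ) :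
    Descends ℓ σ (σ.pushTail e u) := by
  refine ⟨rfl, fun v hv => ?_⟩
  have hne : v ≠ σ.tail e := by rintro rfl; omega
  simp only [Preflow.pushTail, Function.update_apply, if_neg hne]
  split_ifs with h
  · subst h; omega
  · exact le_rfl

/-- Within a pass labels are frozen and excess on level `ℓ` only shrinks. So a hyperedge stays stuck
while its head is left alone, and visiting each hyperedge once is enough. -/
theorem StuckHead.of_descends {ℓ : ℕ} {σ' : Preflow n m} {e : Fin m} (h : StuckHead G σ ℓ e)
    (hd : Descends ℓ σ σ') (he : σ'.head e = σ.head e) : StuckHead G σ' ℓ e := by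
  intro h1 h2 w hw
  rw [he, hd.lab_eq] at h1
  rw [he] at h2
  rw [hd.lab_eq]
  exact h h1 (h2.trans_le (hd.exc_le _ h1.ge)) w hw

theorem StuckTail.of_descends {ℓ : ℕ} {σ' : Preflow n m} {e : Fin m} (h : StuckTail G σ ℓ e)
    (hd : Descends ℓ σ σ') (he : σ'.tail e = σ.tail e) : StuckTail G σ' ℓ e := by
  intro u hu h1 h2
  rw [hd.lab_eq] at h1
  rw [he, hd.lab_eq]
  exact h u hu h1 (h2.trans_le (hd.exc_le _ h1.ge))

/-- Raise the labels of the vertices of level `ℓ` that are still active. -/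
def relabel (σ : Preflow n m) (S : Finset (Fin n)) (ℓ : ℕ) : Preflow n m :=
  { σ with lab := fun v => if σ.lab v = ℓ ∧ 0 < σ.exc v ∧ v ∉ S then ℓ + 1 else σ.lab v }

theorem lab_le_relabel (σ : Preflow n m) (S : Finset (Fin n)) (ℓ : ℕ) (v : Fin n) :
    σ.lab v ≤ (σ.relabel S ℓ).lab v := by
  simp only [relabel]; split_ifs with h <;> omega

/-- All active vertices of level `ℓ` rise together. Validity only limits how far a residual arc
descends, and stuckness excludes residual arcs from these vertices to level `ℓ - 1`. The bound `ℓ ≤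
n` keeps the sources, on level `n + 1`, from being raised. -/
theorem Inv.relabel (h : Inv G S T σ) {ℓ : ℕ} (hℓ : ℓ ≤ n)
    (h1 : ∀ e, StuckHead G σ ℓ e) (h2 : ∀ e, StuckTail G σ ℓ e) :
    Inv G S T (σ.relabel S ℓ) where
  tail_mem := h.tail_mem
  head_mem := h.head_mem
  lab_tail e u hu := by
    have a := h.lab_tail e u hu
    have b := σ.lab_le_relabel S ℓ (σ.tail e)
    change (if σ.lab u = ℓ ∧ 0 < σ.exc u ∧ u ∉ S then ℓ + 1 else σ.lab u) ≤
      (σ.relabel S ℓ).lab (σ.tail e) + 1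
    split_ifs with hc
    · have := h2 e u hu hc.1 hc.2.1
      omega
    · omega
  lab_head e w hw := by
    have a := h.lab_head e w hw
    have b := σ.lab_le_relabel S ℓ w
    change (if σ.lab (σ.head e) = ℓ ∧ 0 < σ.exc (σ.head e) ∧ σ.head e ∉ S then ℓ + 1
      else σ.lab (σ.head e)) ≤ (σ.relabel S ℓ).lab w + 1
    split_ifs with hc
    · have := h1 e hc.1 hc.2.1 w hw
      omega
    · omega
  lab_pos v := (h.lab_pos v).trans (σ.lab_le_relabel S ℓ v)
  lab_le v := by
    have := h.lab_le v
    simp only [Preflow.relabel]; split_ifs <;> omega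
  lab_source v hv := by
    have := h.lab_source v hv
    simp only [Preflow.relabel]; rw [if_neg (by omega)]; exact this
  lab_sink v hv := by
    have := h.lab_sink v hv
    simp only [Preflow.relabel]; rw [if_neg (by tauto)]; exact this
  exc_eq := h.exc_eq

end Preflow

/-! ### Reasoning about programs -/

namespace Ram

/-- The program may write the register `r`. -/
def Prog.writesReg : Prog → ℕ → Bool
  | .skip, _ => false
  | .const x _, r => x == r
  | .copy x _, r => x == r
  | .succ x, r => x == r
  | .pred x, r => x == r
  | .load x _ _, r => x == r
  | .store _ _ _, _ => false
  | .write _, _ => false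
  | .seq P Q, r => P.writesReg r || Q.writesReg r
  | .ite _ P Q, r => P.writesReg r || Q.writesReg r
  | .while _ P, r => P.writesReg r

/-- The program may write the array `a`. -/
def Prog.writesArr : Prog → ℕ → Bool
  | .skip, _ => false
  | .const _ _, _ => false
  | .copy _ _, _ => false
  | .succ _, _ => false
  | .pred _, _ => false
  | .load _ _ _, _ => false
  | .store b _ _, a => b == a
  | .write _, _ => false
  | .seq P Q, a => P.writesArr a || Q.writesArr a
  | .ite _ P Q, a => P.writesArr a || Q.writesArr a
  | .while _ P, a => P.writesArr a

/-- The program may write to the output tape. -/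
def Prog.writesOut : Prog → Bool
  | .skip => false
  | .const _ _ => false
  | .copy _ _ => false
  | .succ _ => false
  | .pred _ => false
  | .load _ _ _ => false
  | .store _ _ _ => false
  | .write _ => true
  | .seq P Q => P.writesOut || Q.writesOut
  | .ite _ P Q => P.writesOut || Q.writesOut
  | .while _ P => P.writesOut

/-- What a run of the program from `s` to `s'` leaves unchanged. -/
structure Frame (P : Prog) (s s' : Store) : Prop where
  reg : ∀ x, P.writesReg x = false → s'.reg x = s.reg x
  arr : ∀ a, P.writesArr a = false → s'.arr a = s.arr a
  out : P.writesOut = false → s'.out = s.out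

theorem Frame.refl (P : Prog) (s : Store) : Frame P s s :=
  ⟨fun _ _ => rfl, fun _ _ => rfl, fun _ => rfl⟩

theorem Frame.trans {P : Prog} {s s' s'' : Store} (h : Frame P s s') (h' : Frame P s' s'') :
    Frame P s s'' :=
  ⟨fun x hx => (h'.reg x hx).trans (h.reg x hx), fun a ha => (h'.arr a ha).trans (h.arr a ha),
    fun ho => (h'.out ho).trans (h.out ho)⟩

theorem Frame.mono {P Q : Prog} {s s' : Store} (h : Frame P s s')
    (h1 : ∀ x, Q.writesReg x = false → P.writesReg x = false)
    (h2 : ∀ x, Q.writesArr x = false → P.writesArr x = false)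
    (h3 : Q.writesOut = false → P.writesOut = false) : Frame Q s s' :=
  ⟨fun x hx => h.reg x (h1 x hx), fun a ha => h.arr a (h2 a ha), fun ho => h.out (h3 ho)⟩

/-- The frame is determined by the program text. For a concrete program `decide` therefore settles
which registers and arrays survive. -/
theorem Exec.frame {P : Prog} {s s' : Store} {t : ℕ} (h : Exec P s t s') : Frame P s s' := by
  induction h with
  | skip s => exact .refl _ _
  | const s x c | copy s x y | succ s x | pred s x | load s x a y =>
    refine ⟨fun r hr => ?_, fun _ _ => rfl, fun _ => rfl⟩
    simp only [Prog.writesReg, beq_eq_false_iff_ne] at hr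
    exact Function.update_of_ne hr.symm _ _
  | store s a x y =>
    refine ⟨fun _ _ => rfl, fun r hr => ?_, fun _ => rfl⟩
    simp only [Prog.writesArr, beq_eq_false_iff_ne] at hr
    exact Function.update_of_ne hr.symm _ _
  | write s x => exact ⟨fun _ _ => rfl, fun _ _ => rfl, fun h => by simp [Prog.writesOut] at h⟩
  | seq _ _ ih1 ih2 =>
    exact (ih1.mono (by simp +contextual [Prog.writesReg]) (by simp +contextual [Prog.writesArr])
      (by simp +contextual [Prog.writesOut])).trans
      (ih2.mono (by simp +contextual [Prog.writesReg]) (by simp +contextual [Prog.writesArr])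
      (by simp +contextual [Prog.writesOut]))
  | iteTrue _ _ ih | iteFalse _ _ ih =>
    exact ih.mono (by simp +contextual [Prog.writesReg]) (by simp +contextual [Prog.writesArr])
      (by simp +contextual [Prog.writesOut])
  | @whileTrue b P _ _ _ _ _ _ _ _ ih1 ih2 =>
    exact (ih1.mono (Q := .while b P) (fun _ h => h) (fun _ h => h) (fun h => h)).trans ih2
  | whileFalse _ => exact .refl _ _

/-- Started in `s`, the program halts, and the number of steps and the final store satisfy `Q`. -/
def wp (P : Prog) (s : Store) (Q : ℕ → Store → Prop) : Prop :=
  ∃ t s', Exec P s t s' ∧ Q t s'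

/-- The consequence receives the frame of the run, so a specification has to mention only what
changes. -/
theorem wp.mono {P : Prog} {s : Store} {Q Q' : ℕ → Store → Prop} (h : wp P s Q)
    (h' : ∀ t s', Frame P s s' → Q t s' → Q' t s') : wp P s Q' := by
  obtain ⟨t, s', he, hq⟩ := h
  exact ⟨t, s', he, h' t s' he.frame hq⟩

variable {P P' : Prog} {s : Store} {Q : ℕ → Store → Prop}

theorem wp_skip (h : Q 1 s) : wp .skip s Q := ⟨_, _, .skip s, h⟩

theorem wp_const {x c : ℕ} (h : Q 1 (s.setReg x c)) : wp (.const x c) s Q := ⟨_, _, .const s x c, h⟩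

theorem wp_copy {x y : ℕ} (h : Q 1 (s.setReg x (s.reg y))) : wp (.copy x y) s Q :=
  ⟨_, _, .copy s x y, h⟩

theorem wp_succ {x : ℕ} (h : Q 1 (s.setReg x (s.reg x + 1))) : wp (.succ x) s Q :=
  ⟨_, _, .succ s x, h⟩

theorem wp_pred {x : ℕ} (h : Q 1 (s.setReg x (s.reg x - 1))) : wp (.pred x) s Q :=
  ⟨_, _, .pred s x, h⟩

theorem wp_load {x a y : ℕ} (h : Q 1 (s.setReg x (s.arr a (s.reg y)))) : wp (.load x a y) s Q :=
  ⟨_, _, .load s x a y, h⟩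

theorem wp_store {a x y : ℕ} (h : Q 1 (s.setArr a (s.reg x) (s.reg y))) :
    wp (.store a x y) s Q := ⟨_, _, .store s a x y, h⟩

theorem wp_write {x : ℕ} (h : Q 1 { s with out := s.out ++ [s.reg x] }) : wp (.write x) s Q :=
  ⟨_, _, .write s x, h⟩

theorem wp_seq (h : wp P s fun t s' => wp P' s' fun t' s'' => Q (t + t') s'') :
    wp (.seq P P') s Q := by
  obtain ⟨t, s', h1, t', s'', h2, h3⟩ := h
  exact ⟨_, _, .seq h1 h2, h3⟩

theorem wp_ite {b : Test} (h1 : b.Holds s → wp P s fun t s' => Q (t + 1) s')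
    (h2 : ¬ b.Holds s → wp P' s fun t s' => Q (t + 1) s') : wp (.ite b P P') s Q := by
  by_cases hb : b.Holds s
  · obtain ⟨t, s', h, hq⟩ := h1 hb
    exact ⟨_, _, .iteTrue hb h, hq⟩
  · obtain ⟨t, s', h, hq⟩ := h2 hb
    exact ⟨_, _, .iteFalse hb h, hq⟩

/-- The index `j` bounds the iterations still to come: a successful test forces it to be positive,
and the body lowers it by one. Each iteration pays one step for its test, and the final `+ 1` pays
for the failing one. -/
theorem wp_while {b : Test} {T j₀ : ℕ} (I : ℕ → Store → Prop) (h0 : I j₀ s)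
    (step : ∀ j s', Frame (.while b P) s s' → I j s' → b.Holds s' →
      ∃ j', j = j' + 1 ∧ wp P s' fun t s'' => t ≤ T ∧ I j' s'') :
    wp (.while b P) s fun t s' => t ≤ j₀ * (T + 1) + 1 ∧ (∃ j ≤ j₀, I j s') ∧ ¬ b.Holds s' := by
  induction j₀ generalizing s with
  | zero =>
    by_cases hb : b.Holds s
    · obtain ⟨j', h, -⟩ := step 0 s (.refl _ _) h0 hb
      omega
    · exact ⟨_, _, .whileFalse hb, by simp, ⟨0, le_rfl, h0⟩, hb⟩
  | succ j ih =>
    by_cases hb : b.Holds s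
    · obtain ⟨j', h, t, s', he, ht, hI⟩ := step (j + 1) s (.refl _ _) h0 hb
      obtain rfl : j = j' := by omega
      obtain ⟨t', s'', he', ht', ⟨i, hi, hI'⟩, hb'⟩ := ih hI fun i s'' hf =>
        step i s'' ((he.frame.mono (Q := .while b P) (fun _ h => h) (fun _ h => h) (fun h => h)).trans hf)
      refine ⟨_, _, .whileTrue hb he he', ?_, ⟨i, by omega, hI'⟩, hb'⟩
      rw [Nat.succ_mul]; omega
    · exact ⟨_, _, .whileFalse hb, by simp, ⟨j + 1, le_rfl, h0⟩, hb⟩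

/-- The programs of the list one after the other. -/
def block : List Prog → Prog
  | [] => .skip
  | [P] => P
  | P :: P' :: L => .seq P (block (P' :: L))

/-- `while i < b: P; i := i + 1`. -/
def forUp (i b : ℕ) (P : Prog) : Prog := .while (.lt i b) (.seq P (.succ i))

/-- `for i < b: P`. -/
def forBelow (i b : ℕ) (P : Prog) : Prog := .seq (.const i 0) (forUp i b P)

@[simp] theorem reg_setReg (s : Store) (x v y : ℕ) :
    (s.setReg x v).reg y = if y = x then v else s.reg y := by
  simp [Store.setReg, Function.update_apply]

@[simp] theorem arr_setReg (s : Store) (x v : ℕ) : (s.setReg x v).arr = s.arr := rfl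

@[simp] theorem out_setReg (s : Store) (x v : ℕ) : (s.setReg x v).out = s.out := rfl

@[simp] theorem reg_setArr (s : Store) (a i v : ℕ) : (s.setArr a i v).reg = s.reg := rfl

@[simp] theorem arr_setArr (s : Store) (a i v b : ℕ) : (s.setArr a i v).arr b =
    if b = a then Function.update (s.arr a) i v else s.arr b := by
  simp [Store.setArr, Function.update_apply]

/-- The two extra steps per round are the test and the increment. The body must establish the
invariant for the store in which the counter has already advanced. -/
theorem wp_forUp {i b lo hi : ℕ} (T : ℕ → ℕ) (I : ℕ → Store → Prop)
    (hi' : P.writesReg i = false) (hb' : P.writesReg b = false) (hib : i ≠ b)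
    (hlo : s.reg i = lo) (hhi : s.reg b = hi) (hle : lo ≤ hi) (h0 : I lo s)
    (step : ∀ j s', lo ≤ j → j < hi → Frame (forUp i b P) s s' → s'.reg i = j → I j s' →
      wp P s' fun t s'' => t ≤ T j ∧ I (j + 1) (s''.setReg i (j + 1))) :
    wp (forUp i b P) s fun t s' => t ≤ ∑ j ∈ Finset.Ico lo hi, (T j + 2) + 1 ∧ I hi s' := by
  obtain ⟨c, rfl⟩ := Nat.exists_eq_add_of_le hle
  clear hle
  induction c generalizing s lo with
  | zero =>
    refine ⟨_, _, .whileFalse ?_, by simp, by simpa using h0⟩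
    simp [Test.Holds, hlo, hhi]
  | succ c ih =>
    have hlt : (Test.lt i b).Holds s := by simp [Test.Holds, hlo, hhi]
    obtain ⟨t, s', he, ht, hI⟩ := step lo s le_rfl (by omega) (.refl _ _) hlo h0
    have hf := he.frame
    have hri : s'.reg i = lo := (hf.reg i hi').trans hlo
    have hrb : s'.reg b = lo + (c + 1) := (hf.reg b hb').trans hhi
    have he' : Exec (.seq P (.succ i)) s (t + 1) (s'.setReg i (lo + 1)) := by
      rw [← hri]; exact .seq he (.succ s' i)
    obtain ⟨t', s'', he'', ht', hI'⟩ := ih (s := s'.setReg i (lo + 1)) (lo := lo + 1)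
      (hlo := by simp) (hhi := by simp [hib.symm, hrb]; omega) (h0 := hI) (step := fun j s'' h1 h2 hf' =>
        step j s'' (by omega) (by omega)
          ((he'.frame.mono (Q := forUp i b P) (fun _ h => h) (fun _ h => h) (fun h => h)).trans hf'))
    refine ⟨_, _, .whileTrue hlt he' he'', ?_, ?_⟩
    · rw [Finset.sum_eq_sum_Ico_succ_bot (by omega)]
      have e : lo + (c + 1) = lo + 1 + c := by omega
      rw [e]
      omega
    · rwa [show lo + (c + 1) = lo + 1 + c by omega]

/-- The invariant is indexed by the set of finished indices instead of the counter, which suits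
sums, suprema and images over finite sets; `step` also learns that this set is an initial segment.
-/
theorem wp_forBelow {i b N : ℕ} (T : Fin N → ℕ) (I : Finset (Fin N) → Store → Prop)
    (hi' : P.writesReg i = false) (hb' : P.writesReg b = false) (hib : i ≠ b)
    (hb : s.reg b = N) (h0 : I ∅ (s.setReg i 0))
    (step : ∀ D (x : Fin N) s', (∀ y, y ∈ D ↔ y < x) → Frame (forBelow i b P) s s' →
      s'.reg i = x → I D s' →
      wp P s' fun t s'' => t ≤ T x ∧ I (insert x D) (s''.setReg i (x + 1))) :
    wp (forBelow i b P) s fun t s' => t ≤ ∑ x, (T x + 2) + 2 ∧ I Finset.univ s' := by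
  have hf0 : Frame (forBelow i b P) s (s.setReg i 0) :=
    (Exec.const s i 0).frame.mono (by simp +contextual [forBelow, Prog.writesReg])
      (by simp +contextual [forBelow, Prog.writesArr])
      (by simp +contextual [forBelow, Prog.writesOut])
  refine wp_seq (wp_const ?_)
  refine (wp_forUp (fun j => if h : j < N then T ⟨j, h⟩ else 0)
    (fun j => I (Finset.univ.filter fun y => y.1 < j)) hi' hb' hib (lo := 0) (hi := N)
    (by simp) (by simp [hib.symm, hb]) (Nat.zero_le _) (by simpa using h0) ?_).mono ?_
  · intro j s' _ hj hf hreg hI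
    have hf' := hf0.trans (hf.mono (Q := forBelow i b P)
      (by simp +contextual [forBelow, Prog.writesReg])
      (by simp +contextual [forBelow, Prog.writesArr])
      (by simp +contextual [forBelow, Prog.writesOut]))
    refine (step _ ⟨j, hj⟩ s' (by simp [Fin.lt_def]) hf' hreg hI).mono fun t s'' _ h => ?_
    refine ⟨by simpa [hj] using h.1, ?_⟩
    have e : (Finset.univ.filter fun y : Fin N => y.1 < j + 1) =
        insert ⟨j, hj⟩ (Finset.univ.filter fun y : Fin N => y.1 < j) := by
      ext y
      simp only [Finset.mem_filter, Finset.mem_univ, true_and, Finset.mem_insert, Fin.ext_iff]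
      omega
    rw [e]
    exact h.2
  · rintro t s' - ⟨ht, hI⟩
    have e : (Finset.univ.filter fun y : Fin N => y.1 < N) = Finset.univ := by ext y; simp
    rw [e] at hI
    refine ⟨?_, hI⟩
    have : ∑ j ∈ Finset.Ico 0 N, ((if h : j < N then T ⟨j, h⟩ else 0) + 2) = ∑ x, (T x + 2) := by
      rw [← Finset.range_eq_Ico, Finset.sum_range]
      exact Finset.sum_congr rfl fun x _ => by simp
    omega

/-- `forBelow` with the same time bound for all iterations. -/
theorem wp_forBelow_const {i b N : ℕ} (T : ℕ) (I : Finset (Fin N) → Store → Prop)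
    (hi' : P.writesReg i = false) (hb' : P.writesReg b = false) (hib : i ≠ b)
    (hb : s.reg b = N) (h0 : I ∅ (s.setReg i 0))
    (step : ∀ D (x : Fin N) s', (∀ y, y ∈ D ↔ y < x) → Frame (forBelow i b P) s s' →
      s'.reg i = x → I D s' →
      wp P s' fun t s'' => t ≤ T ∧ I (insert x D) (s''.setReg i (x + 1))) :
    wp (forBelow i b P) s fun t s' => t ≤ N * (T + 2) + 2 ∧ I Finset.univ s' := by
  refine (wp_forBelow (fun _ => T) I hi' hb' hib hb h0 step).mono fun t s' _ h => ?_
  simpa using h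

end Ram

/-! ### The hypergraph in memory -/

namespace MultiHypergraph

open Ram

variable {n m : ℕ}

/-- The registers `1` to `4` hold `n`, `m`, `0`, `1`, and for each hyperedge `e` the segment of the
array `0` from cell `arr 1 e` to cell `arr 2 e` lists its vertices. -/
structure InMemory (G : MultiHypergraph n m) (s : Store) : Prop where
  regN : s.reg 1 = n
  regM : s.reg 2 = m
  zero : s.reg 3 = 0
  one : s.reg 4 = 1
  edges : ∀ e : Fin m, ∃ l : List (Fin n), l.Nodup ∧ l.toFinset = G.edge e ∧
    s.arr 2 e = s.arr 1 e + l.length ∧ ∀ j (h : j < l.length), s.arr 0 (s.arr 1 e + j) = l[j]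

variable {G : MultiHypergraph n m} {s s' : Store}

theorem InMemory.congr (h : G.InMemory s) (h1 : s'.reg 1 = s.reg 1) (h2 : s'.reg 2 = s.reg 2)
    (h3 : s'.reg 3 = s.reg 3) (h4 : s'.reg 4 = s.reg 4) (h5 : s'.arr 0 = s.arr 0)
    (h6 : s'.arr 1 = s.arr 1) (h7 : s'.arr 2 = s.arr 2) : G.InMemory s' :=
  ⟨h1.trans h.regN, h2.trans h.regM, h3.trans h.zero, h4.trans h.one, by
    rw [h5, h6, h7]; exact h.edges⟩

/-- The program leaves the hypergraph in memory alone. -/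
def KeepsInput (P : Prog) : Prop :=
  (P.writesReg 1 || P.writesReg 2 || P.writesReg 3 || P.writesReg 4 || P.writesArr 0 ||
    P.writesArr 1 || P.writesArr 2) = false

instance (P : Prog) : Decidable (KeepsInput P) := inferInstanceAs (Decidable (_ = false))

theorem InMemory.frame {P : Prog} (h : G.InMemory s) (hf : Frame P s s') (hP : KeepsInput P) :
    G.InMemory s' := by
  simp only [KeepsInput, Bool.or_eq_false_iff] at hP
  obtain ⟨⟨⟨⟨⟨⟨h1, h2⟩, h3⟩, h4⟩, h5⟩, h6⟩, h7⟩ := hP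
  exact h.congr (hf.reg _ h1) (hf.reg _ h2) (hf.reg _ h3) (hf.reg _ h4) (hf.arr _ h5)
    (hf.arr _ h6) (hf.arr _ h7)

theorem InMemory.setReg (h : G.InMemory s) {x v : ℕ} (hx : 4 < x) : G.InMemory (s.setReg x v) := by
  refine h.congr ?_ ?_ ?_ ?_ rfl rfl rfl <;> rw [reg_setReg, if_neg (by omega)]

theorem InMemory.setArr (h : G.InMemory s) {a i v : ℕ} (ha : 2 < a) :
    G.InMemory (s.setArr a i v) := by
  refine h.congr rfl rfl rfl rfl ?_ ?_ ?_ <;> rw [arr_setArr, if_neg (by omega)]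

/-- Run through the vertices of the hyperedge in register `8`; register `7` holds the vertex. -/
def scan (P : Prog) : Prog :=
  block [.load 5 1 8, .load 6 2 8, forUp 5 6 (block [.load 7 0 5, P])]

/-- The arbitrary values `a`, `b` and `q` of the position registers make the invariant independent
of where the hyperedge is stored. A vertex is never seen twice because the stored list has no
repetitions. -/
theorem wp_scan {P : Prog} {T : ℕ} (hG : G.InMemory s) (e : Fin m) (he : s.reg 8 = e)
    (I : Finset (Fin n) → Store → Prop)
    (hP : (P.writesReg 5 || P.writesReg 6) = false) (hK : KeepsInput P)
    (h0 : ∀ a b, I ∅ ((s.setReg 5 a).setReg 6 b))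
    (step : ∀ D (v : Fin n) s' q, v ∈ G.edge e → v ∉ D → G.InMemory s' → Frame (scan P) s s' →
      I D s' → wp P (s'.setReg 7 v) fun t s'' => t ≤ T ∧ I (insert v D) (s''.setReg 5 q)) :
    wp (scan P) s fun t s' => t ≤ (G.edge e).card * (T + 3) + 3 ∧ I (G.edge e) s' := by
  obtain ⟨l, hnd, hl, hlen, hget⟩ := hG.edges e
  have hK' := hK
  simp only [KeepsInput, Bool.or_eq_false_iff] at hK hP
  refine wp_seq (wp_load (wp_seq (wp_load ?_)))
  set s1 := (s.setReg 5 (s.arr 1 (s.reg 8))) with hs1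
  set s2 := (s1.setReg 6 (s1.arr 2 (s1.reg 8))) with hs2
  have hf2 : Frame (scan P) s s2 := by
    refine ⟨fun x hx => ?_, fun _ _ => rfl, fun _ => rfl⟩
    have hx5 : x ≠ 5 := by
      rintro rfl; simp [scan, block, Prog.writesReg] at hx
    have hx6 : x ≠ 6 := by
      rintro rfl; simp [scan, block, Prog.writesReg] at hx
    simp [hs2, hs1, hx5, hx6]
  have hcard : (G.edge e).card = l.length := by rw [← hl, List.toFinset_card_of_nodup hnd]
  refine (wp_forUp (fun _ => T + 1) (fun j => I (l.take (j - s.arr 1 e)).toFinset)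
    (lo := s.arr 1 e) (hi := s.arr 2 e)
    (by simp [block, Prog.writesReg, hP]) (by simp [block, Prog.writesReg, hP]) (by decide)
    (by simp [hs1, hs2, he]) (by simp [hs1, hs2, he]) (by omega) ?_ ?_).mono ?_
  · simpa [hs1, hs2] using h0 _ _
  · intro j s' h1 h2 hf hreg hI
    have hf' : Frame (scan P) s2 s' := hf.mono
      (by simp +contextual [scan, block, Prog.writesReg, forUp])
      (by simp +contextual [scan, block, Prog.writesArr, forUp])
      (by simp +contextual [scan, block, Prog.writesOut, forUp])
    have hkeep : KeepsInput (scan P) := by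
      simp [KeepsInput, scan, block, forUp, Prog.writesReg, Prog.writesArr, hK]
    have hf'' := hf2.trans hf'
    have hG' := hG.frame hf'' hkeep
    obtain ⟨i, rfl⟩ := Nat.exists_eq_add_of_le h1
    have hi : i < l.length := by omega
    have hv : s'.arr 0 (s'.reg 5) = l[i] := by
      rw [hf''.arr 0 (by simp [scan, block, forUp, Prog.writesArr, hK]), hreg, hget i hi]
    refine wp_seq (wp_load ?_)
    rw [hv]
    have hmem : l[i] ∈ G.edge e := by rw [← hl]; simp
    rw [Nat.add_sub_cancel_left] at hI
    refine (step _ l[i] s' (s.arr 1 e + i + 1) hmem ?_ hG' hf'' hI).mono fun t s'' _ h => ⟨by omega, ?_⟩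
    · rw [List.mem_toFinset, List.mem_take_iff_getElem]
      rintro ⟨a, ha, hal⟩
      have := (List.Nodup.getElem_inj_iff hnd).1 hal
      omega
    · have : (l.take (s.arr 1 e + i + 1 - s.arr 1 e)).toFinset =
          insert l[i] (l.take i).toFinset := by
        rw [show s.arr 1 e + i + 1 - s.arr 1 e = i + 1 by omega, List.take_succ_eq_append_getElem hi]
        ext x
        simp only [List.mem_toFinset, List.mem_append, List.mem_singleton, Finset.mem_insert,
          or_comm]
      rw [this]
      exact h.2
  · rintro t s' - ⟨ht, hI⟩
    rw [Finset.sum_const, Nat.card_Ico, hlen, Nat.add_sub_cancel_left, smul_eq_mul, ← hcard] at ht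
    rw [hlen, Nat.add_sub_cancel_left, List.take_length, hl] at hI
    have : (G.edge e).card * (T + 1 + 2) = (G.edge e).card * (T + 3) := rfl
    refine ⟨by omega, hI⟩

/-- Run through the hyperedges; register `8` holds the hyperedge. -/
def forEdges (P : Prog) : Prog := forBelow 8 2 P

theorem card_le_size (hne : ∀ e, (G.edge e).Nonempty) : m ≤ G.size := by
  have : ∑ e : Fin m, 1 ≤ G.size := Finset.sum_le_sum fun e _ => (hne e).card_pos
  simpa using this

/-- Non-empty hyperedges give `m ≤ p`, so constant overhead per hyperedge is absorbed into a
multiple of the size. -/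
theorem wp_forEdges {P : Prog} {a b : ℕ} (hne : ∀ e, (G.edge e).Nonempty)
    (hG : G.InMemory s) (I : Finset (Fin m) → Store → Prop)
    (hP : P.writesReg 8 = false) (hK : KeepsInput P) (h0 : I ∅ (s.setReg 8 0))
    (step : ∀ D (e : Fin m) s', (∀ y, y ∈ D ↔ y < e) → G.InMemory s' → Frame (forEdges P) s s' →
      s'.reg 8 = e → I D s' → wp P s' fun t s'' => t ≤ a * (G.edge e).card + b ∧
        I (insert e D) (s''.setReg 8 (e + 1))) :
    wp (forEdges P) s fun t s' => t ≤ (a + b + 2) * G.size + 2 ∧ I Finset.univ s' := by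
  have hK' := hK
  simp only [KeepsInput, Bool.or_eq_false_iff] at hK
  refine (wp_forBelow (fun e => a * (G.edge e).card + b) I hP (by simp [hK]) (by decide) hG.regM h0
    fun D e s' hD hf hr hI => step D e s' hD (hG.frame hf ?_) hf hr hI).mono fun t s' _ h => ?_
  · simp [KeepsInput, forBelow, forUp, Prog.writesReg, Prog.writesArr, hK]
  · refine ⟨h.1.trans ?_, h.2⟩
    have hm := G.card_le_size hne
    have : ∑ e, (a * (G.edge e).card + b + 2) = a * G.size + m * (b + 2) := by
      simp only [add_assoc, Finset.sum_add_distrib, ← Finset.mul_sum, size]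
      simp; ring
    rw [this]
    nlinarith [Nat.mul_le_mul_right (b + 2) hm]

end MultiHypergraph

/-! ### Vertex sets in memory and closures -/

namespace MultiHypergraph

open Ram

variable {n m : ℕ} {G : MultiHypergraph n m} {s s' : Store}

/-- The array `a` holds the characteristic vector of `A`. -/
def IsIndicator (a : ℕ → ℕ) (A : Finset (Fin n)) : Prop :=
  ∀ v : Fin n, a v = if v ∈ A then 1 else 0

theorem IsIndicator.eq_one_iff {a : ℕ → ℕ} {A : Finset (Fin n)} (h : IsIndicator a A) {v : Fin n} :
    a v = 1 ↔ v ∈ A := by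
  rw [h v]; split_ifs with h' <;> simp [h']

theorem IsIndicator.insert {a : ℕ → ℕ} {A : Finset (Fin n)} (h : IsIndicator a A) (v : Fin n) :
    IsIndicator (Function.update a v 1) (insert v A) := by
  intro w
  rw [Function.update_apply]
  by_cases hwv : w = v
  · subst hwv; simp
  · have : (w : ℕ) ≠ v := fun hc => hwv (Fin.ext hc)
    rw [if_neg this, h w]
    simp [hwv]

/-- Add the head of the hyperedge in register `8` to the set in array `6` if the hyperedge meets
the set. Array `4` holds the heads, register `9` tells whether the set has changed. -/
def closeHead : Prog :=
  block [.const 11 0, scan (block [.load 12 6 7, .ite (.eq 12 4) (.const 11 1) .skip]),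
    .load 13 4 8, .load 14 6 13,
    .ite (.eq 11 4) (.ite (.eq 14 4) .skip (block [.store 6 13 4, .const 9 1])) .skip]

/-- Add the vertices of the hyperedge in register `8` to the set in array `6` if the set contains
the tail of the hyperedge. Array `3` holds the tails. -/
def closeTail : Prog :=
  block [.load 13 3 8, .load 14 6 13,
    .ite (.eq 14 4) (scan (block [.load 12 6 7,
      .ite (.eq 12 4) .skip (block [.store 6 7 4, .const 9 1])])) .skip]

theorem wp_closeHead (hG : G.InMemory s) {e : Fin m} (he : s.reg 8 = e) {A : Finset (Fin n)}
    (hA : IsIndicator (s.arr 6) A) {h : Fin n} (hh : s.arr 4 e = h) :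
    wp closeHead s fun t s' => t ≤ 6 * (G.edge e).card + 10 ∧ ∃ A', IsIndicator (s'.arr 6) A' ∧
      ((A' = A ∧ s'.reg 9 = s.reg 9 ∧ ∀ w ∈ G.edge e, w ∈ A → h ∈ A) ∨
        (A' = insert h A ∧ h ∉ A ∧ (∃ w ∈ G.edge e, w ∈ A) ∧ s'.reg 9 = 1)) := by
  classical
  refine wp_seq (wp_const (wp_seq ?_))
  refine (wp_scan (T := 3) (hG.setReg (by norm_num)) e (by simpa using he)
    (fun D s' => s'.reg 11 = if ∃ w ∈ D, w ∈ A then 1 else 0) (by decide) (by decide)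
    (by simp) ?_).mono ?_
  · intro D v s' q hv hvD hG' hf hI
    have h6 : s'.arr 6 = s.arr 6 := hf.arr 6 (by decide)
    refine wp_seq (wp_load (wp_ite (fun hb => wp_const ⟨by norm_num, ?_⟩)
      (fun hb => wp_skip ⟨by norm_num, ?_⟩)))
    · simp only [Test.Holds, reg_setReg, arr_setReg, h6, hG'.one] at hb
      have : v ∈ A := by rw [← hA.eq_one_iff]; simpa using hb
      simp [this]
    · simp only [Test.Holds, reg_setReg, arr_setReg, h6, hG'.one] at hb
      have : v ∉ A := by rw [← hA.eq_one_iff]; simpa using hb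
      simp [this, hI]
  · rintro t s1 hf ⟨ht, hI⟩
    have h6 : s1.arr 6 = s.arr 6 := hf.arr 6 (by decide)
    have h4 : s1.arr 4 = s.arr 4 := hf.arr 4 (by decide)
    have h8 : s1.reg 8 = e := (hf.reg 8 (by decide)).trans (by simpa using he)
    have h9 : s1.reg 9 = s.reg 9 := (hf.reg 9 (by decide)).trans (by simp)
    have ho : s1.reg 4 = 1 := (hf.reg 4 (by decide)).trans (by simpa using hG.one)
    refine wp_seq (wp_load (wp_seq (wp_load (wp_ite (fun hb => wp_ite (fun hb' => wp_skip ?_)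
      (fun hb' => wp_seq (wp_store (wp_const ?_)))) (fun hb => wp_skip ?_)))))
    all_goals
      refine ⟨by omega, ?_⟩
      simp only [Test.Holds, reg_setReg, arr_setReg, h6, h4, h8, ho, hh, hI] at hb
    · simp only [Test.Holds, reg_setReg, arr_setReg, h6, h4, h8, ho, hh] at hb'
      have hhA : h ∈ A := by rw [← hA.eq_one_iff]; simpa using hb'
      refine ⟨A, by simpa [h6] using hA, .inl ⟨rfl, by simpa using h9, fun _ _ _ => hhA⟩⟩
    · simp only [Test.Holds, reg_setReg, arr_setReg, h6, h4, h8, ho, hh] at hb'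
      have hhA : h ∉ A := by rw [← hA.eq_one_iff]; simpa using hb'
      refine ⟨_, ?_, .inr ⟨rfl, hhA, ?_, by simp⟩⟩
      · simpa [h6, h4, h8, ho, hh] using hA.insert h
      · simpa using hb
    · refine ⟨A, by simpa [h6] using hA, .inl ⟨rfl, by simpa using h9, fun w hw hwA => ?_⟩⟩
      exfalso
      refine hb ?_
      have : ∃ w ∈ G.edge e, w ∈ A := ⟨w, hw, hwA⟩
      simp [this]

theorem wp_closeTail (hG : G.InMemory s) {e : Fin m} (he : s.reg 8 = e) {A : Finset (Fin n)}
    (hA : IsIndicator (s.arr 6) A) {u : Fin n} (hh : s.arr 3 e = u) :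
    wp closeTail s fun t s' => t ≤ 7 * (G.edge e).card + 10 ∧ ∃ A', IsIndicator (s'.arr 6) A' ∧
      ((A' = A ∧ s'.reg 9 = s.reg 9 ∧ (u ∈ A → G.edge e ⊆ A)) ∨
        (A' = A ∪ G.edge e ∧ ¬ G.edge e ⊆ A ∧ u ∈ A ∧ s'.reg 9 = 1)) := by
  classical
  refine wp_seq (wp_load (wp_seq (wp_load (wp_ite (fun hb => ?_) (fun hb => wp_skip ?_)))))
  · simp only [Test.Holds, reg_setReg, arr_setReg, he, hh, hG.one] at hb
    have huA : u ∈ A := by rw [← hA.eq_one_iff]; simpa using hb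
    refine (wp_scan (T := 4) ((hG.setReg (by norm_num)).setReg (by norm_num)) e (by simpa using he)
      (fun D s' => IsIndicator (s'.arr 6) (A ∪ D) ∧
        s'.reg 9 = if D ⊆ A then s.reg 9 else 1) (by decide) (by decide)
      (by simpa using hA) ?_).mono ?_
    · rintro D v s' q hv hvD hG' hf ⟨hI1, hI2⟩
      refine wp_seq (wp_load (wp_ite (fun hb => wp_skip ⟨by norm_num, ?_⟩)
        (fun hb => wp_seq (wp_store (wp_const ⟨by norm_num, ?_⟩)))))
      · simp only [Test.Holds, reg_setReg, arr_setReg, hG'.one] at hb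
        have hvA : v ∈ A := by
          have := hI1.eq_one_iff.1 (by simpa using hb)
          simpa [hvD] using this
        refine ⟨?_, ?_⟩
        · rw [Finset.union_insert, Finset.insert_eq_of_mem (by simp [hvA])]
          exact hI1
        · simpa [Finset.insert_subset_iff, hvA] using hI2
      · simp only [Test.Holds, reg_setReg, arr_setReg, hG'.one] at hb
        have hvA : v ∉ A := by
          intro h
          exact hb (by simpa using hI1.eq_one_iff.2 (Finset.mem_union_left _ h))
        refine ⟨?_, ?_⟩
        · rw [Finset.union_insert]
          simpa [hG'.one] using hI1.insert v
        · simp [Finset.insert_subset_iff, hvA]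
    · rintro t s1 hf ⟨ht, hI1, hI2⟩
      refine ⟨by omega, A ∪ G.edge e, hI1, ?_⟩
      by_cases hsub : G.edge e ⊆ A
      · rw [if_pos hsub] at hI2
        exact .inl ⟨Finset.union_eq_left.2 hsub, hI2, fun _ => hsub⟩
      · rw [if_neg hsub] at hI2
        exact .inr ⟨rfl, hsub, huA, hI2⟩
  · simp only [Test.Holds, reg_setReg, arr_setReg, he, hh, hG.one] at hb
    have huA : u ∉ A := by rw [← hA.eq_one_iff]; simpa using hb
    exact ⟨by omega, A, hA, .inl ⟨rfl, by simp, fun h => absurd h huA⟩⟩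

/-- Close the set in array `6` under the hyperedges enabled in array `5`. -/
def close : Prog :=
  block [.const 9 1, .while (.eq 9 4) (block [.const 9 0, forEdges (block [.load 10 5 8,
    .ite (.eq 10 4) (block [closeHead, closeTail]) .skip])])]

/-- Every round except the last adds a vertex, so there are at most `n + 1` rounds. Only vertices
that belong to every closed superset of `S` are added, and a round without change certifies that the
set is closed. -/
theorem wp_close (hne : ∀ e, (G.edge e).Nonempty) (hG : G.InMemory s) {S : Finset (Fin n)}
    (hS : IsIndicator (s.arr 6) S) {tl hd : Fin m → Fin n} {en : Fin m → Prop}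
    (htl : ∀ e : Fin m, s.arr 3 e = tl e) (hhd : ∀ e : Fin m, s.arr 4 e = hd e)
    (hen : ∀ e : Fin m, s.arr 5 e = 1 ↔ en e) :
    wp close s fun t s' => t ≤ 50 * (n + 1) * (G.size + 1) ∧
      ∃ A, IsIndicator (s'.arr 6) A ∧ Preflow.IsClosure G en tl hd S A := by
  classical
  refine wp_seq (wp_const ?_)
  have hG1 : G.InMemory (s.setReg 9 1) := hG.setReg (by norm_num)
  refine (wp_while (T := 37 * G.size + 3) (j₀ := n + 1) (fun j s' => ∃ A, IsIndicator (s'.arr 6) A ∧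
    S ⊆ A ∧ (∀ A', S ⊆ A' → Preflow.Closed G en tl hd A' → A ⊆ A') ∧
      ((s'.reg 9 = 1 ∧ n + 1 ≤ j + A.card) ∨ (s'.reg 9 = 0 ∧ Preflow.Closed G en tl hd A)))
    ?_ ?_).mono ?_
  · exact ⟨S, hS, subset_rfl, fun _ h _ => h, .inl ⟨by simp, by omega⟩⟩
  · rintro j s1 hf1 ⟨A, hA1, hA2, hA3, hA4⟩ hb
    have hG2 := hG1.frame hf1 (by decide)
    have hb : s1.reg 9 = 1 := by simpa [Test.Holds, hG2.one] using hb
    have hA4 : n + 1 ≤ j + A.card := by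
      rcases hA4 with h | h
      · exact h.2
      · omega
    have hAn : A.card ≤ n := by simpa using Finset.card_le_univ A
    obtain ⟨j, rfl⟩ : ∃ j', j = j' + 1 := ⟨j - 1, by omega⟩
    refine ⟨j, rfl, wp_seq (wp_const ?_)⟩
    refine (wp_forEdges (a := 13) (b := 22) hne (hG2.setReg (by norm_num)) (fun D s' => ∃ A',
      IsIndicator (s'.arr 6) A' ∧ A ⊆ A' ∧
      (∀ A'', S ⊆ A'' → Preflow.Closed G en tl hd A'' → A' ⊆ A'') ∧
        ((s'.reg 9 = 0 ∧ A' = A ∧ ∀ e ∈ D, en e → (tl e ∈ A → G.edge e ⊆ A) ∧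
          ∀ w ∈ G.edge e, w ∈ A → hd e ∈ A) ∨ (s'.reg 9 = 1 ∧ A ≠ A')))
      (by decide) (by decide) ⟨A, hA1, subset_rfl, hA3, .inl ⟨by simp, rfl, by simp⟩⟩ ?_).mono ?_
    · rintro D e s2 hD hG3 hf2 h8 ⟨B, hB1, hB2, hB3, hB4⟩
      have h3 : s2.arr 3 = s.arr 3 := (hf2.arr 3 (by decide)).trans (hf1.arr 3 (by decide))
      have h4 : s2.arr 4 = s.arr 4 := (hf2.arr 4 (by decide)).trans (hf1.arr 4 (by decide))
      have h5 : s2.arr 5 = s.arr 5 := (hf2.arr 5 (by decide)).trans (hf1.arr 5 (by decide))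
      refine wp_seq (wp_load (wp_ite (fun hb => wp_seq ?_) (fun hb => wp_skip ?_)))
      · have hen' : en e := by
          rw [← hen]; simpa [Test.Holds, hG3.one, h8, h5] using hb
        refine (wp_closeHead (hG3.setReg (by norm_num)) (e := e) (by simpa using h8) (A := B)
          (by simpa using hB1) (h := hd e) (by simpa [h4] using hhd e)).mono ?_
        rintro t1 s3 hf3 ⟨ht1, B', hB'1, hB'2⟩
        have hG4 := (hG3.setReg (x := 10) (v := s2.arr 5 (s2.reg 8)) (by norm_num)).frame hf3
          (by decide)
        refine (wp_closeTail hG4 (e := e) ((hf3.reg 8 (by decide)).trans (by simpa using h8))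
          hB'1 (u := tl e) (by rw [hf3.arr 3 (by decide)]; simpa [h3] using htl e)).mono ?_
        rintro t2 s4 hf4 ⟨ht2, B'', hB''1, hB''2⟩
        refine ⟨by omega, B'', by simpa using hB''1, ?_⟩
        have hBB' : B ⊆ B' := by
          rcases hB'2 with h | h
          · rw [h.1]
          · rw [h.1]; exact Finset.subset_insert _ _
        have hBB'' : B' ⊆ B'' := by
          rcases hB''2 with h | h
          · rw [h.1]
          · rw [h.1]; exact Finset.subset_union_left
        have hlow : ∀ A'', S ⊆ A'' → Preflow.Closed G en tl hd A'' → B' ⊆ A'' := by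
          intro A'' h1 h2
          rcases hB'2 with h | ⟨h, -, ⟨w, hw, hwB⟩, -⟩
          · rw [h.1]; exact hB3 _ h1 h2
          · rw [h]
            exact Finset.insert_subset ((h2 e hen').2 w hw (hB3 _ h1 h2 hwB)) (hB3 _ h1 h2)
        have hlow2 : ∀ A'', S ⊆ A'' → Preflow.Closed G en tl hd A'' → B'' ⊆ A'' := by
          intro A'' h1 h2
          rcases hB''2 with h | ⟨h, -, hu, -⟩
          · rw [h.1]; exact hlow _ h1 h2
          · rw [h]
            exact Finset.union_subset (hlow _ h1 h2) ((h2 e hen').1 (hlow _ h1 h2 hu))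
        refine ⟨hB2.trans (hBB'.trans hBB''), hlow2, ?_⟩
        simp only [reg_setReg] at hB'2 ⊢
        norm_num at hB'2 ⊢
        rcases hB'2 with ⟨e1, r1, c1⟩ | ⟨e1, c1, -, r1⟩
        · subst e1
          rcases hB''2 with ⟨e2, r2, c2⟩ | ⟨e2, c2, -, r2⟩
          · subst e2
            rcases hB4 with ⟨r0, rfl, hcl⟩ | ⟨r0, hne⟩
            · refine .inl ⟨by omega, rfl, ⟨fun _ => ⟨c2, c1⟩, hcl⟩⟩
            · exact .inr ⟨by omega, hne⟩
          · refine .inr ⟨r2, ?_⟩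
            intro hAB
            exact c2 ((Finset.subset_union_right.trans
              (e2.symm.subset.trans hAB.symm.subset)).trans hB2)
        · refine .inr ⟨?_, ?_⟩
          · rcases hB''2 with ⟨e2, r2, c2⟩ | ⟨e2, c2, -, r2⟩ <;> omega
          · rintro rfl
            exact c1 (hB2 (hBB'' (by rw [e1]; simp)))
      · have hen' : ¬ en e := by
          rw [← hen]; simpa [Test.Holds, hG3.one, h8, h5] using hb
        refine ⟨by omega, B, by simpa using hB1, hB2, hB3, ?_⟩
        rcases hB4 with ⟨h, h', h''⟩ | ⟨h, h'⟩
        · refine .inl ⟨by simpa using h, h', fun e' he' hc => ?_⟩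
          rcases Finset.mem_insert.1 he' with rfl | he'
          · exact absurd hc hen'
          · exact h'' e' he' hc
        · exact .inr ⟨by simpa using h, h'⟩
    · rintro t s2 hf2 ⟨ht, B, hB1, hB2, hB3, hB4⟩
      refine ⟨by omega, B, hB1, hA2.trans hB2, hB3, ?_⟩
      rcases hB4 with ⟨h, rfl, hcl⟩ | ⟨h, hne⟩
      · exact .inr ⟨h, fun e he => hcl e (Finset.mem_univ _) he⟩
      · have := Finset.card_lt_card (Finset.ssubset_iff_subset_ne.2 ⟨hB2, hne⟩)
        exact .inl ⟨h, by omega⟩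
  · rintro t s1 hf ⟨ht, ⟨j, hj, A, hA1, hA2, hA3, hA4⟩, hb⟩
    have hG2 := hG1.frame hf (by decide)
    refine ⟨?_, A, hA1, hA2, ?_, hA3⟩
    · nlinarith
    · rcases hA4 with h | h
      · exact absurd (by simpa [Test.Holds, hG2.one] using h.1) hb
      · exact h.2

end MultiHypergraph

/-! ### Minimum terminal cuts -/

namespace MultiHypergraph

open Ram

variable {n m : ℕ} {G : MultiHypergraph n m} {s s' : Store} {S T : Finset (Fin n)}
  {σ : Preflow n m}

/-- The arrays `3`, `4`, `7` and `8` hold the preflow. -/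
structure _root_.Preflow.InMemory (σ : Preflow n m) (s : Store) : Prop where
  tail : ∀ e : Fin m, s.arr 3 e = σ.tail e
  head : ∀ e : Fin m, s.arr 4 e = σ.head e
  exc : ∀ v : Fin n, s.arr 7 v = σ.exc v
  lab : ∀ v : Fin n, s.arr 8 v = σ.lab v

theorem _root_.Preflow.InMemory.congr (h : σ.InMemory s) (h3 : s'.arr 3 = s.arr 3)
    (h4 : s'.arr 4 = s.arr 4) (h7 : s'.arr 7 = s.arr 7) (h8 : s'.arr 8 = s.arr 8) :
    σ.InMemory s' :=
  ⟨by rw [h3]; exact h.tail, by rw [h4]; exact h.head, by rw [h7]; exact h.exc,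
    by rw [h8]; exact h.lab⟩

theorem update_coe {N : ℕ} {a : ℕ → ℕ} {f : Fin N → ℕ} (h : ∀ v : Fin N, a v = f v) (x : Fin N)
    (y : ℕ) (v : Fin N) : Function.update a x y v = Function.update f x y v := by
  by_cases hv : v = x
  · subst hv; simp
  · rw [Function.update_of_ne hv, Function.update_of_ne (fun hc => hv (Fin.ext hc)), h]

theorem update_coe_fin {N M : ℕ} {a : ℕ → ℕ} {f : Fin N → Fin M} (h : ∀ v : Fin N, a v = f v)
    (x : Fin N) (y : Fin M) (v : Fin N) :
    Function.update a x y v = (Function.update f x y v : Fin M) := by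
  by_cases hv : v = x
  · subst hv; simp
  · rw [Function.update_of_ne hv, Function.update_of_ne (fun hc => hv (Fin.ext hc)), h]

/-- Try to move the head of the hyperedge in register `8` from level `ℓ` (register `16`) to level
`ℓ - 1` (register `17`). -/
def moveHead : Prog :=
  block [.load 10 4 8, .load 11 8 10, .ite (.eq 11 16) (block [.load 12 7 10, .ite (.lt 3 12)
    (block [.const 13 0, scan (block [.load 14 8 7,
        .ite (.eq 14 17) (block [.const 13 1, .copy 18 7]) .skip]),
      .ite (.eq 13 4) (block [.store 4 8 18, .pred 12, .store 7 10 12, .load 12 7 18, .succ 12,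
        .store 7 18 12]) .skip]) .skip]) .skip]

/-- Try to move the tail of the hyperedge in register `8` from level `ℓ - 1` to level `ℓ`. -/
def moveTail : Prog :=
  block [.load 10 3 8, .load 11 8 10, .ite (.eq 11 17)
    (block [.const 13 0, scan (block [.load 14 8 7,
        .ite (.eq 14 16) (block [.load 14 7 7,
          .ite (.lt 3 14) (block [.const 13 1, .copy 18 7]) .skip]) .skip]),
      .ite (.eq 13 4) (block [.store 3 8 18, .load 12 7 18, .pred 12, .store 7 18 12,
        .load 12 7 10, .succ 12, .store 7 10 12]) .skip]) .skip]

/-- One move suffices: afterwards the head is on level `ℓ - 1`, so the hyperedge is stuck on level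
`ℓ`. If no move takes place, one of the three conditions for a move has failed. -/
theorem wp_moveHead (hG : G.InMemory s) {e : Fin m} (he : s.reg 8 = e) (hσ : σ.InMemory s)
    (hI : σ.Inv G S T) {ℓ : ℕ} (h16 : s.reg 16 = ℓ) (h17 : s.reg 17 + 1 = ℓ) :
    wp moveHead s fun t s' => t ≤ 7 * (G.edge e).card + 20 ∧ ∃ σ' : Preflow n m,
      σ'.InMemory s' ∧ σ'.Inv G S T ∧ σ.Descends ℓ σ' ∧ σ'.tail = σ.tail ∧
        (∀ e' ≠ e, σ'.head e' = σ.head e') ∧ σ'.StuckHead G ℓ e := by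
  have hb0 := hσ.head e
  refine wp_seq (wp_load (wp_seq (wp_load (wp_ite (fun hb => wp_seq (wp_load
    (wp_ite (fun hx => ?_) (fun hx => wp_skip ?_)))) (fun hb => wp_skip ?_)))))
  all_goals simp [Test.Holds, he, hb0, hσ.lab, h16] at hb
  · simp [Test.Holds, he, hb0, hσ.exc, hG.zero] at hx
    refine wp_seq (wp_const (wp_seq ?_))
    set s0 := ((((s.setReg 10 _).setReg 11 _).setReg 12 _).setReg 13 0) with hs0
    have hG0 : G.InMemory s0 := by
      repeat' first | exact hG | apply InMemory.setReg | norm_num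
    refine (wp_scan (T := 4) hG0 e (by simpa [hs0] using he)
      (fun D s' => (s'.reg 13 = 0 ∧ ∀ w ∈ D, σ.lab w + 1 ≠ ℓ) ∨ (s'.reg 13 = 1 ∧
        ∃ w ∈ G.edge e, s'.reg 18 = w ∧ σ.lab w + 1 = ℓ)) (by decide) (by decide)
      (by simp [hs0]) ?_).mono ?_
    · intro D v s' q hv hvD hG' hf hD
      have h8 : s'.arr 8 v = σ.lab v := by
        rw [hf.arr 8 (by decide), ← hσ.lab v]; simp [hs0]
      have h17' : s'.reg 17 + 1 = ℓ := by
        rw [hf.reg 17 (by decide), ← h17]; simp [hs0]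
      refine wp_seq (wp_load (wp_ite (fun hb => wp_seq (wp_const (wp_copy ⟨by norm_num, ?_⟩)))
        (fun hb => wp_skip ⟨by norm_num, ?_⟩)))
      · simp [Test.Holds, h8] at hb
        refine .inr ⟨by simp, v, hv, by simp, by omega⟩
      · simp [Test.Holds, h8] at hb
        rcases hD with ⟨h1, h2⟩ | ⟨h1, h2⟩
        · refine .inl ⟨by simpa using h1, fun w hw => ?_⟩
          rcases Finset.mem_insert.1 hw with rfl | hw
          · omega
          · exact h2 w hw
        · exact .inr ⟨by simpa using h1, by simpa using h2⟩
    · rintro t s1 hf ⟨ht, hD⟩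
      have ho : s1.reg 4 = 1 := (hf.reg 4 (by decide)).trans (by simpa [hs0] using hG.one)
      have h10 : s1.reg 10 = σ.head e := (hf.reg 10 (by decide)).trans (by simp [hs0, he, hb0])
      have h12 : s1.reg 12 = σ.exc (σ.head e) :=
        (hf.reg 12 (by decide)).trans (by simp [hs0, he, hb0, hσ.exc])
      have hr8 : s1.reg 8 = e := (hf.reg 8 (by decide)).trans (by simp [hs0, he])
      have hσ1 : σ.InMemory s1 := hσ.congr ((hf.arr 3 (by decide)).trans (by simp [hs0]))
        ((hf.arr 4 (by decide)).trans (by simp [hs0])) ((hf.arr 7 (by decide)).trans (by simp [hs0]))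
        ((hf.arr 8 (by decide)).trans (by simp [hs0]))
      rcases hD with ⟨h1, h2⟩ | ⟨h1, w, hw, h18, hlw⟩
      · refine wp_ite (fun hb => ?_) (fun hb => wp_skip ⟨by omega, σ, hσ1, hI, .refl _ _, rfl,
          fun _ _ => rfl, fun _ _ => h2⟩)
        simp [Test.Holds, h1, ho] at hb
      · refine wp_ite (fun hb => ?_) (fun hb => absurd (show s1.reg 13 = s1.reg 4 by omega) hb)
        have hne : w ≠ σ.head e := fun hc => by rw [hc] at hlw; omega
        refine wp_seq (wp_store (wp_seq (wp_pred (wp_seq (wp_store (wp_seq (wp_load (wp_seq (wp_succ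
          (wp_store ⟨by omega, σ.pushHead e w, ⟨?_, ?_, ?_, ?_⟩, hI.pushHead hw (by omega) hx,
            Preflow.descends_pushHead hlw, rfl, fun e' he' => ?_, fun h1 h2 w' hw' => ?_⟩))))))))))
        · simpa [Preflow.pushHead] using hσ1.tail
        · intro e'
          simpa [Preflow.pushHead, hr8, h18] using update_coe_fin hσ1.head e w e'
        · intro v
          have h7 : ∀ v : Fin n, Function.update (s1.arr 7) (σ.head e) (σ.exc (σ.head e) - 1) v =
              Function.update σ.exc (σ.head e) (σ.exc (σ.head e) - 1) v :=
            update_coe hσ1.exc _ _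
          have h7w : Function.update (s1.arr 7) (σ.head e) (σ.exc (σ.head e) - 1) w = σ.exc w := by
            rw [h7, Function.update_of_ne hne]
          simp [h10, h12, h18, h7w]
          exact update_coe h7 w _ v
        · simpa [Preflow.pushHead] using hσ1.lab
        · simp [Preflow.pushHead, he']
        · simp [Preflow.pushHead] at h1
          omega
  · simp [Test.Holds, he, hb0, hσ.exc, hG.zero] at hx
    exact ⟨by omega, σ, hσ.congr (by simp) (by simp) (by simp) (by simp), hI, .refl _ _, rfl,
      fun _ _ => rfl, fun _ h => by omega⟩
  · exact ⟨by omega, σ, hσ.congr (by simp) (by simp) (by simp) (by simp), hI, .refl _ _, rfl,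
      fun _ _ => rfl, fun h => absurd h hb⟩

/-- After a move the tail is on level `ℓ`, no longer on `ℓ - 1`, and the hyperedge is stuck. -/
theorem wp_moveTail (hG : G.InMemory s) {e : Fin m} (he : s.reg 8 = e) (hσ : σ.InMemory s)
    (hI : σ.Inv G S T) {ℓ : ℕ} (h16 : s.reg 16 = ℓ) (h17 : s.reg 17 + 1 = ℓ) :
    wp moveTail s fun t s' => t ≤ 9 * (G.edge e).card + 20 ∧ ∃ σ' : Preflow n m,
      σ'.InMemory s' ∧ σ'.Inv G S T ∧ σ.Descends ℓ σ' ∧ σ'.head = σ.head ∧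
        (∀ e' ≠ e, σ'.tail e' = σ.tail e') ∧ σ'.StuckTail G ℓ e := by
  have hb0 := hσ.tail e
  refine wp_seq (wp_load (wp_seq (wp_load (wp_ite (fun hb => ?_) (fun hb => wp_skip ?_)))))
  all_goals simp [Test.Holds, he, hb0, hσ.lab] at hb
  · refine wp_seq (wp_const (wp_seq ?_))
    set s0 := (((s.setReg 10 _).setReg 11 _).setReg 13 0) with hs0
    have hG0 : G.InMemory s0 := by
      repeat' first | exact hG | apply InMemory.setReg | norm_num
    refine (wp_scan (T := 6) hG0 e (by simpa [hs0] using he)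
      (fun D s' => (s'.reg 13 = 0 ∧ ∀ u ∈ D, σ.lab u = ℓ → ¬ 0 < σ.exc u) ∨ (s'.reg 13 = 1 ∧
        ∃ u ∈ G.edge e, s'.reg 18 = u ∧ σ.lab u = ℓ ∧ 0 < σ.exc u)) (by decide) (by decide)
      (by simp [hs0]) ?_).mono ?_
    · intro D v s' q hv hvD hG' hf hD
      have h8 : s'.arr 8 v = σ.lab v := by
        rw [hf.arr 8 (by decide), ← hσ.lab v]; simp [hs0]
      have h7 : s'.arr 7 v = σ.exc v := by
        rw [hf.arr 7 (by decide), ← hσ.exc v]; simp [hs0]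
      have h16' : s'.reg 16 = ℓ := by
        rw [hf.reg 16 (by decide), ← h16]; simp [hs0]
      refine wp_seq (wp_load (wp_ite (fun hb => wp_seq (wp_load (wp_ite
        (fun hc => wp_seq (wp_const (wp_copy ⟨by norm_num, ?_⟩)))
        (fun hc => wp_skip ⟨by norm_num, ?_⟩)))) (fun hb => wp_skip ⟨by norm_num, ?_⟩)))
      all_goals simp [Test.Holds, h8, h16'] at hb
      · simp [Test.Holds, h7, hG'.zero] at hc
        exact .inr ⟨by simp, v, hv, by simp, hb, hc⟩
      · simp [Test.Holds, h7, hG'.zero] at hc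
        rcases hD with ⟨h1, h2⟩ | ⟨h1, h2⟩
        · refine .inl ⟨by simpa using h1, fun w hw => ?_⟩
          rcases Finset.mem_insert.1 hw with rfl | hw
          · omega
          · exact h2 w hw
        · exact .inr ⟨by simpa using h1, by simpa using h2⟩
      · rcases hD with ⟨h1, h2⟩ | ⟨h1, h2⟩
        · refine .inl ⟨by simpa using h1, fun w hw => ?_⟩
          rcases Finset.mem_insert.1 hw with rfl | hw
          · omega
          · exact h2 w hw
        · exact .inr ⟨by simpa using h1, by simpa using h2⟩
    · rintro t s1 hf ⟨ht, hD⟩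
      have ho : s1.reg 4 = 1 := (hf.reg 4 (by decide)).trans (by simpa [hs0] using hG.one)
      have h10 : s1.reg 10 = σ.tail e := (hf.reg 10 (by decide)).trans (by simp [hs0, he, hb0])
      have hr8 : s1.reg 8 = e := (hf.reg 8 (by decide)).trans (by simp [hs0, he])
      have hσ1 : σ.InMemory s1 := hσ.congr ((hf.arr 3 (by decide)).trans (by simp [hs0]))
        ((hf.arr 4 (by decide)).trans (by simp [hs0])) ((hf.arr 7 (by decide)).trans (by simp [hs0]))
        ((hf.arr 8 (by decide)).trans (by simp [hs0]))
      rcases hD with ⟨h1, h2⟩ | ⟨h1, u, hu, h18, hlu, hx⟩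
      · refine wp_ite (fun hb => ?_) (fun hb => wp_skip ⟨by omega, σ, hσ1, hI, .refl _ _, rfl,
          fun _ _ => rfl, fun u hu hl hx => absurd hx (h2 u hu hl)⟩)
        simp [Test.Holds, h1, ho] at hb
      · refine wp_ite (fun hb => ?_) (fun hb => absurd (show s1.reg 13 = s1.reg 4 by omega) hb)
        have hlt : σ.lab (σ.tail e) + 1 = ℓ := by omega
        have hne : σ.tail e ≠ u := fun hc => by rw [hc] at hlt; omega
        refine wp_seq (wp_store (wp_seq (wp_load (wp_seq (wp_pred (wp_seq (wp_store (wp_seq (wp_load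
          (wp_seq (wp_succ (wp_store ⟨by omega, σ.pushTail e u, ⟨?_, ?_, ?_, ?_⟩,
            hI.pushTail hu (by omega) hx, Preflow.descends_pushTail hlt, rfl,
            fun e' he' => ?_, fun u' hu' h1 h2 => ?_⟩))))))))))))
        · intro e'
          simpa [Preflow.pushTail, hr8, h18] using update_coe_fin hσ1.tail e u e'
        · simpa [Preflow.pushTail] using hσ1.head
        · intro v
          have h7 : ∀ v : Fin n, Function.update (s1.arr 7) u (σ.exc u - 1) v =
              Function.update σ.exc u (σ.exc u - 1) v :=
            update_coe hσ1.exc _ _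
          have h7w : Function.update (s1.arr 7) u (σ.exc u - 1) (σ.tail e) =
              σ.exc (σ.tail e) := by
            rw [h7, Function.update_of_ne hne]
          simp [h10, h18, hσ1.exc, h7w]
          exact update_coe h7 (σ.tail e) _ v
        · simpa [Preflow.pushTail] using hσ1.lab
        · simp [Preflow.pushTail, he']
        · simp [Preflow.pushTail]
          omega
  · exact ⟨by omega, σ, hσ.congr (by simp) (by simp) (by simp) (by simp), hI, .refl _ _, rfl,
      fun _ _ => rfl, fun _ _ _ _ h => hb (by omega)⟩

/-- Move all units of level `ℓ` that can be moved to level `ℓ - 1`. -/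
def pass : Prog := forEdges (block [moveHead, moveTail])

theorem wp_pass (hne : ∀ e, (G.edge e).Nonempty) (hG : G.InMemory s) (hσ : σ.InMemory s)
    (hI : σ.Inv G S T) {ℓ : ℕ} (h16 : s.reg 16 = ℓ) (h17 : s.reg 17 + 1 = ℓ) :
    wp pass s fun t s' => t ≤ 58 * G.size + 2 ∧ ∃ σ' : Preflow n m,
      σ'.InMemory s' ∧ σ'.Inv G S T ∧ σ.Descends ℓ σ' ∧ (∀ e, σ'.StuckHead G ℓ e) ∧
        ∀ e, σ'.StuckTail G ℓ e := by
  refine (wp_forEdges (a := 16) (b := 40) hne hG (fun D s' => ∃ σ' : Preflow n m,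
    σ'.InMemory s' ∧ σ'.Inv G S T ∧ σ.Descends ℓ σ' ∧ (∀ e ∈ D, σ'.StuckHead G ℓ e) ∧
      ∀ e ∈ D, σ'.StuckTail G ℓ e) (by decide) (by decide)
    ⟨σ, hσ.congr rfl rfl rfl rfl, hI, .refl _ _, by simp, by simp⟩ ?_).mono ?_
  · rintro D e s1 hD hG1 hf h8 ⟨σ1, hm1, hI1, hd1, hh1, ht1⟩
    have h16' : s1.reg 16 = ℓ := (hf.reg 16 (by decide)).trans h16
    have h17' : s1.reg 17 + 1 = ℓ := by rw [hf.reg 17 (by decide), h17]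
    have heD : e ∉ D := fun h => by simpa using (hD e).1 h
    refine wp_seq ((wp_moveHead hG1 h8 hm1 hI1 h16' h17').mono ?_)
    rintro t2 s2 hf2 ⟨hT2, σ2, hm2, hI2, hd2, htl2, hhd2, hst2⟩
    refine (wp_moveTail (hG1.frame hf2 (by decide)) ((hf2.reg 8 (by decide)).trans h8) hm2 hI2
      ((hf2.reg 16 (by decide)).trans h16') (by rw [hf2.reg 17 (by decide), h17'])).mono ?_
    rintro t3 s3 hf3 ⟨hT3, σ3, hm3, hI3, hd3, hhd3, htl3, hst3⟩
    refine ⟨by omega, σ3, hm3.congr rfl rfl rfl rfl, hI3, (hd1.trans hd2).trans hd3, ?_, ?_⟩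
    · intro e' he'
      rcases Finset.mem_insert.1 he' with rfl | he'
      · exact hst2.of_descends hd3 (by rw [hhd3])
      · have : e' ≠ e := fun h => heD (h ▸ he')
        exact ((hh1 e' he').of_descends hd2 (hhd2 e' this)).of_descends hd3 (by rw [hhd3])
    · intro e' he'
      rcases Finset.mem_insert.1 he' with rfl | he'
      · exact hst3
      · have : e' ≠ e := fun h => heD (h ▸ he')
        exact ((ht1 e' he').of_descends hd2 (by rw [htl2])).of_descends hd3 (htl3 e' this)
  · rintro t s1 - ⟨ht, σ1, h1, h2, h3, h4, h5⟩
    exact ⟨by omega, σ1, h1, h2, h3, fun e => h4 e (Finset.mem_univ _),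
      fun e => h5 e (Finset.mem_univ _)⟩

/-- Raise the labels of the active vertices of level `ℓ` to `ℓ + 1` (register `19`). -/
def raise : Prog :=
  forBelow 7 1 (block [.load 10 8 7, .ite (.eq 10 16) (block [.load 10 7 7, .ite (.lt 3 10)
    (block [.load 10 9 7, .ite (.eq 10 4) .skip (block [.store 8 7 19, .const 9 1])]) .skip])
      .skip])

theorem wp_raise (hG : G.InMemory s) (hσ : σ.InMemory s) (hS : IsIndicator (s.arr 9) S) {ℓ : ℕ}
    (h16 : s.reg 16 = ℓ) (h19 : s.reg 19 = ℓ + 1) :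
    wp raise s fun t s' => t ≤ n * 13 + 2 ∧ (σ.relabel S ℓ).InMemory s' ∧
      ((s'.reg 9 = s.reg 9 ∧ ∀ v, ¬ (σ.lab v = ℓ ∧ 0 < σ.exc v ∧ v ∉ S)) ∨
        (s'.reg 9 = 1 ∧ ∃ v, σ.lab v = ℓ ∧ 0 < σ.exc v ∧ v ∉ S)) := by
  classical
  refine (wp_forBelow_const (N := n) 11 (fun D s' => (∀ v : Fin n, s'.arr 8 v =
    if v ∈ D ∧ σ.lab v = ℓ ∧ 0 < σ.exc v ∧ v ∉ S then ℓ + 1 else σ.lab v) ∧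
      ((s'.reg 9 = s.reg 9 ∧ ∀ v ∈ D, ¬ (σ.lab v = ℓ ∧ 0 < σ.exc v ∧ v ∉ S)) ∨
        (s'.reg 9 = 1 ∧ ∃ v, σ.lab v = ℓ ∧ 0 < σ.exc v ∧ v ∉ S)))
    (by decide) (by decide) (by decide) hG.regN (by simp [hσ.lab]) ?_).mono ?_
  · rintro D v s1 hD hf h7 ⟨hI1, hI2⟩
    have hG1 := hG.frame hf (by decide)
    have hvD : v ∉ D := fun h => by simpa using (hD v).1 h
    have hlv : s1.arr 8 v = σ.lab v := by rw [hI1 v, if_neg (by tauto)]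
    have hxv : s1.arr 7 v = σ.exc v := by rw [hf.arr 7 (by decide), hσ.exc]
    have hSv : s1.arr 9 v = 1 ↔ v ∈ S := by rw [hf.arr 9 (by decide), hS.eq_one_iff]
    have h16' : s1.reg 16 = ℓ := (hf.reg 16 (by decide)).trans h16
    have h19' : s1.reg 19 = ℓ + 1 := (hf.reg 19 (by decide)).trans h19
    have hskip : ¬ (σ.lab v = ℓ ∧ 0 < σ.exc v ∧ v ∉ S) → ∀ s2 : Store, s2.arr 8 = s1.arr 8 →
        s2.reg 9 = s1.reg 9 → (∀ w : Fin n, s2.arr 8 w =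
          if w ∈ insert v D ∧ σ.lab w = ℓ ∧ 0 < σ.exc w ∧ w ∉ S then ℓ + 1 else σ.lab w) ∧
        ((s2.reg 9 = s.reg 9 ∧ ∀ w ∈ insert v D, ¬ (σ.lab w = ℓ ∧ 0 < σ.exc w ∧ w ∉ S)) ∨
        (s2.reg 9 = 1 ∧ ∃ v, σ.lab v = ℓ ∧ 0 < σ.exc v ∧ v ∉ S)) := by
      intro hn s2 h1 h2
      rw [h1, h2]
      refine ⟨fun w => ?_, ?_⟩
      · rw [hI1 w]
        by_cases hwv : w = v
        · subst hwv; rw [if_neg (by tauto), if_neg (by tauto)]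
        · simp [hwv]
      · rcases hI2 with ⟨h, h'⟩ | h
        · refine .inl ⟨h, fun w hw => ?_⟩
          rcases Finset.mem_insert.1 hw with rfl | hw
          · exact hn
          · exact h' w hw
        · exact .inr h
    refine wp_seq (wp_load (wp_ite (fun hb => wp_seq (wp_load (wp_ite (fun hc => wp_seq (wp_load
      (wp_ite (fun hd => wp_skip ⟨by norm_num, hskip ?_ _ (by simp) (by simp)⟩)
        (fun hd => wp_seq (wp_store (wp_const ⟨by norm_num, ?_, ?_⟩))))))
      (fun hc => wp_skip ⟨by norm_num, hskip ?_ _ (by simp) (by simp)⟩))))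
      (fun hb => wp_skip ⟨by norm_num, hskip ?_ _ (by simp) (by simp)⟩)))
    all_goals simp [Test.Holds, h7, hlv, h16'] at hb
    · simp [Test.Holds, h7, hG1.one, hSv] at hd
      tauto
    · simp [Test.Holds, h7, hG1.one, hSv] at hd
      simp [Test.Holds, h7, hxv, hG1.zero] at hc
      intro w
      simp [h7, h19', Function.update_apply]
      by_cases hwv : w = v
      · subst hwv; simp [hb, hc, hd]
      · have : (w : ℕ) ≠ v := fun h => hwv (Fin.ext h)
        simp [hwv, this, hI1 w]
    · simp [Test.Holds, h7, hG1.one, hSv] at hd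
      simp [Test.Holds, h7, hxv, hG1.zero] at hc
      exact .inr ⟨by simp, v, hb, hc, hd⟩
    · simp [Test.Holds, h7, hxv, hG1.zero] at hc
      omega
    · tauto
  · rintro t s1 hf ⟨ht, hI1, hI2⟩
    refine ⟨by omega, ⟨?_, ?_, ?_, ?_⟩, by simpa using hI2⟩
    · rw [hf.arr 3 (by decide)]; exact hσ.tail
    · rw [hf.arr 4 (by decide)]; exact hσ.head
    · rw [hf.arr 7 (by decide)]; exact hσ.exc
    · intro v
      rw [hI1 v]
      simp [Preflow.relabel]

/-- Treat the levels from `n` down to `1`. -/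
def wave : Prog :=
  block [.const 9 0, .copy 16 1, .copy 17 1, .pred 17, forBelow 20 1 (block [pass, .copy 19 16,
    .succ 19, raise, .pred 16, .pred 17])]

/-- On the way down units only enter levels that are still to be treated. If nothing is raised, the
levels already treated carry no excess outside `S`, and after level `1` no vertex is active. If
something is raised, the sum of the labels has grown. -/
theorem wp_wave (hne : ∀ e, (G.edge e).Nonempty) (hG : G.InMemory s) (hσ : σ.InMemory s)
    (hI : σ.Inv G S T) (hS : IsIndicator (s.arr 9) S) :
    wp wave s fun t s' => t ≤ n * (58 * G.size + n * 13 + 10) + 6 ∧ ∃ σ' : Preflow n m,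
      σ'.InMemory s' ∧ σ'.Inv G S T ∧
        ((s'.reg 9 = 0 ∧ ∀ v ∉ S, σ'.lab v ≤ n → σ'.exc v = 0) ∨
          (s'.reg 9 = 1 ∧ ∑ v, σ.lab v < ∑ v, σ'.lab v)) := by
  refine wp_seq (wp_const (wp_seq (wp_copy (wp_seq (wp_copy (wp_seq (wp_pred ?_)))))))
  set s0 := ((((s.setReg 9 0).setReg 16 _).setReg 17 _).setReg 17 _) with hs0
  have hG0 : G.InMemory s0 := by
    repeat' first | exact hG | apply InMemory.setReg | norm_num
  refine (wp_forBelow_const (N := n) (58 * G.size + n * 13 + 8) (fun D s' => ∃ σ' : Preflow n m,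
      σ'.InMemory s' ∧ σ'.Inv G S T ∧ s'.reg 16 = n - D.card ∧ s'.reg 17 = n - D.card - 1 ∧
        (∀ v, σ.lab v ≤ σ'.lab v) ∧
        ((s'.reg 9 = 0 ∧ ∀ v ∉ S, n - D.card < σ'.lab v → σ'.lab v ≤ n → σ'.exc v = 0) ∨
          (s'.reg 9 = 1 ∧ ∑ v, σ.lab v < ∑ v, σ'.lab v)))
    (by decide) (by decide) (by decide) hG0.regN ?_ ?_).mono ?_
  · refine ⟨σ, hσ.congr rfl rfl rfl rfl, hI, ?_, ?_, fun _ => le_rfl, .inl ⟨?_, ?_⟩⟩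
    · simp [hs0, hG.regN]
    · simp [hs0, hG.regN]
    · simp [hs0]
    · intro v _ h1 h2
      simp at h1
      omega
  · rintro D x s1 hD hf h20 ⟨σ1, hm1, hI1, h16, h17, hle1, hor⟩
    have hxD : x ∉ D := fun h => by simpa using (hD x).1 h
    have hDc : D.card < n := by
      have := Finset.card_lt_univ_of_notMem hxD
      simpa using this
    have hG1 := hG0.frame hf (by decide)
    refine wp_seq ((wp_pass hne hG1 hm1 hI1 h16 (by omega)).mono ?_)
    rintro t2 s2 hf2 ⟨ht2, σ2, hm2, hI2, hd2, hsh2, hst2⟩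
    have hG2 := hG1.frame hf2 (by decide)
    refine wp_seq (wp_copy (wp_seq (wp_succ (wp_seq ?_))))
    refine (wp_raise (σ := σ2) (S := S) (ℓ := n - D.card) ((hG2.setReg (by norm_num)).setReg
      (by norm_num)) (hm2.congr rfl rfl rfl rfl) ?_ ?_ ?_).mono ?_
    · simp only [arr_setReg]
      rw [hf2.arr 9 (by decide), hf.arr 9 (by decide)]
      exact hS
    · simp [hf2.reg 16 (by decide), h16]
    · simp [hf2.reg 16 (by decide), h16]
    · rintro t3 s3 hf3 ⟨ht3, hm3, h9⟩
      have h16' : s3.reg 16 = n - D.card :=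
        (hf3.reg 16 (by decide)).trans (by simp [hf2.reg 16 (by decide), h16])
      have h17' : s3.reg 17 = n - D.card - 1 :=
        (hf3.reg 17 (by decide)).trans (by simp [hf2.reg 17 (by decide), h17])
      have h9' : s2.reg 9 = s1.reg 9 := hf2.reg 9 (by decide)
      simp [h9'] at h9
      have hle2 : ∀ v, σ1.lab v ≤ (σ2.relabel S (n - D.card)).lab v := fun v => by
        have := σ2.lab_le_relabel S (n - D.card) v
        rw [hd2.lab_eq] at this
        exact this
      refine wp_seq (wp_pred (wp_pred ⟨by omega, σ2.relabel S (n - D.card),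
        hm3.congr rfl rfl rfl rfl, hI2.relabel (by omega) hsh2 hst2, ?_, ?_,
        fun v => (hle1 v).trans (hle2 v), ?_⟩))
      · rw [Finset.card_insert_of_notMem hxD]; simp [h16']; omega
      · rw [Finset.card_insert_of_notMem hxD]; simp [h17']; omega
      · rw [Finset.card_insert_of_notMem hxD]
        have hsum12 : ∑ v, σ1.lab v ≤ ∑ v, (σ2.relabel S (n - D.card)).lab v :=
          Finset.sum_le_sum fun v _ => hle2 v
        rcases h9 with ⟨h9, hno⟩ | ⟨h9, v, hv1, hv2, hv3⟩
        · rcases hor with ⟨h0, hz⟩ | ⟨h1, hlt⟩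
          · refine .inl ⟨by simp [h9, h0], fun v hv h1 h2 => ?_⟩
            have hlab : (σ2.relabel S (n - D.card)).lab v = σ2.lab v := by
              simp only [Preflow.relabel]
              rw [if_neg]
              rintro ⟨a, b, c⟩
              exact c (hno v a b)
            rw [hlab] at h1 h2
            change σ2.exc v = 0
            by_cases hvl : σ2.lab v = n - D.card
            · by_contra hne0
              exact hv (hno v hvl (by omega))
            · have hz1 := hz v hv
              rw [← hd2.lab_eq] at hz1
              have := hd2.exc_le v (by rw [← hd2.lab_eq]; omega)
              have := hz1 (by omega) h2
              omega
          · exact .inr ⟨by simp [h9, h1], by omega⟩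
        · refine .inr ⟨by simp [h9], lt_of_le_of_lt (Finset.sum_le_sum fun v _ => hle1 v) ?_⟩
          refine Finset.sum_lt_sum (fun v _ => hle2 v) ⟨v, Finset.mem_univ _, ?_⟩
          rw [← hd2.lab_eq]
          simp only [Preflow.relabel]
          rw [if_pos ⟨hv1, hv2, hv3⟩]
          omega
  · rintro t s1 hf ⟨ht, σ1, hm1, hI1, h16, h17, hle1, hor⟩
    refine ⟨?_, σ1, hm1, hI1, ?_⟩
    · have : n * (58 * G.size + n * 13 + 8 + 2) = n * (58 * G.size + n * 13 + 10) := rfl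
      omega
    · rcases hor with ⟨h0, hz⟩ | h
      · refine .inl ⟨h0, fun v hv hl => hz v hv ?_ hl⟩
        have := hI1.lab_pos v
        simp
        omega
      · exact .inr h

end MultiHypergraph

/-! ### The initial preflow and the complete minimum cut computation. -/

namespace MultiHypergraph

open Ram

variable {n m : ℕ} {G : MultiHypergraph n m} {s s' : Store} {S T : Finset (Fin n)}

/-- Initial excesses, labels (register `15` holds `n + 1`) and marks. -/
def initVertices : Prog :=
  forBelow 7 1 (block [.store 7 7 3, .load 10 10 7, .ite (.eq 10 4) (.store 8 7 15) (.store 8 7 4),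
    .load 10 9 7, .store 6 7 10])

theorem wp_initVertices (hG : G.InMemory s) (hS : IsIndicator (s.arr 9) S)
    (hT : IsIndicator (s.arr 10) T) (h15 : s.reg 15 = n + 1) :
    wp initVertices s fun t s' => t ≤ n * 8 + 2 ∧ IsIndicator (s'.arr 6) S ∧
      (∀ v : Fin n, s'.arr 7 v = 0) ∧ ∀ v : Fin n, s'.arr 8 v = if v ∈ T then n + 1 else 1 := by
  refine (wp_forBelow_const (N := n) 6 (fun D s' => (∀ v ∈ D, s'.arr 6 v = if v ∈ S then 1 else 0) ∧
      (∀ v ∈ D, s'.arr 7 v = 0) ∧ ∀ v ∈ D, s'.arr 8 v = if v ∈ T then n + 1 else 1)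
    (by decide) (by decide) (by decide) hG.regN (by simp) ?_).mono ?_
  · rintro D v s1 hD hf h7 ⟨hI1, hI2, hI3⟩
    have hG1 := hG.frame hf (by decide)
    have hSv : s1.arr 9 v = if v ∈ S then 1 else 0 := by rw [hf.arr 9 (by decide), hS v]
    have hTv : s1.arr 10 v = 1 ↔ v ∈ T := by rw [hf.arr 10 (by decide), hT.eq_one_iff]
    have h15' : s1.reg 15 = n + 1 := (hf.reg 15 (by decide)).trans h15
    have hupd : ∀ (a : ℕ → ℕ) (f : Fin n → ℕ), (∀ w ∈ D, a w = f w) →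
        ∀ w ∈ insert v D, Function.update a v (f v) w = f w := by
      intro a f ha w hw
      rw [Function.update_apply]
      by_cases hwv : w = v
      · subst hwv; simp
      · have : (w : ℕ) ≠ v := fun h => hwv (Fin.ext h)
        rw [if_neg this]
        exact ha w ((Finset.mem_insert.1 hw).resolve_left hwv)
    refine wp_seq (wp_store (wp_seq (wp_load (wp_seq (wp_ite
      (fun hb => wp_store (wp_seq (wp_load (wp_store ⟨by norm_num, ?_⟩))))
      (fun hb => wp_store (wp_seq (wp_load (wp_store ⟨by norm_num, ?_⟩)))))))))
    all_goals
      simp [Test.Holds, h7, hG1.one, hTv] at hb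
      simp [h7, hG1.one, hG1.zero, hSv, h15']
      have e1 := hupd (s1.arr 6) (fun v => if v ∈ S then 1 else 0) hI1
      have e2 := hupd (s1.arr 7) (fun v => 0) hI2
      have e3 := hupd (s1.arr 8) (fun v => if v ∈ T then n + 1 else 1) hI3
      simp only [hb, if_true, if_false] at e3
      simp only [Finset.mem_insert, forall_eq_or_imp] at e1 e2 e3
      simp only [hb]
      simp at e1 e2 e3 ⊢
      exact ⟨e1, e2, e3.2⟩
  · rintro t s1 hf ⟨ht, hI1, hI2, hI3⟩
    exact ⟨by omega, fun v => hI1 v (Finset.mem_univ _), fun v => hI2 v (Finset.mem_univ _),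
      fun v => hI3 v (Finset.mem_univ _)⟩

/-- Saturate the hyperedges that leave `T` and enable all hyperedges. -/
def initEdges : Prog :=
  forEdges (block [.const 11 0, .const 12 0, .store 5 8 4, scan (block [.load 10 10 7,
      .ite (.eq 10 4) (block [.const 11 1, .copy 13 7]) (block [.const 12 1, .copy 14 7])]),
    .ite (.eq 11 4) (.ite (.eq 12 4)
      (block [.store 3 8 13, .store 4 8 14, .load 10 7 14, .succ 10, .store 7 14 10])
      (block [.store 3 8 13, .store 4 8 13])) (block [.store 3 8 14, .store 4 8 14])])

/-- A hyperedge that meets both `T` and its complement sends a unit out of `T`; the others carry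
nothing. So the tail is in `T` whenever the hyperedge meets `T`, and the head is outside `T` unless
the hyperedge lies in `T`. This makes the labels `n + 1` on `T` and `1` elsewhere valid. -/
theorem wp_initEdges (hne : ∀ e, (G.edge e).Nonempty) (hG : G.InMemory s)
    (hST : Disjoint S T) (hT : IsIndicator (s.arr 10) T) (h7 : ∀ v : Fin n, s.arr 7 v = 0)
    (h8 : ∀ v : Fin n, s.arr 8 v = if v ∈ T then n + 1 else 1) :
    wp initEdges s fun t s' => t ≤ 29 * G.size + 2 ∧ (∀ e : Fin m, s'.arr 5 e = 1) ∧
      ∃ σ : Preflow n m, σ.InMemory s' ∧ σ.Inv G S T := by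
  classical
  refine (wp_forEdges (a := 7) (b := 20) hne hG (fun D s' => (∀ e ∈ D, s'.arr 5 e = 1) ∧
      ∃ (tl hd : Fin m → Fin n) (ex : Fin n → ℕ),
        (∀ e ∈ D, s'.arr 3 e = tl e) ∧ (∀ e ∈ D, s'.arr 4 e = hd e) ∧
        (∀ v : Fin n, s'.arr 7 v = ex v) ∧ (∀ e, tl e ∈ G.edge e) ∧ (∀ e, hd e ∈ G.edge e) ∧
        (∀ e ∉ D, tl e = hd e) ∧ (∀ e ∈ D, (tl e ∈ T ∨ Disjoint (G.edge e) T) ∧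
          (hd e ∉ T ∨ G.edge e ⊆ T)) ∧
        ∀ v ∉ T, ex v + Preflow.fiberCard tl v = Preflow.fiberCard hd v)
    (by decide) (by decide) ?_ ?_).mono ?_
  -- Hyperedges not yet visited get an arbitrary common tail and head, which does not affect the
  -- balance of any vertex.
  · choose f hf using hne
    exact ⟨by simp, f, f, fun _ => 0, by simp, by simp, by simpa using h7, hf, hf, by simp, by simp,
      by simp⟩
  · rintro D e s1 hD hG1 hf hr8 ⟨hI5, tl, hd, ex, hI3, hI4, hI7, htm, hhm, heq, hprop, hex⟩
    have heD : e ∉ D := fun h => by simpa using (hD e).1 h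
    have hT1 : IsIndicator (s1.arr 10) T := by rw [hf.arr 10 (by decide)]; exact hT
    refine wp_seq (wp_const (wp_seq (wp_const (wp_seq (wp_store (wp_seq ?_))))))
    set s0 := (((s1.setReg 11 0).setReg 12 0).setArr 5 _ _) with hs0
    have hG0 : G.InMemory s0 := by
      repeat' first | exact hG1 | apply InMemory.setReg | apply InMemory.setArr | norm_num
    refine (wp_scan (T := 4) hG0 e (by simpa [hs0] using hr8)
      (fun D s' => ((s'.reg 11 = 0 ∧ ∀ w ∈ D, w ∉ T) ∨
          (s'.reg 11 = 1 ∧ ∃ w ∈ G.edge e, w ∈ T ∧ s'.reg 13 = w)) ∧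
        ((s'.reg 12 = 0 ∧ ∀ w ∈ D, w ∈ T) ∨
          (s'.reg 12 = 1 ∧ ∃ w ∈ G.edge e, w ∉ T ∧ s'.reg 14 = w))) (by decide) (by decide)
      (by simp [hs0]) ?_).mono ?_
    · rintro D v s2 q hv hvD hG2 hf2 ⟨hA, hB⟩
      have hTv : s2.arr 10 v = 1 ↔ v ∈ T := by
        rw [hf2.arr 10 (by decide)]; simpa [hs0] using hT1.eq_one_iff
      refine wp_seq (wp_load (wp_ite
        (fun hb => wp_seq (wp_const (wp_copy ⟨by norm_num, .inr ?_, ?_⟩)))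
        (fun hb => wp_seq (wp_const (wp_copy ⟨by norm_num, ?_, .inr ?_⟩)))))
      all_goals simp [Test.Holds, hG2.one, hTv] at hb
      · simpa using ⟨v, hv, hb, rfl⟩
      · rcases hB with ⟨h1, h2⟩ | ⟨h1, h2⟩
        · exact .inl ⟨by simpa using h1, fun w hw => by
            rcases Finset.mem_insert.1 hw with rfl | hw
            exacts [hb, h2 w hw]⟩
        · exact .inr ⟨by simpa using h1, by simpa using h2⟩
      · rcases hA with ⟨h1, h2⟩ | ⟨h1, h2⟩
        · exact .inl ⟨by simpa using h1, fun w hw => by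
            rcases Finset.mem_insert.1 hw with rfl | hw
            exacts [hb, h2 w hw]⟩
        · exact .inr ⟨by simpa using h1, by simpa using h2⟩
      · simpa using ⟨v, hv, hb, rfl⟩
    · rintro t s2 hf2 ⟨ht, hA, hB⟩
      have ho : s2.reg 4 = 1 := (hf2.reg 4 (by decide)).trans (by simpa [hs0] using hG1.one)
      have hr8' : s2.reg 8 = e := (hf2.reg 8 (by decide)).trans (by simp [hs0, hr8])
      have h3 : s2.arr 3 = s1.arr 3 := (hf2.arr 3 (by decide)).trans (by simp [hs0])
      have h4 : s2.arr 4 = s1.arr 4 := (hf2.arr 4 (by decide)).trans (by simp [hs0])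
      have h7 : s2.arr 7 = s1.arr 7 := (hf2.arr 7 (by decide)).trans (by simp [hs0])
      have h5 : s2.arr 5 = Function.update (s1.arr 5) e 1 :=
        (hf2.arr 5 (by decide)).trans (by simp [hs0, hr8, hG1.one])
      -- The bookkeeping shared by the three kinds of hyperedges, with `a` as new tail and `b` as
      -- new head.
      have hfin : ∀ (a b : Fin n), a ∈ G.edge e → b ∈ G.edge e → (a ∈ T ∨ Disjoint (G.edge e) T) →
          (b ∉ T ∨ G.edge e ⊆ T) → ∀ (s3 : Store) (ex' : Fin n → ℕ),
          s3.arr 5 = s2.arr 5 → s3.arr 3 = Function.update (s2.arr 3) e a →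
          s3.arr 4 = Function.update (s2.arr 4) e b → (∀ v : Fin n, s3.arr 7 v = ex' v) →
          (∀ v ∉ T, ex' v + (if a = v then 1 else 0) = ex v + if b = v then 1 else 0) →
          (∀ e' ∈ insert e D, s3.arr 5 e' = 1) ∧ ∃ (tl hd : Fin m → Fin n) (ex : Fin n → ℕ),
            (∀ e' ∈ insert e D, s3.arr 3 e' = tl e') ∧ (∀ e' ∈ insert e D, s3.arr 4 e' = hd e') ∧
            (∀ v : Fin n, s3.arr 7 v = ex v) ∧ (∀ e, tl e ∈ G.edge e) ∧ (∀ e, hd e ∈ G.edge e) ∧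
            (∀ e' ∉ insert e D, tl e' = hd e') ∧
            (∀ e' ∈ insert e D, (tl e' ∈ T ∨ Disjoint (G.edge e') T) ∧
              (hd e' ∉ T ∨ G.edge e' ⊆ T)) ∧
            ∀ v ∉ T, ex v + Preflow.fiberCard tl v = Preflow.fiberCard hd v := by
        intro a b ha hb ha' hb' s3 ex' e5 e3 e4 e7 hx
        have hcase : ∀ e' : Fin m, e' = e ∨ (e' ≠ e ∧ (e' : ℕ) ≠ e) := fun e' => by
          by_cases h : e' = e
          · exact .inl h
          · exact .inr ⟨h, fun hc => h (Fin.ext hc)⟩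
        refine ⟨fun e' he' => ?_, Function.update tl e a, Function.update hd e b, ex', fun e' he' => ?_,
          fun e' he' => ?_, e7, fun e' => ?_, fun e' => ?_, fun e' he' => ?_, fun e' he' => ?_,
          fun v hv => ?_⟩
        · rcases hcase e' with rfl | ⟨h, h'⟩
          · simp [e5, h5]
          · rw [e5, h5, Function.update_of_ne h']
            exact hI5 e' ((Finset.mem_insert.1 he').resolve_left h)
        · rcases hcase e' with rfl | ⟨h, h'⟩
          · simp [e3]
          · rw [e3, Function.update_of_ne h', Function.update_of_ne h, h3]
            exact hI3 e' ((Finset.mem_insert.1 he').resolve_left h)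
        · rcases hcase e' with rfl | ⟨h, h'⟩
          · simp [e4]
          · rw [e4, Function.update_of_ne h', Function.update_of_ne h, h4]
            exact hI4 e' ((Finset.mem_insert.1 he').resolve_left h)
        · rcases hcase e' with rfl | ⟨h, h'⟩
          · simpa using ha
          · rw [Function.update_of_ne h]; exact htm e'
        · rcases hcase e' with rfl | ⟨h, h'⟩
          · simpa using hb
          · rw [Function.update_of_ne h]; exact hhm e'
        · rw [Finset.mem_insert, not_or] at he'
          rw [Function.update_of_ne he'.1, Function.update_of_ne he'.1]
          exact heq e' he'.2
        · rcases hcase e' with rfl | ⟨h, h'⟩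
          · simpa using ⟨ha', hb'⟩
          · rw [Function.update_of_ne h, Function.update_of_ne h]
            exact hprop e' ((Finset.mem_insert.1 he').resolve_left h)
        · have c1 := Preflow.card_fiber_update tl e a v
          have c2 := Preflow.card_fiber_update hd e b v
          rw [heq e heD] at c1
          have := hx v hv
          have := hex v hv
          omega
      rcases hA with ⟨h11, hA⟩ | ⟨h11, a, ha, haT, h13⟩
      · refine wp_ite (fun hb => ?_) fun hb => ?_
        · simp [Test.Holds, ho, h11] at hb
        obtain ⟨b, hbe, hbT, h14⟩ : ∃ w ∈ G.edge e, w ∉ T ∧ s2.reg 14 = w := by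
          rcases hB with ⟨-, h⟩ | ⟨-, h⟩
          · obtain ⟨x, hx⟩ := hne e
            exact absurd (h x hx) (hA x hx)
          · exact h
        refine wp_seq (wp_store (wp_store ⟨by omega, hfin b b hbe hbe
          (.inr (Finset.disjoint_left.2 hA)) (.inl hbT) _ ex ?_ ?_ ?_ ?_ (fun _ _ => rfl)⟩))
        · simp
        · simp [hr8', h14]
        · simp [hr8', h14]
        · simpa [h7] using hI7
      · refine wp_ite (fun hb => ?_) fun hb => absurd (show s2.reg 11 = s2.reg 4 by omega) hb
        rcases hB with ⟨h12, hB⟩ | ⟨h12, b, hbe, hbT, h14⟩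
        · refine wp_ite (fun hb => ?_) fun hb => ?_
          · simp [Test.Holds, ho, h12] at hb
          refine wp_seq (wp_store (wp_store ⟨by omega, hfin a a ha ha (.inl haT) (.inr hB) _ ex
            ?_ ?_ ?_ ?_ (fun _ _ => rfl)⟩))
          · simp
          · simp [hr8', h13]
          · simp [hr8', h13]
          · simpa [h7] using hI7
        · refine wp_ite (fun hb => ?_) fun hb => absurd (show s2.reg 12 = s2.reg 4 by omega) hb
          refine wp_seq (wp_store (wp_seq (wp_store (wp_seq (wp_load (wp_seq (wp_succ (wp_store
            ⟨by omega, hfin a b ha hbe (.inl haT) (.inl hbT) _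
              (Function.update ex b (ex b + 1)) ?_ ?_ ?_ ?_ ?_⟩))))))))
          · simp
          · simp [hr8', h13]
          · simp [hr8', h14]
          · intro v
            simp [h14, h7, hI7]
            exact update_coe hI7 b _ v
          · intro v hv
            have hav : a ≠ v := fun h => hv (h ▸ haT)
            rw [if_neg hav, Function.update_apply]
            by_cases hvb : v = b
            · subst hvb; simp
            · rw [if_neg hvb, if_neg (Ne.symm hvb)]
  · rintro t s1 hf ⟨ht, hI5, tl, hd, ex, hI3, hI4, hI7, htm, hhm, -, hprop, hex⟩
    refine ⟨by omega, fun e => hI5 e (Finset.mem_univ _),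
      ⟨tl, hd, ex, fun v => if v ∈ T then n + 1 else 1⟩,
      ⟨fun e => hI3 e (Finset.mem_univ _), fun e => hI4 e (Finset.mem_univ _), hI7, ?_⟩, ?_⟩
    · rw [hf.arr 8 (by decide)]; exact h8
    · refine ⟨htm, hhm, fun e u hu => ?_, fun e w hw => ?_, fun v => ?_, fun v => ?_, fun v hv => ?_,
        fun v hv => ?_, hex⟩
      · change (if u ∈ T then n + 1 else 1) ≤ (if tl e ∈ T then n + 1 else 1) + 1
        rcases (hprop e (Finset.mem_univ _)).1 with h | h
        · rw [if_pos h]; split_ifs <;> omega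
        · rw [if_neg (Finset.disjoint_left.1 h hu)]; omega
      · change (if hd e ∈ T then n + 1 else 1) ≤ (if w ∈ T then n + 1 else 1) + 1
        rcases (hprop e (Finset.mem_univ _)).2 with h | h
        · rw [if_neg h]; omega
        · rw [if_pos (h hw)]; split_ifs <;> omega
      · change 1 ≤ if v ∈ T then n + 1 else 1
        split_ifs <;> omega
      · change (if v ∈ T then n + 1 else 1) ≤ n + 1
        split_ifs <;> omega
      · change (if v ∈ T then n + 1 else 1) = n + 1
        rw [if_pos hv]
      · change (if v ∈ T then n + 1 else 1) = 1
        rw [if_neg (Finset.disjoint_left.1 hST hv)]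

/-- Compute the source minimal minimum `(S, T)`-terminal cut, where the arrays `9` and `10` hold
`S` and `T`. -/
def minCut : Prog :=
  block [.copy 15 1, .succ 15, initVertices, initEdges, .const 9 1, .while (.eq 9 4) wave, close]

/-- The labels sum to at most `n (n + 1)` and every wave but the last increases the sum, so at most
`n (n + 1) + 1` waves occur. Then no vertex is active, and the closure of `S` is the cut. -/
theorem wp_minCut (hne : ∀ e, (G.edge e).Nonempty) (hG : G.InMemory s) (hST : Disjoint S T)
    (hS : IsIndicator (s.arr 9) S) (hT : IsIndicator (s.arr 10) T) :
    wp minCut s fun t s' => t ≤ 1000 * (n + 1) ^ 4 * (G.size + 1) ∧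
      ∃ A, IsIndicator (s'.arr 6) A ∧ G.IsSourceMinimalMinCut S T A := by
  refine wp_seq (wp_copy (wp_seq (wp_succ (wp_seq ?_))))
  set s0 := ((s.setReg 15 _).setReg 15 _) with hs0
  have hG0 : G.InMemory s0 := by
    repeat' first | exact hG | apply InMemory.setReg | norm_num
  refine (wp_initVertices (S := S) (T := T) hG0 hS hT (by simp [hs0, hG.regN])).mono ?_
  rintro t1 s1 hf1 ⟨ht1, h6, h7, h8⟩
  have hG1 := hG0.frame hf1 (by decide)
  refine wp_seq ((wp_initEdges (S := S) (T := T) hne hG1 hST (by rw [hf1.arr 10 (by decide)]; exact hT)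
    h7 h8).mono ?_)
  rintro t2 s2 hf2 ⟨ht2, h5, σ, hσ, hI⟩
  have hG2 := hG1.frame hf2 (by decide)
  have hS2 : IsIndicator (s2.arr 9) S := by
    rw [hf2.arr 9 (by decide), hf1.arr 9 (by decide)]; exact hS
  have h6' : IsIndicator (s2.arr 6) S := by rw [hf2.arr 6 (by decide)]; exact h6
  refine wp_seq (wp_const (wp_seq ?_))
  refine (wp_while (T := n * (58 * G.size + n * 13 + 10) + 6) (j₀ := n * (n + 1) + 1)
    (fun j s' => ∃ σ : Preflow n m, σ.InMemory s' ∧ σ.Inv G S T ∧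
      ((s'.reg 9 = 0 ∧ ∀ v ∉ S, σ.lab v ≤ n → σ.exc v = 0) ∨
        (s'.reg 9 = 1 ∧ n * (n + 1) + 1 ≤ j + ∑ v, σ.lab v))) ?_ ?_).mono ?_
  · exact ⟨σ, hσ.congr rfl rfl rfl rfl, hI, .inr ⟨by simp, by omega⟩⟩
  · rintro j s3 hf3 ⟨σ3, hσ3, hI3, hor⟩ hb
    have hG3 := (hG2.setReg (x := 9) (v := 1) (by norm_num)).frame hf3 (by decide)
    have hb : s3.reg 9 = 1 := by simpa [Test.Holds, hG3.one] using hb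
    have hj : n * (n + 1) + 1 ≤ j + ∑ v, σ3.lab v := by
      rcases hor with h | h
      · omega
      · exact h.2
    have hle : ∑ v, σ3.lab v ≤ n * (n + 1) := by
      have := Finset.sum_le_sum fun v (_ : v ∈ Finset.univ) => hI3.lab_le v
      simpa using this
    obtain ⟨j, rfl⟩ : ∃ j', j = j' + 1 := ⟨j - 1, by omega⟩
    refine ⟨j, rfl, (wp_wave hne hG3 hσ3 hI3 ?_).mono ?_⟩
    · rw [hf3.arr 9 (by decide)]; exact hS2
    · rintro t4 s4 - ⟨ht4, σ4, hσ4, hI4, hor4⟩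
      refine ⟨ht4, σ4, hσ4, hI4, ?_⟩
      rcases hor4 with h | h
      · exact .inl h
      · exact .inr ⟨h.1, by omega⟩
  · rintro t3 s3 hf3 ⟨ht3, ⟨j, -, σ3, hσ3, hI3, hor⟩, hb⟩
    have hG3 := (hG2.setReg (x := 9) (v := 1) (by norm_num)).frame hf3 (by decide)
    have hact : ∀ v ∉ S, σ3.lab v ≤ n → σ3.exc v = 0 := by
      rcases hor with h | h
      · exact h.2
      · exact absurd (by simpa [Test.Holds, hG3.one] using h.1) hb
    refine (wp_close hne hG3 (S := S) ?_ hσ3.tail hσ3.head (en := fun _ => True) ?_).mono ?_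
    · rw [hf3.arr 6 (by decide)]; exact h6'
    · intro e
      rw [hf3.arr 5 (by decide)]
      simpa using h5 e
    · rintro t4 s4 - ⟨ht4, A, hA, hcl⟩
      refine ⟨?_, A, hA, hI3.isSourceMinimalMinCut hact hcl⟩
      set p := G.size
      have e1 : (n * (n + 1) + 1) * (n * (58 * p + n * 13 + 10) + 6 + 1) ≤
          (n + 1) ^ 2 * ((n + 1) * (58 * ((n + 1) * (p + 1)) + 13 * ((n + 1) * (p + 1))
            + 10 * ((n + 1) * (p + 1))) + 7 * ((n + 1) ^ 2 * (p + 1))) := by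
        refine Nat.mul_le_mul (by nlinarith) ?_
        have a1 : n * (58 * p + n * 13 + 10) ≤ (n + 1) * (58 * ((n + 1) * (p + 1)) +
          13 * ((n + 1) * (p + 1)) + 10 * ((n + 1) * (p + 1))) := by
          refine Nat.mul_le_mul (by omega) ?_
          nlinarith
        have a2 : 1 ≤ (n + 1) ^ 2 * (p + 1) := Nat.mul_pos (by positivity) (by omega)
        omega
      have e2 : (n + 1) ^ 2 * ((n + 1) * (58 * ((n + 1) * (p + 1)) + 13 * ((n + 1) * (p + 1))
            + 10 * ((n + 1) * (p + 1))) + 7 * ((n + 1) ^ 2 * (p + 1))) =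
            88 * ((n + 1) ^ 4 * (p + 1)) := by ring
      have b1 : (n + 1) * (p + 1) ≤ (n + 1) ^ 4 * (p + 1) :=
        Nat.mul_le_mul_right _ (Nat.le_self_pow (by norm_num) _)
      have b2 : n + 1 ≤ (n + 1) * (p + 1) := Nat.le_mul_of_pos_right _ (by omega)
      have b3 : p + 1 ≤ (n + 1) * (p + 1) := Nat.le_mul_of_pos_left _ (by omega)
      have b4 : 50 * (n + 1) * (p + 1) = 50 * ((n + 1) * (p + 1)) := by ring
      have b5 : 1000 * (n + 1) ^ 4 * (p + 1) = 1000 * ((n + 1) ^ 4 * (p + 1)) := by ring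
      omega

end MultiHypergraph

/-! ### Running through all words of a given length -/

namespace Ram

/-- Increase the number whose digits (to the base in register `25`, least digit first) are the
first cells of array `11`, as many as register `24` says; register `21` becomes the carry. -/
def increment : Prog :=
  block [.const 21 1, forBelow 22 24 (.ite (.eq 21 4) (block [.load 23 11 22, .succ 23,
    .ite (.eq 23 25) (.store 11 22 3) (block [.store 11 22 23, .const 21 0])]) .skip)]

/-- Run `P` for all words of the length in register `24` over the alphabet `0, …, b - 1`, where
`b` is in register `25`; array `11` holds the word. -/
def forWords (P : Prog) : Prog :=
  block [forBelow 22 24 (.store 11 22 3), .const 21 0, .while (.eq 21 3) (.seq P increment)]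

variable {P : Prog} {s : Store} {L B : ℕ}

/-- While the carry is set it is worth `B ^ D.card`, the weight of the next digit; with it the
digits written so far amount to the old ones plus one. A carry left at the end means that `f` was
the last word. -/
theorem wp_increment (h3 : s.reg 3 = 0) (h4 : s.reg 4 = 1) (h24 : s.reg 24 = L) (h25 : s.reg 25 = B)
    (f : Fin L → Fin B) (hf : ∀ i : Fin L, s.arr 11 i = f i) :
    wp increment s fun t s' => t ≤ L * 9 + 3 ∧
      ((s'.reg 21 = 1 ∧ (finFunctionFinEquiv f : ℕ) + 1 = B ^ L) ∨
        (s'.reg 21 = 0 ∧ ∃ g : Fin L → Fin B, (∀ i : Fin L, s'.arr 11 i = g i) ∧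
          (finFunctionFinEquiv g : ℕ) = finFunctionFinEquiv f + 1)) := by
  classical
  refine wp_seq (wp_const ?_)
  refine (wp_forBelow_const (N := L) 7 (fun D s' => ∃ g : Fin L → Fin B,
    (∀ i : Fin L, s'.arr 11 i = g i) ∧ (∀ i ∉ D, g i = f i) ∧
      ((s'.reg 21 = 1 ∧ ∑ i ∈ D, (g i : ℕ) * B ^ (i : ℕ) + B ^ D.card =
          ∑ i ∈ D, (f i : ℕ) * B ^ (i : ℕ) + 1) ∨
        (s'.reg 21 = 0 ∧ ∑ i ∈ D, (g i : ℕ) * B ^ (i : ℕ) =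
          ∑ i ∈ D, (f i : ℕ) * B ^ (i : ℕ) + 1))) (by decide) (by decide) (by decide)
    (by simpa using h24) ?_ ?_).mono ?_
  · refine ⟨f, hf, fun _ _ => rfl, .inl ⟨?_, ?_⟩⟩ <;> simp
  · rintro D x s1 hD hfr h22 ⟨g, hg, hgf, hor⟩
    have h3' : s1.reg 3 = 0 := (hfr.reg 3 (by decide)).trans (by simpa using h3)
    have h4' : s1.reg 4 = 1 := (hfr.reg 4 (by decide)).trans (by simpa using h4)
    have h25' : s1.reg 25 = B := (hfr.reg 25 (by decide)).trans (by simpa using h25)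
    have hxD : x ∉ D := fun h => by simpa using (hD x).1 h
    have hcard : D.card = x := by
      have : D = Finset.Iio x := by ext y; simp [hD]
      rw [this, Fin.card_Iio]
    have hsum : ∀ y : Fin B, ∑ i ∈ D, ((Function.update g x y i : Fin B) : ℕ) * B ^ (i : ℕ) =
        ∑ i ∈ D, (g i : ℕ) * B ^ (i : ℕ) := fun y => Finset.sum_congr rfl fun i hi => by
      rw [Function.update_of_ne]; rintro rfl; exact hxD hi
    refine wp_ite (fun hb => wp_seq (wp_load (wp_seq (wp_succ (wp_ite
      (fun hc => wp_store ⟨by norm_num, ?_⟩)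
      (fun hc => wp_seq (wp_store (wp_const ⟨by norm_num, ?_⟩)))))))
      ) (fun hb => wp_skip ⟨by norm_num, ?_⟩)
    all_goals simp [Test.Holds, h4'] at hb
    · simp [Test.Holds, h22, hg, h25'] at hc
      have hB : 0 < B := by omega
      refine ⟨Function.update g x ⟨0, hB⟩, fun i => ?_, fun i hi => ?_, .inl ⟨by simpa using hb, ?_⟩⟩
      · simpa [h22, h3'] using MultiHypergraph.update_coe_fin hg x ⟨0, hB⟩ i
      · rw [Finset.mem_insert, not_or] at hi
        rw [Function.update_of_ne hi.1, hgf i hi.2]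
      · rw [Finset.sum_insert hxD, Finset.sum_insert hxD, Finset.card_insert_of_notMem hxD, hsum,
          Function.update_self, hcard, ← hgf x hxD]
        rcases hor with ⟨-, h⟩ | ⟨h, -⟩
        · rw [hcard] at h
          have : B ^ ((x : ℕ) + 1) = (g x : ℕ) * B ^ (x : ℕ) + B ^ (x : ℕ) := by
            calc B ^ ((x : ℕ) + 1) = B ^ (x : ℕ) * ((g x : ℕ) + 1) := by rw [hc, pow_succ]
              _ = _ := by ring
          simp only [zero_mul]
          omega
        · omega
    · simp [Test.Holds, h22, hg, h25'] at hc
      have hlt : (g x : ℕ) + 1 < B := by have := (g x).2; omega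
      refine ⟨Function.update g x ⟨g x + 1, hlt⟩, fun i => ?_, fun i hi => ?_, .inr ⟨by simp, ?_⟩⟩
      · simpa [h22, hg] using MultiHypergraph.update_coe_fin hg x ⟨g x + 1, hlt⟩ i
      · rw [Finset.mem_insert, not_or] at hi
        rw [Function.update_of_ne hi.1, hgf i hi.2]
      · rw [Finset.sum_insert hxD, Finset.sum_insert hxD, hsum, Function.update_self, ← hgf x hxD]
        rcases hor with ⟨-, h⟩ | ⟨h, -⟩
        · rw [hcard] at h
          rw [add_mul]
          omega
        · omega
    · refine ⟨g, by simpa using hg, fun i hi => hgf i fun h => hi (Finset.mem_insert_of_mem h), ?_⟩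
      rcases hor with ⟨h, -⟩ | ⟨h, h'⟩
      · exact absurd h hb
      · refine .inr ⟨by simpa using h, ?_⟩
        rw [Finset.sum_insert hxD, Finset.sum_insert hxD, ← hgf x hxD]
        omega
  · rintro t s1 - ⟨ht, g, hg, -, hor⟩
    refine ⟨by omega, ?_⟩
    rw [finFunctionFinEquiv_apply]
    rcases hor with ⟨h, h'⟩ | ⟨h, h'⟩
    · refine .inl ⟨h, ?_⟩
      have := (finFunctionFinEquiv f).2
      rw [finFunctionFinEquiv_apply] at this
      simp only [Finset.card_univ, Fintype.card_fin] at h'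
      omega
    · exact .inr ⟨h, g, hg, by rw [finFunctionFinEquiv_apply]; exact h'⟩

/-- Words come in the order of the numbers they encode, so the finished ones are those with smaller
number. `hI` asks that the invariant ignores the memory of the counter, which changes between two
runs of `P`. -/
theorem wp_forWords {T : ℕ} (h3 : s.reg 3 = 0) (h4 : s.reg 4 = 1) (h24 : s.reg 24 = L)
    (h25 : s.reg 25 = B) (hB : 0 < B)
    (hP : (P.writesReg 3 || P.writesReg 4 || P.writesReg 21 || P.writesReg 24 || P.writesReg 25 ||
      P.writesArr 11) = false)
    (I : Finset (Fin L → Fin B) → Store → Prop)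
    (hI : ∀ D s s', (∀ r, r ≠ 21 → r ≠ 22 → r ≠ 23 → s'.reg r = s.reg r) →
      (∀ a, a ≠ 11 → s'.arr a = s.arr a) → s'.out = s.out → I D s → I D s')
    (h0 : I ∅ s)
    (step : ∀ D (f : Fin L → Fin B) s', f ∉ D → Frame (forWords P) s s' →
      (∀ i : Fin L, s'.arr 11 i = f i) → I D s' →
      wp P s' fun t s'' => t ≤ T ∧ I (insert f D) s'') :
    wp (forWords P) s fun t s' => t ≤ B ^ L * (T + L * 9 + 4) + L * 3 + 4 ∧ I Finset.univ s' := by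
  classical
  simp only [Bool.or_eq_false_iff] at hP
  obtain ⟨⟨⟨⟨⟨hP3, hP4⟩, hP21⟩, hP24⟩, hP25⟩, hP11⟩ := hP
  have hsub : ∀ (Q : Prog) (s s' : Store), Frame Q s s' →
      (∀ x, (forWords P).writesReg x = false → Q.writesReg x = false) →
      (∀ x, (forWords P).writesArr x = false → Q.writesArr x = false) →
      ((forWords P).writesOut = false → Q.writesOut = false) → Frame (forWords P) s s' :=
    fun Q s s' h => h.mono
  refine wp_seq ?_
  refine (wp_forBelow_const (N := L) 1 (fun D s' => ∀ i ∈ D, s'.arr 11 i = 0) (by decide)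
    (by decide) (by decide) h24 (by simp) ?_).mono ?_
  · rintro D x s1 hD hf h22 hD0
    refine wp_store ⟨le_rfl, fun i hi => ?_⟩
    have h3' : s1.reg 3 = 0 := (hf.reg 3 (by decide)).trans h3
    simp [h22, h3', Function.update_apply]
    intro hne
    refine hD0 i ((Finset.mem_insert.1 hi).resolve_left fun h => hne (congrArg _ h))
  rintro t1 s1 hf1 ⟨ht1, hz⟩
  refine wp_seq (wp_const ?_)
  have hfr0 : Frame (forWords P) s (s1.setReg 21 0) := by
    refine (hsub _ _ _ hf1 ?_ ?_ ?_).trans (hsub _ _ _ (Exec.const s1 21 0).frame ?_ ?_ ?_) <;>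
      simp +contextual [forWords, block, Prog.writesReg, Prog.writesArr, Prog.writesOut]
  let f0 : Fin L → Fin B := fun _ => ⟨0, hB⟩
  have hval0 : (finFunctionFinEquiv f0 : ℕ) = 0 := by
    rw [finFunctionFinEquiv_apply]; simp [f0]
  refine (wp_while (T := T + (L * 9 + 3)) (j₀ := B ^ L) (fun j s' =>
    (s'.reg 21 = 0 ∧ ∃ f : Fin L → Fin B, (∀ i : Fin L, s'.arr 11 i = f i) ∧
      j + finFunctionFinEquiv f = B ^ L ∧
        I (Finset.univ.filter fun g => finFunctionFinEquiv g < finFunctionFinEquiv f) s') ∨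
      (s'.reg 21 = 1 ∧ I Finset.univ s')) ?_ ?_).mono ?_
  · refine .inl ⟨by simp, f0, fun i => by simpa [f0] using hz i (Finset.mem_univ _), by omega, ?_⟩
    have : (Finset.univ.filter fun g : Fin L → Fin B =>
        finFunctionFinEquiv g < finFunctionFinEquiv f0) = ∅ := by
      rw [Finset.filter_eq_empty_iff]
      intro g _
      rw [Fin.lt_def, hval0]
      omega
    rw [this]
    refine hI ∅ s _ (fun r h1 h2 _ => ?_) (fun a ha => ?_) ?_ h0
    · rw [reg_setReg, if_neg h1]
      exact hf1.reg r (by simp [forBelow, forUp, Prog.writesReg, h2.symm])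
    · exact hf1.arr a (by simp [forBelow, forUp, Prog.writesArr, ha.symm])
    · exact hf1.out (by decide)
  · rintro j s2 hf2 hor hb
    have hfr2 : Frame (forWords P) s s2 := hfr0.trans (hsub _ _ _ hf2
      (by simp +contextual [forWords, block, Prog.writesReg])
      (by simp +contextual [forWords, block, Prog.writesArr])
      (by simp +contextual [forWords, block, Prog.writesOut]))
    have h3' : s2.reg 3 = 0 := (hfr2.reg 3 (by
      simp [forWords, block, forBelow, forUp, Prog.writesReg, increment, hP3])).trans h3
    have h4' : s2.reg 4 = 1 := (hfr2.reg 4 (by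
      simp [forWords, block, forBelow, forUp, Prog.writesReg, increment, hP4])).trans h4
    have h24' : s2.reg 24 = L := (hfr2.reg 24 (by
      simp [forWords, block, forBelow, forUp, Prog.writesReg, increment, hP24])).trans h24
    have h25' : s2.reg 25 = B := (hfr2.reg 25 (by
      simp [forWords, block, forBelow, forUp, Prog.writesReg, increment, hP25])).trans h25
    have hb : s2.reg 21 = 0 := by simpa [Test.Holds, h3'] using hb
    rcases hor with ⟨-, f, hf, hj, hIf⟩ | ⟨h, -⟩
    swap
    · omega
    have hfl := (finFunctionFinEquiv f).2
    obtain ⟨j, rfl⟩ : ∃ j', j = j' + 1 := ⟨j - 1, by omega⟩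
    refine ⟨j, rfl, wp_seq ((step _ f s2 (by simp) hfr2 hf hIf).mono ?_)⟩
    rintro t3 s3 hf3 ⟨ht3, hI3⟩
    have hins : ∀ g : Fin L → Fin B, g ∈ insert f (Finset.univ.filter fun g =>
        finFunctionFinEquiv g < finFunctionFinEquiv f) ↔
          (finFunctionFinEquiv g : ℕ) < finFunctionFinEquiv f + 1 := by
      intro g
      simp only [Finset.mem_insert, Finset.mem_filter, Finset.mem_univ, true_and, Fin.lt_def,
        Nat.lt_succ_iff_lt_or_eq]
      constructor
      · rintro (rfl | h)
        · exact .inr rfl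
        · exact .inl h
      · rintro (h | h)
        · exact .inr h
        · exact .inl (finFunctionFinEquiv.injective (Fin.ext h))
    refine (wp_increment ((hf3.reg 3 hP3).trans h3') ((hf3.reg 4 hP4).trans h4')
      ((hf3.reg 24 hP24).trans h24') ((hf3.reg 25 hP25).trans h25') f
      (by rw [hf3.arr 11 hP11]; exact hf)).mono ?_
    rintro t4 s4 hf4 ⟨ht4, hor⟩
    have hI4 := hI _ s3 s4 (fun r h1 h2 h3 => hf4.reg r (by
      simp [increment, block, forBelow, forUp, Prog.writesReg, h1.symm, h2.symm, h3.symm]))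
      (fun a ha => hf4.arr a (by
        simp [increment, block, forBelow, forUp, Prog.writesArr, ha.symm])) (hf4.out (by decide)) hI3
    refine ⟨by omega, ?_⟩
    rcases hor with ⟨h21, hv⟩ | ⟨h21, g, hg, hv⟩
    · refine .inr ⟨h21, ?_⟩
      convert hI4
      ext g
      rw [hins, hv]
      simpa using (finFunctionFinEquiv g).2
    · refine .inl ⟨h21, g, hg, by omega, ?_⟩
      convert hI4 using 1
      ext g'
      rw [hins]
      simp only [Finset.mem_filter, Finset.mem_univ, true_and, Fin.lt_def, hv]
  · rintro t2 s2 hf2 ⟨ht2, ⟨j, hj, hor⟩, hb⟩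
    have h3' : s2.reg 3 = 0 := by
      have e : s1.reg 3 = 0 := (hf1.reg 3 (by decide)).trans h3
      rw [hf2.reg 3 (by
        simp [block, forBelow, forUp, Prog.writesReg, increment, hP3])]
      simpa using e
    rcases hor with ⟨h, -⟩ | ⟨-, h⟩
    · exact absurd (by simpa [Test.Holds, h3'] using h) hb
    · refine ⟨?_, h⟩
      have e1 : B ^ L * (T + (L * 9 + 3) + 1) = B ^ L * (T + L * 9 + 4) := by ring
      omega

end Ram

/-! ### Reading the input -/

namespace MultiHypergraph

open Ram

variable {n m k : ℕ} {G : MultiHypergraph n m} {s s' : Store}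

theorem card_of_mem_iff_lt {N : ℕ} {D : Finset (Fin N)} {x : Fin N} (h : ∀ y, y ∈ D ↔ y < x) :
    D.card = x := by
  have : D = Finset.Iio x := by ext y; simp [h]
  rw [this, Fin.card_Iio]

theorem not_mem_of_mem_iff_lt {N : ℕ} {D : Finset (Fin N)} {x : Fin N} (h : ∀ y, y ∈ D ↔ y < x) :
    x ∉ D := by simp [h]

theorem getElem?_flatMap_finRange {α : Type*} {N : ℕ} (f : Fin N → List α) (x : Fin N) {j : ℕ}
    (hj : j < (f x).length) :
    ((List.finRange N).flatMap f)[(((List.finRange N).take x).flatMap f).length + j]? =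
      some (f x)[j] := by
  have hx : (x : ℕ) < (List.finRange N).length := by simp
  have e : (List.finRange N) =
      (List.finRange N).take x ++ x :: (List.finRange N).drop (x + 1) := by
    conv_lhs => rw [← List.take_append_drop x (List.finRange N)]
    rw [List.drop_eq_getElem_cons hx]
    simp
  conv_lhs => rw [e]
  rw [List.flatMap_append, List.flatMap_cons, List.getElem?_append_right (by simp)]
  conv_lhs => rw [← e]
  rw [Nat.add_sub_cancel_left, List.getElem?_append_left hj, List.getElem?_eq_getElem hj]

theorem length_flatMap_take_succ {α : Type*} {N : ℕ} (f : Fin N → List α) (x : Fin N) :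
    (((List.finRange N).take (x + 1)).flatMap f).length =
      (((List.finRange N).take x).flatMap f).length + (f x).length := by
  rw [List.take_succ_eq_append_getElem (by simp), List.flatMap_append]
  simp

/-- The part of the input word that describes the hyperedge `e`. -/
def edgeWord (G : MultiHypergraph n m) (e : Fin m) : List ℕ :=
  (G.edge e).card :: ((G.edge e).sort (· ≤ ·)).map Fin.val

/-- Read `k`, `n` and `m` into the registers `0` to `2` and locate the hyperedges. -/
def readInput : Prog :=
  block [.load 0 0 3, .const 4 2, .load 2 0 4, .const 4 1, .load 1 0 4, .const 5 3,
    forBelow 8 2 (block [.load 6 0 5, .succ 5, .store 1 8 5, forBelow 7 6 (.succ 5),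
      .store 2 8 5])]

theorem wp_readInput (hne : ∀ e, (G.edge e).Nonempty) :
    wp readInput (initial (G.inputWord k)) fun t s => t ≤ 20 * (G.size + 1) ∧ G.InMemory s ∧
      s.reg 0 = k ∧ s.out = [] := by
  classical
  set w := G.inputWord k with hw
  have hw0 : ∀ i, (initial w).arr 0 i = w.getD i 0 := fun i => rfl
  have hoff : ∀ i, w.getD (3 + i) 0 = ((List.finRange m).flatMap G.edgeWord).getD i 0 := by
    intro i
    rw [add_comm]
    rfl
  -- The offset at which the description of a hyperedge begins, not counting the three cells for
  -- `k`, `n` and `m`. Its vertices start one cell later, after the cardinality.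
  let off : ℕ → ℕ := fun j => (((List.finRange m).take j).flatMap G.edgeWord).length
  have hlen : ∀ e, (G.edgeWord e).length = (G.edge e).card + 1 := by
    intro e; simp [edgeWord]
  have hcell : ∀ (e : Fin m) j (hj : j < (G.edgeWord e).length),
      w.getD (3 + (off e + j)) 0 = (G.edgeWord e)[j] := by
    intro e j hj
    rw [hoff, List.getD_eq_getElem?_getD, getElem?_flatMap_finRange _ _ hj]
    rfl
  have hk : w.getD 0 0 = k ∧ w.getD 1 0 = n ∧ w.getD 2 0 = m := ⟨rfl, rfl, rfl⟩
  obtain ⟨k0, k1, k2⟩ := hk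
  clear_value w
  have h1 : ∀ i, (initial w).reg i = 0 := fun _ => rfl
  have ho : (initial w).out = [] := rfl
  clear hw
  generalize initial w = s at hw0 h1 ho ⊢
  refine wp_seq (wp_load (wp_seq (wp_const (wp_seq (wp_load (wp_seq (wp_const (wp_seq (wp_load
    (wp_seq (wp_const ?_)))))))))))
  set s0 := ((((((s.setReg 0 _).setReg 4 2).setReg 2 _).setReg 4 1).setReg 1 _).setReg 5 3)
    with hs0
  have r0 : s0.reg 0 = k := by simp only [hs0, reg_setReg, arr_setReg, h1, hw0]; norm_num [h1, hw0, -List.getD_eq_getElem?_getD, k0]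
  have r1 : s0.reg 1 = n := by simp only [hs0, reg_setReg, arr_setReg, h1, hw0]; norm_num [h1, hw0, -List.getD_eq_getElem?_getD, k1]
  have r2 : s0.reg 2 = m := by simp only [hs0, reg_setReg, arr_setReg, h1, hw0]; norm_num [h1, hw0, -List.getD_eq_getElem?_getD, k2]
  have r3 : s0.reg 3 = 0 := by simp [hs0, h1]
  have r4 : s0.reg 4 = 1 := by simp [hs0]
  have a0 : s0.arr 0 = fun i => w.getD i 0 := by
    funext i; simp only [hs0, arr_setReg, hw0]
  have ho : s0.out = [] := ho
  refine (wp_forBelow (N := m) (fun e => (G.edge e).card * 3 + 8) (fun D s' =>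
    s'.reg 5 = 3 + off D.card ∧ ∀ e ∈ D, s'.arr 1 e = 3 + (off e + 1) ∧
      s'.arr 2 e = s'.arr 1 e + (G.edge e).card) (by decide) (by decide) (by decide) r2 ?_ ?_).mono ?_
  · simp [hs0, off]
  · rintro D e s1 hD hf h8 ⟨hI1, hI2⟩
    have hc := card_of_mem_iff_lt hD
    have a0' : s1.arr 0 = fun i => w.getD i 0 := (hf.arr 0 (by decide)).trans a0
    have hcard : s1.arr 0 (3 + off e) = (G.edge e).card := by
      have := hcell e 0 (by rw [hlen]; omega)
      rw [a0']
      simpa [edgeWord] using this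
    refine wp_seq (wp_load (wp_seq (wp_succ (wp_seq (wp_store (wp_seq ?_))))))
    set s2 := (((s1.setReg 6 _).setReg 5 _).setArr 1 _ _) with hs2
    refine (wp_forBelow_const (N := (G.edge e).card) 1 (fun D' s' =>
      s'.reg 5 = 3 + (off e + 1) + D'.card) (by decide) (by decide) (by decide) ?_ ?_ ?_).mono ?_
    · simp [hs2, hI1, hc, hcard]
    · simp [hs2, hI1, hc]; omega
    · intro D' x s3 hD' hf' h7 hI
      refine wp_succ ⟨le_rfl, ?_⟩
      rw [Finset.card_insert_of_notMem (not_mem_of_mem_iff_lt hD')]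
      simp [hI]; omega
    · rintro t s3 hf3 ⟨ht, hI⟩
      have h8' : s3.reg 8 = e := (hf3.reg 8 (by decide)).trans (by simp [hs2, h8])
      have g1 : s3.arr 1 = Function.update (s1.arr 1) e (3 + (off e + 1)) :=
        (hf3.arr 1 (by decide)).trans (by simp [hs2, h8, hI1, hc]; rfl)
      have g2 : s3.arr 2 = s1.arr 2 := (hf3.arr 2 (by decide)).trans (by simp [hs2])
      refine wp_store ⟨by omega, ?_, ?_⟩
      · rw [Finset.card_insert_of_notMem (not_mem_of_mem_iff_lt hD), hc]
        have : off (e + 1) = off e + (G.edgeWord e).length := length_flatMap_take_succ _ _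
        simp [hI, this, hlen]
        omega
      · intro e' he'
        by_cases hee : e' = e
        · subst hee
          simp [g1, h8', hI]
        · have hee' : (e' : ℕ) ≠ e := fun h => hee (Fin.ext h)
          have := hI2 e' ((Finset.mem_insert.1 he').resolve_left hee)
          simp [g1, g2, h8', Function.update_of_ne hee', this]
  · rintro t s1 hf ⟨ht, hI1, hI2⟩
    have hm := G.card_le_size hne
    refine ⟨?_, ⟨?_, ?_, ?_, ?_, fun e => ⟨(G.edge e).sort (· ≤ ·), ?_, ?_, ?_, ?_⟩⟩, ?_, ?_⟩
    · have : ∑ e, ((G.edge e).card * 3 + 8 + 2) = G.size * 3 + m * 10 := by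
        simp only [add_assoc, Finset.sum_add_distrib, ← Finset.sum_mul, size]
        simp; omega
      omega
    · exact (hf.reg 1 (by decide)).trans r1
    · exact (hf.reg 2 (by decide)).trans r2
    · exact (hf.reg 3 (by decide)).trans r3
    · exact (hf.reg 4 (by decide)).trans r4
    · exact Finset.sort_nodup _ _
    · exact Finset.sort_toFinset _ _
    · simpa using (hI2 e (Finset.mem_univ _)).2
    · intro j hj
      rw [(hI2 e (Finset.mem_univ _)).1, hf.arr 0 (by decide), a0]
      have := hcell e (j + 1) (by rw [hlen]; simpa using hj)
      rw [show 3 + (off e + 1) + j = 3 + (off e + (j + 1)) by omega]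
      simpa [edgeWord] using this
    · exact (hf.reg 0 (by decide)).trans r0
    · exact (hf.out (by decide)).trans ho

/-! ### The list of the candidates -/

/-- The candidates found so far: register `27` holds their number, array `13` the positions of
their characteristic vectors in array `12`, register `28` the first free cell there. -/
structure Stored (L : List (Finset (Fin n))) (s : Store) : Prop where
  count : s.reg 27 = L.length
  fits : ∀ i < L.length, s.arr 13 i + n ≤ s.reg 28
  cells : ∀ i (h : i < L.length), ∀ v : Fin n, s.arr 12 (s.arr 13 i + v) = if v ∈ L[i] then 1 else 0

theorem Stored.congr {L : List (Finset (Fin n))} (h : Stored L s) (h1 : s'.reg 27 = s.reg 27)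
    (h2 : s'.reg 28 = s.reg 28) (h3 : s'.arr 12 = s.arr 12) (h4 : s'.arr 13 = s.arr 13) :
    Stored L s' :=
  ⟨h1.trans h.count, by rw [h2, h4]; exact h.fits, by rw [h3, h4]; exact h.cells⟩

/-- Find out whether the set in array `6` has been stored (register `29`). -/
def findCandidate : Prog :=
  block [.const 29 0, forBelow 30 27 (block [.load 31 13 30, .const 32 1,
    forBelow 7 1 (block [.load 10 12 31, .load 11 6 7, .ite (.eq 10 11) .skip (.const 32 0),
      .succ 31]),
    .ite (.eq 32 4) (.const 29 1) .skip])]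

/-- Store the set in array `6` unless it has been stored before. -/
def addCandidate : Prog :=
  block [findCandidate, .ite (.eq 29 3) (block [.store 13 27 28, .succ 27,
    forBelow 7 1 (block [.load 10 6 7, .store 12 28 10, .succ 28])]) .skip]

open scoped Classical in
theorem wp_findCandidate (hG : G.InMemory s) {L : List (Finset (Fin n))} (hL : Stored L s)
    {A : Finset (Fin n)} (hA : IsIndicator (s.arr 6) A) :
    wp findCandidate s fun t s' => t ≤ L.length * (n * 7 + 9) + 3 ∧
      s'.reg 29 = if A ∈ L then 1 else 0 := by
  refine wp_seq (wp_const ?_)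
  refine (wp_forBelow_const (N := L.length) (n * 7 + 7) (fun D s' =>
    s'.reg 29 = if ∃ i ∈ D, L.get i = A then 1 else 0) (by decide) (by decide) (by decide)
    ?_ ?_ ?_).mono ?_
  · simpa using hL.count
  · simp
  · intro D x s1 hD hf h30 hI
    have h4 : s1.reg 4 = 1 := (hf.reg 4 (by decide)).trans (by simpa using hG.one)
    have h1 : s1.reg 1 = n := (hf.reg 1 (by decide)).trans (by simpa using hG.regN)
    have a6 : s1.arr 6 = s.arr 6 := hf.arr 6 (by decide)
    have a12 : s1.arr 12 = s.arr 12 := hf.arr 12 (by decide)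
    have a13 : s1.arr 13 = s.arr 13 := hf.arr 13 (by decide)
    refine wp_seq (wp_load (wp_seq (wp_const (wp_seq ?_))))
    set s2 := ((s1.setReg 31 _).setReg 32 1) with hs2
    refine (wp_forBelow_const (N := n) 5 (fun D' s' => s'.reg 31 = s.arr 13 x + D'.card ∧
      s'.reg 32 = if ∀ v ∈ D', v ∈ L.get x ↔ v ∈ A then 1 else 0) (by decide) (by decide) (by decide)
      ?_ ?_ ?_).mono ?_
    · simpa [hs2] using h1
    · simp [hs2, h30, a13]
    · rintro D' v s3 hD' hf3 h7 ⟨hI1, hI2⟩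
      have b12 : s3.arr 12 = s.arr 12 := (hf3.arr 12 (by decide)).trans a12
      have b6 : s3.arr 6 = s.arr 6 := (hf3.arr 6 (by decide)).trans a6
      rw [card_of_mem_iff_lt hD'] at hI1
      have e1 : s3.arr 12 (s3.reg 31) = if v ∈ L.get x then 1 else 0 := by
        rw [b12, hI1]; exact hL.cells x x.2 v
      have e2 : s3.arr 6 v = if v ∈ A then 1 else 0 := by rw [b6]; exact hA v
      have hvD := not_mem_of_mem_iff_lt hD'
      refine wp_seq (wp_load (wp_seq (wp_load (wp_seq (wp_ite (fun hb => wp_skip (wp_succ ?_))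
        (fun hb => wp_const (wp_succ ?_)))))))
      all_goals
        refine ⟨by omega, ?_, ?_⟩
        · rw [Finset.card_insert_of_notMem hvD, card_of_mem_iff_lt hD']
          simp [hI1]; omega
        simp only [Test.Holds, reg_setReg, arr_setReg, h7, if_pos] at hb
        norm_num [e1, e2, h7] at hb
      · have hiff : v ∈ L.get x ↔ v ∈ A := by
          by_cases c1 : v ∈ L.get x <;> by_cases c2 : v ∈ A <;> simp_all
        simp only [Finset.forall_mem_insert, hiff, true_and]
        simpa using hI2
      · have hiff : ¬ (v ∈ L.get x ↔ v ∈ A) := by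
          by_cases c1 : v ∈ L.get x <;> by_cases c2 : v ∈ A <;> simp_all
        simp only [Finset.forall_mem_insert, hiff, false_and]
        simp
    · rintro t3 s3 hf3 ⟨ht3, -, hI2⟩
      have h4' : s3.reg 4 = 1 := (hf3.reg 4 (by decide)).trans (by simpa [hs2] using h4)
      have h29 : s3.reg 29 = s1.reg 29 := (hf3.reg 29 (by decide)).trans (by simp [hs2])
      have hext : (∀ v ∈ Finset.univ, v ∈ L.get x ↔ v ∈ A) ↔ L.get x = A := by
        simp [Finset.ext_iff]
      simp only [hext] at hI2
      refine wp_ite (fun hb => wp_const ⟨by omega, ?_⟩) (fun hb => wp_skip ⟨by omega, ?_⟩)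
      · have : L.get x = A := by
          by_contra hc
          simp [Test.Holds, hI2, h4'] at hb
          exact hc hb
        simp [show L[(x : ℕ)] = A from this]
      · have hne : ¬ L.get x = A := by
          intro hc
          simp [Test.Holds, hI2, h4'] at hb
          exact hb hc
        simp only [Finset.mem_insert, or_and_right, exists_or, exists_eq_left, hne, false_or]
        simpa [h29] using hI
  · rintro t s1 - ⟨ht, hI⟩
    refine ⟨by linarith, ?_⟩
    rw [hI]
    simp [List.mem_iff_get]

/-- Without repetitions the length of the list is bounded by the number of candidates, and different
index words later denote different tuples. -/
theorem wp_addCandidate (hG : G.InMemory s) {L : List (Finset (Fin n))} (hL : Stored L s)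
    (hnd : L.Nodup) {A : Finset (Fin n)} (hA : IsIndicator (s.arr 6) A) :
    wp addCandidate s fun t s' => t ≤ L.length * (n * 7 + 9) + n * 5 + 20 ∧
      ∃ L' : List (Finset (Fin n)), L'.Nodup ∧ Stored L' s' ∧ ∀ U, U ∈ L' ↔ U = A ∨ U ∈ L := by
  classical
  refine wp_seq ((wp_findCandidate hG hL hA).mono ?_)
  rintro t1 s1 hf1 ⟨ht1, h29⟩
  have hG1 := hG.frame hf1 (by decide)
  have hL1 := hL.congr (hf1.reg 27 (by decide)) (hf1.reg 28 (by decide)) (hf1.arr 12 (by decide))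
    (hf1.arr 13 (by decide))
  have hA1 : IsIndicator (s1.arr 6) A := by rw [hf1.arr 6 (by decide)]; exact hA
  refine wp_ite (fun hb => ?_) (fun hb => wp_skip ?_)
  all_goals simp [Test.Holds, h29, hG1.zero] at hb
  · refine wp_seq (wp_store (wp_seq (wp_succ ?_)))
    set s2 := ((s1.setArr 13 _ _).setReg 27 _) with hs2
    have c27 : s2.reg 27 = L.length + 1 := by simp [hs2, hL1.count]
    have c28 : s2.reg 28 = s1.reg 28 := by simp [hs2]
    have c13 : s2.arr 13 = Function.update (s1.arr 13) L.length (s1.reg 28) := by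
      simp [hs2, hL1.count]
    have c12 : s2.arr 12 = s1.arr 12 := by simp [hs2]
    have c6 : IsIndicator (s2.arr 6) A := by simpa [hs2] using hA1
    refine (wp_forBelow_const (N := n) 3 (fun D s' => s'.reg 28 = s1.reg 28 + D.card ∧
      (∀ c < s1.reg 28, s'.arr 12 c = s1.arr 12 c) ∧
      ∀ v ∈ D, s'.arr 12 (s1.reg 28 + v) = if v ∈ A then 1 else 0) (by decide) (by decide) (by decide)
      ?_ ?_ ?_).mono ?_
    · simp [hs2, hG1.regN]
    · simp [c28, c12]
    · rintro D v s3 hD hf3 h7 ⟨hI1, hI2, hI3⟩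
      have c6' : s3.arr 6 v = if v ∈ A then 1 else 0 := by
        rw [hf3.arr 6 (by decide)]; exact c6 v
      have hvD := not_mem_of_mem_iff_lt hD
      refine wp_seq (wp_load (wp_seq (wp_store (wp_succ ⟨le_rfl, ?_, ?_, ?_⟩))))
      · rw [Finset.card_insert_of_notMem hvD]
        simp [hI1]; omega
      · intro c hc
        simp [hI1]
        rw [Function.update_of_ne (by omega)]
        exact hI2 c hc
      · intro w hw
        simp only [arr_setReg, arr_setArr, reg_setReg, if_true]
        norm_num
        rw [hI1, card_of_mem_iff_lt hD, h7, c6']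
        by_cases hwv : w = v
        · subst hwv; simp
        · have : (w : ℕ) ≠ v := fun h => hwv (Fin.ext h)
          rw [Function.update_of_ne (by omega)]
          exact hI3 w ((Finset.mem_insert.1 hw).resolve_left hwv)
    · rintro t3 s3 hf3 ⟨ht3, hI1, hI2, hI3⟩
      have d13 : s3.arr 13 = Function.update (s1.arr 13) L.length (s1.reg 28) :=
        (hf3.arr 13 (by decide)).trans c13
      rw [Finset.card_univ, Fintype.card_fin] at hI1
      have hlt : ∀ i, i < L.length → s3.arr 13 i = s1.arr 13 i := fun i hi => by
        rw [d13, Function.update_of_ne (by omega)]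
      have heq : s3.arr 13 L.length = s1.reg 28 := by rw [d13]; simp
      refine ⟨by omega, L ++ [A], ?_, ⟨?_, ?_, ?_⟩, ?_⟩
      · rw [List.nodup_append]
        refine ⟨hnd, by simp, ?_⟩
        rintro a ha b hb' rfl
        rw [List.mem_singleton] at hb'
        exact hb (hb' ▸ ha)
      · rw [hf3.reg 27 (by decide), c27]; simp
      · intro i hi
        rw [List.length_append, List.length_singleton] at hi
        rcases Nat.lt_succ_iff_lt_or_eq.1 hi with h | h
        · rw [hlt i h, hI1]
          have := hL1.fits i h
          omega
        · rw [h, heq, hI1]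
      · intro i hi v
        rw [List.length_append, List.length_singleton] at hi
        rcases Nat.lt_succ_iff_lt_or_eq.1 hi with h | h
        · have := hL1.fits i h
          have hv := v.2
          rw [hlt i h, hI2 _ (by omega), hL1.cells i h v, List.getElem_append_left h]
        · subst h
          rw [heq, hI3 v (Finset.mem_univ _)]
          simp
      · intro U; simp [or_comm]
  · refine ⟨by omega, L, hnd, hL1, fun U => ⟨.inr, ?_⟩⟩
    rintro (rfl | h)
    · exact hb
    · exact h

end MultiHypergraph

/-! ### From words of vertices to candidates. -/

namespace MultiHypergraph

open Ram

variable {n m k : ℕ} {G : MultiHypergraph n m} {s s' : Store}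

/-- Register `26` becomes `2k - 1` and register `24` twice as much, where register `0` holds `k`. -/
def terminalNumbers : Prog :=
  block [.const 26 0, .const 24 0, forBelow 22 0 (block [.succ 26, .succ 26, .succ 24, .succ 24,
    .succ 24, .succ 24]), .pred 26, .pred 24, .pred 24]

theorem wp_terminalNumbers (h0 : s.reg 0 = k) :
    wp terminalNumbers s fun t s' => t ≤ k * 8 + 7 ∧ s'.reg 26 = 2 * k - 1 ∧
      s'.reg 24 = (2 * k - 1) + (2 * k - 1) := by
  classical
  refine wp_seq (wp_const (wp_seq (wp_const (wp_seq ?_))))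
  refine (wp_forBelow_const (N := k) 6 (fun D s' => s'.reg 26 = 2 * D.card ∧
    s'.reg 24 = 4 * D.card) (by decide) (by decide) (by decide) ?_ ?_ ?_).mono ?_
  · simpa using h0
  · simp
  · rintro D x s1 hD hf h22 ⟨hI1, hI2⟩
    refine wp_seq (wp_succ (wp_seq (wp_succ (wp_seq (wp_succ (wp_seq (wp_succ (wp_seq (wp_succ
      (wp_succ ⟨by norm_num, ?_⟩))))))))))
    rw [Finset.card_insert_of_notMem (not_mem_of_mem_iff_lt hD)]
    constructor
    · simp [hI1]; omega
    · simp [hI2]; omega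
  · rintro t s1 - ⟨ht, hI1, hI2⟩
    rw [Finset.card_univ, Fintype.card_fin] at hI1 hI2
    refine wp_seq (wp_pred (wp_seq (wp_pred (wp_pred ⟨by omega, ?_, ?_⟩))))
    · simp [hI1]
    · simp [hI2]; omega

/-- Make the first half of the word in array `11` the set in array `9` and the second half the
set in array `10`. -/
def wordSets : Prog :=
  block [forBelow 7 1 (block [.store 9 7 3, .store 10 7 3]), .copy 23 26,
    forBelow 22 26 (block [.load 7 11 22, .store 9 7 4, .load 7 11 23, .store 10 7 4, .succ 23])]

/-- The vertices that occur in the first half of the word. -/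
def leftSet {r : ℕ} (f : Fin (r + r) → Fin n) : Finset (Fin n) :=
  Finset.univ.image fun i : Fin r => f (i.castAdd r)

/-- The vertices that occur in the second half of the word. -/
def rightSet {r : ℕ} (f : Fin (r + r) → Fin n) : Finset (Fin n) :=
  Finset.univ.image fun i : Fin r => f (i.natAdd r)

theorem wp_wordSets {r : ℕ} (hG : G.InMemory s) (h26 : s.reg 26 = r) (f : Fin (r + r) → Fin n)
    (hf : ∀ i : Fin (r + r), s.arr 11 i = f i) :
    wp wordSets s fun t s' => t ≤ n * 4 + r * 7 + 5 ∧ IsIndicator (s'.arr 9) (leftSet f) ∧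
      IsIndicator (s'.arr 10) (rightSet f) := by
  classical
  refine wp_seq ((wp_forBelow_const (N := n) 2 (fun D s' => ∀ v ∈ D, s'.arr 9 v = 0 ∧
    s'.arr 10 v = 0) (by decide) (by decide) (by decide) hG.regN (by simp) ?_).mono ?_)
  · rintro D x s1 hD hf1 h7 hI
    have h3 : s1.reg 3 = 0 := (hf1.reg 3 (by decide)).trans hG.zero
    refine wp_seq (wp_store (wp_store ⟨le_rfl, fun v hv => ?_⟩))
    by_cases hvx : v = x
    · subst hvx; simp [h7, h3]
    · have : (v : ℕ) ≠ x := fun h => hvx (Fin.ext h)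
      simpa [h7, Function.update_of_ne this] using hI v ((Finset.mem_insert.1 hv).resolve_left hvx)
  rintro t1 s1 hf1 ⟨ht1, hI1⟩
  have h26' : s1.reg 26 = r := (hf1.reg 26 (by decide)).trans h26
  have h4 : s1.reg 4 = 1 := (hf1.reg 4 (by decide)).trans hG.one
  have a11 : s1.arr 11 = s.arr 11 := hf1.arr 11 (by decide)
  refine wp_seq (wp_copy ?_)
  refine (wp_forBelow_const (N := r) 5 (fun D s' => s'.reg 23 = r + D.card ∧
    IsIndicator (s'.arr 9) (D.image fun i : Fin r => f (i.castAdd r)) ∧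
    IsIndicator (s'.arr 10) (D.image fun i : Fin r => f (i.natAdd r)))
    (by decide) (by decide) (by decide) ?_ ?_ ?_).mono ?_
  · simpa using h26'
  · refine ⟨by simp [h26'], fun v => ?_, fun v => ?_⟩
    · simpa using (hI1 v (Finset.mem_univ _)).1
    · simpa using (hI1 v (Finset.mem_univ _)).2
  · rintro D x s2 hD hf2 h22 ⟨hI23, hI9, hI10⟩
    have h4' : s2.reg 4 = 1 := (hf2.reg 4 (by decide)).trans (by simpa using h4)
    have a11' : s2.arr 11 = s.arr 11 := (hf2.arr 11 (by decide)).trans (by simpa using a11)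
    have hc := card_of_mem_iff_lt hD
    have e1 : s.arr 11 x = f (x.castAdd r) := hf (x.castAdd r)
    have e2 : s.arr 11 (r + x) = f (x.natAdd r) := hf (x.natAdd r)
    refine wp_seq (wp_load (wp_seq (wp_store (wp_seq (wp_load (wp_seq (wp_store (wp_succ
      ⟨le_rfl, ?_, ?_, ?_⟩))))))))
    · rw [Finset.card_insert_of_notMem (not_mem_of_mem_iff_lt hD)]
      simp [hI23]; omega
    · rw [Finset.image_insert]
      simpa [h22, a11', e1, h4'] using hI9.insert (f (x.castAdd r))
    · rw [Finset.image_insert]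
      simpa [h22, a11', e2, h4', hI23, hc] using hI10.insert (f (x.natAdd r))
  · rintro t2 s2 - ⟨ht2, -, hI9, hI10⟩
    exact ⟨by omega, hI9, hI10⟩

/-- Register `12` tells whether the sets in the arrays `9` and `10` are disjoint. -/
def testDisjoint : Prog :=
  block [.const 12 1, forBelow 7 1 (block [.load 10 9 7, .load 11 10 7,
    .ite (.eq 10 4) (.ite (.eq 11 4) (.const 12 0) .skip) .skip])]

open scoped Classical in
theorem wp_testDisjoint {S T : Finset (Fin n)} (hG : G.InMemory s) (hS : IsIndicator (s.arr 9) S)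
    (hT : IsIndicator (s.arr 10) T) :
    wp testDisjoint s fun t s' => t ≤ n * 7 + 3 ∧ s'.reg 12 = if Disjoint S T then 1 else 0 := by
  refine wp_seq (wp_const ?_)
  refine (wp_forBelow_const (N := n) 5 (fun D s' => s'.reg 12 =
    if ∀ v ∈ D, v ∈ S → v ∉ T then 1 else 0) (by decide) (by decide) (by decide)
    (by simpa using hG.regN) (by simp) ?_).mono ?_
  · rintro D x s1 hD hf h7 hI
    have h4 : s1.reg 4 = 1 := (hf.reg 4 (by decide)).trans (by simpa using hG.one)
    have hS' : s1.arr 9 x = 1 ↔ x ∈ S := by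
      rw [hf.arr 9 (by decide)]; simpa using hS.eq_one_iff
    have hT' : s1.arr 10 x = 1 ↔ x ∈ T := by
      rw [hf.arr 10 (by decide)]; simpa using hT.eq_one_iff
    refine wp_seq (wp_load (wp_seq (wp_load (wp_ite (fun hb => wp_ite (fun hb' => wp_const ?_)
      (fun hb' => wp_skip ?_)) (fun hb => wp_skip ?_)))))
    all_goals
      refine ⟨by norm_num, ?_⟩
      simp [Test.Holds, h7, h4, hS'] at hb
      simp only [Finset.forall_mem_insert]
    · simp [Test.Holds, h7, h4, hT'] at hb'
      simp [hb, hb']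
    · simp [Test.Holds, h7, h4, hT'] at hb'
      simpa [hb, hb'] using hI
    · simpa [hb] using hI
  · rintro t1 s1 - ⟨ht1, hI⟩
    refine ⟨by omega, ?_⟩
    rw [hI]
    simp [Finset.disjoint_left]

/-- Add the source minimal minimum terminal cut that belongs to the word in array `11`. -/
def wordCandidate : Prog :=
  block [wordSets, testDisjoint, .ite (.eq 12 4) (block [minCut, addCandidate]) .skip]

theorem wp_wordCandidate {r : ℕ} (hne : ∀ e, (G.edge e).Nonempty) (hG : G.InMemory s)
    (h26 : s.reg 26 = r) (f : Fin (r + r) → Fin n) (hf : ∀ i : Fin (r + r), s.arr 11 i = f i)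
    {L : List (Finset (Fin n))} (hL : Stored L s) (hnd : L.Nodup) :
    wp wordCandidate s fun t s' =>
      t ≤ 1000 * (n + 1) ^ 4 * (G.size + 1) + L.length * (n * 7 + 9) + n * 20 + r * 7 + 40 ∧
      ∃ L' : List (Finset (Fin n)), L'.Nodup ∧ Stored L' s' ∧ ∀ U, U ∈ L' ↔
        (Disjoint (leftSet f) (rightSet f) ∧
          G.IsSourceMinimalMinCut (leftSet f) (rightSet f) U) ∨ U ∈ L := by
  classical
  refine wp_seq ((wp_wordSets hG h26 f hf).mono ?_)
  rintro t1 s1 hf1 ⟨ht1, h9, h10⟩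
  have hG1 := hG.frame hf1 (by decide)
  refine wp_seq ((wp_testDisjoint hG1 h9 h10).mono ?_)
  rintro t2 s2 hf2 ⟨ht2, h12⟩
  have hG2 := hG1.frame hf2 (by decide)
  have hL2 : Stored L s2 := (hL.congr (hf1.reg 27 (by decide)) (hf1.reg 28 (by decide))
    (hf1.arr 12 (by decide)) (hf1.arr 13 (by decide))).congr (hf2.reg 27 (by decide))
    (hf2.reg 28 (by decide)) (hf2.arr 12 (by decide)) (hf2.arr 13 (by decide))
  refine wp_ite (fun hb => wp_seq ?_) (fun hb => wp_skip ?_)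
  all_goals simp [Test.Holds, h12, hG2.one] at hb
  · refine (wp_minCut hne hG2 hb (by rw [hf2.arr 9 (by decide)]; exact h9)
      (by rw [hf2.arr 10 (by decide)]; exact h10)).mono ?_
    rintro t3 s3 hf3 ⟨ht3, A, hA, hcut⟩
    have hG3 := hG2.frame hf3 (by decide)
    have hL3 : Stored L s3 := hL2.congr (hf3.reg 27 (by decide))
      (hf3.reg 28 (by decide)) (hf3.arr 12 (by decide)) (hf3.arr 13 (by decide))
    refine (wp_addCandidate hG3 hL3 hnd hA).mono ?_
    rintro t4 s4 - ⟨ht4, L', hnd', hL', hmem⟩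
    refine ⟨by omega, L', hnd', hL', fun U => ?_⟩
    rw [hmem]
    refine or_congr ⟨?_, ?_⟩ Iff.rfl
    · rintro rfl; exact ⟨hb, hcut⟩
    · rintro ⟨-, h⟩; exact G.sourceMinimal_unique h hcut
  · exact ⟨by omega, L, hnd, hL2, fun U => by simp [hb]⟩

/-- List the candidates. -/
def listCandidates : Prog :=
  block [terminalNumbers, .copy 25 1, .const 27 0, .const 28 0, forWords wordCandidate]

/-- The two halves of the word have length `2k - 1 ≥ 1`, so the sets they spell are automatically
non-empty and small enough. -/
theorem mem_candidates_iff_exists_word (hk : 2 ≤ k) {U : Finset (Fin n)} : U ∈ G.candidates k ↔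
    ∃ f : Fin ((2 * k - 1) + (2 * k - 1)) → Fin n, Disjoint (leftSet f) (rightSet f) ∧
      G.IsSourceMinimalMinCut (leftSet f) (rightSet f) U := by
  rw [mem_candidates]
  constructor
  · rintro ⟨S, T, hS, hT, hd, hSc, hTc, h⟩
    obtain ⟨g, rfl⟩ := exists_image_eq hS hSc
    obtain ⟨g', rfl⟩ := exists_image_eq hT hTc
    have e1 : leftSet (Fin.append g g') = Finset.univ.image g := by simp [leftSet]
    have e2 : rightSet (Fin.append g g') = Finset.univ.image g' := by
      simp only [rightSet, Fin.append_right]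
    exact ⟨Fin.append g g', by rw [e1, e2]; exact ⟨hd, h⟩⟩
  · rintro ⟨f, hd, h⟩
    have : Nonempty (Fin (2 * k - 1)) := ⟨⟨0, by omega⟩⟩
    refine ⟨_, _, Finset.univ_nonempty.image _, Finset.univ_nonempty.image _, hd, ?_, ?_, h⟩ <;>
      exact Finset.card_image_le.trans (by simp)

theorem wp_listCandidates (hk : 2 ≤ k) (hn : 0 < n) (hne : ∀ e, (G.edge e).Nonempty)
    (hG : G.InMemory s) (h0 : s.reg 0 = k) :
    wp listCandidates s fun t s' =>
      t ≤ n ^ (4 * k - 2) * (1000 * (n + 1) ^ 4 * (G.size + 1) + n ^ (4 * k - 2) * (n * 7 + 9) +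
        n * 20 + k * 50 + 50) + k * 20 + 20 ∧
      ∃ L : List (Finset (Fin n)), L.Nodup ∧ Stored L s' ∧ ∀ U, U ∈ L ↔ U ∈ G.candidates k := by
  classical
  refine wp_seq ((wp_terminalNumbers h0).mono ?_)
  rintro t1 s1 hf1 ⟨ht1, h26, h24⟩
  refine wp_seq (wp_copy (wp_seq (wp_const (wp_seq (wp_const ?_)))))
  set s2 := (((s1.setReg 25 _).setReg 27 0).setReg 28 0) with hs2
  have hG2 : G.InMemory s2 := by
    have hG1 := hG.frame hf1 (by decide)
    repeat' first | exact hG1 | apply InMemory.setReg | norm_num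
  have hr1 : s1.reg 1 = n := (hf1.reg 1 (by decide)).trans hG.regN
  set r := 2 * k - 1 with hr
  have hpow : n ^ (r + r) = n ^ (4 * k - 2) := by congr 1; omega
  refine (wp_forWords (L := r + r) (B := n)
    (T := 1000 * (n + 1) ^ 4 * (G.size + 1) + n ^ (4 * k - 2) * (n * 7 + 9) + n * 20 + r * 7 + 40)
    hG2.zero hG2.one (by simpa [hs2] using h24) (by simp [hs2, hr1]) hn (by decide)
    (fun D s' => ∃ L : List (Finset (Fin n)), L.Nodup ∧ Stored L s' ∧ ∀ U, U ∈ L ↔ ∃ f ∈ D,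
      Disjoint (leftSet f) (rightSet f) ∧ G.IsSourceMinimalMinCut (leftSet f) (rightSet f) U)
    ?_ ?_ ?_).mono ?_
  · rintro D s3 s4 hr ha - ⟨L, hL1, hL2, hL3⟩
    exact ⟨L, hL1, hL2.congr (hr _ (by decide) (by decide) (by decide))
      (hr _ (by decide) (by decide) (by decide)) (ha _ (by decide)) (ha _ (by decide)), hL3⟩
  · exact ⟨[], List.nodup_nil, ⟨by simp [hs2], by simp, by simp⟩, by simp⟩
  · rintro D f s3 hfD hf3 h11 ⟨L, hL1, hL2, hL3⟩
    -- Only candidates are ever stored, so their number also bounds the cost of the search for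
    -- duplicates.
    have hlen : L.length ≤ n ^ (4 * k - 2) := by
      rw [← List.toFinset_card_of_nodup hL1]
      refine (Finset.card_le_card fun U hU => ?_).trans (G.card_candidates_le (k := k))
      rw [List.mem_toFinset, hL3] at hU
      obtain ⟨f, -, h⟩ := hU
      exact (mem_candidates_iff_exists_word hk).2 ⟨f, h⟩
    refine (wp_wordCandidate hne (hG2.frame hf3 (by decide)) (r := r) ?_ f h11 hL2 hL1).mono ?_
    · rw [hf3.reg 26 (by decide)]; simpa [hs2] using h26
    · rintro t4 s4 - ⟨ht4, L', hL'1, hL'2, hL'3⟩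
      refine ⟨?_, L', hL'1, hL'2, fun U => ?_⟩
      · have := Nat.mul_le_mul_right (n * 7 + 9) hlen
        omega
      · rw [hL'3, hL3]
        simp
  · rintro t3 s3 - ⟨ht3, L, hL1, hL2, hL3⟩
    refine ⟨?_, L, hL1, hL2, fun U => ?_⟩
    · rw [hpow] at ht3
      have : n ^ (4 * k - 2) * (1000 * (n + 1) ^ 4 * (G.size + 1) +
          n ^ (4 * k - 2) * (n * 7 + 9) + n * 20 + r * 7 + 40 + (r + r) * 9 + 4) ≤
          n ^ (4 * k - 2) * (1000 * (n + 1) ^ 4 * (G.size + 1) + n ^ (4 * k - 2) * (n * 7 + 9) +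
            n * 20 + k * 50 + 50) := Nat.mul_le_mul_left _ (by omega)
      omega
    · rw [hL3, mem_candidates_iff_exists_word hk]
      simp only [Finset.mem_univ, true_and]
      exact Iff.rfl

end MultiHypergraph

/-! ### Testing a tuple -/

namespace MultiHypergraph

open Ram

variable {n m k : ℕ} {G : MultiHypergraph n m} {s s' : Store} {U : Fin k → Finset (Fin n)}

/-- The array `a` holds for each vertex `v` one more than the index `i` with `M i v`, which is
unique, and zero if there is no such index. -/
def IsOwner (a : ℕ → ℕ) (M : Fin k → Fin n → Prop) : Prop :=
  ∀ v : Fin n, (∀ i : Fin k, a v = i + 1 ↔ M i v) ∧ (a v = 0 ∨ ∃ i : Fin k, a v = i + 1)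

theorem IsOwner.congr {a : ℕ → ℕ} {M M' : Fin k → Fin n → Prop} (h : IsOwner a M)
    (h' : ∀ i v, M i v ↔ M' i v) : IsOwner a M' :=
  fun v => ⟨fun i => ((h v).1 i).trans (h' i v), (h v).2⟩

theorem IsOwner.disjoint {a : ℕ → ℕ} (h : IsOwner a fun i v => v ∈ U i) (i j : Fin k)
    (hij : i ≠ j) : Disjoint (U i) (U j) := by
  rw [Finset.disjoint_left]
  intro v hi hj
  have h1 := ((h v).1 i).2 hi
  have h2 := ((h v).1 j).2 hj
  exact hij (Fin.ext (by omega))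

/-- Put the owners of the vertices into array `14`, where the word in array `11` lists the numbers
of the members of the tuple; register `33` tells whether they are disjoint. -/
def loadOwners : Prog :=
  block [.const 33 1, forBelow 7 1 (block [.store 14 7 3, .store 16 7 3]),
    forBelow 34 0 (block [.load 35 11 34, .load 35 13 35, .copy 36 34, .succ 36,
      forBelow 7 1 (block [.load 10 12 35, .ite (.eq 10 4) (block [.load 11 14 7,
        .ite (.eq 11 3) (.store 14 7 36) (.const 33 0)]) .skip, .succ 35])])]

/-- A vertex that already has an owner when another member claims it refutes disjointness. After
such a conflict nothing is asserted about the owners. -/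
theorem wp_loadOwners (hG : G.InMemory s) (h0 : s.reg 0 = k) {L : List (Finset (Fin n))}
    (hL : Stored L s) (f : Fin k → Fin L.length) (hf : ∀ i : Fin k, s.arr 11 i = f i) :
    wp loadOwners s fun t s' => t ≤ k * (n * 8 + 8) + n * 4 + 5 ∧ (∀ v : Fin n, s'.arr 16 v = 0) ∧
      ((s'.reg 33 = 1 ∧ IsOwner (s'.arr 14) fun (i : Fin k) v => v ∈ L.get (f i)) ∨
        (s'.reg 33 = 0 ∧ ¬ ∀ i j, i ≠ j → Disjoint (L.get (f i)) (L.get (f j)))) := by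
  classical
  refine wp_seq (wp_const (wp_seq ?_))
  refine (wp_forBelow_const (N := n) 2 (fun D s' => ∀ v ∈ D, s'.arr 14 v = 0 ∧
    s'.arr 16 v = 0) (by decide) (by decide) (by decide) ?_ ?_ ?_).mono ?_
  · simpa using hG.regN
  · simp
  · rintro D x s1 hD hf1 h7 hI
    have h3 : s1.reg 3 = 0 := (hf1.reg 3 (by decide)).trans (by simpa using hG.zero)
    refine wp_seq (wp_store (wp_store ⟨le_rfl, fun v hv => ?_⟩))
    by_cases hvx : v = x
    · subst hvx; simp [h7, h3]
    · have : (v : ℕ) ≠ x := fun h => hvx (Fin.ext h)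
      simpa [h7, Function.update_of_ne this] using hI v ((Finset.mem_insert.1 hv).resolve_left hvx)
  rintro t1 s1 hf1 ⟨ht1, hI1⟩
  have hG1 : G.InMemory s1 := (hG.setReg (x := 33) (v := 1) (by norm_num)).frame hf1 (by decide)
  have h33 : s1.reg 33 = 1 := (hf1.reg 33 (by decide)).trans (by simp)
  have h0' : s1.reg 0 = k := (hf1.reg 0 (by decide)).trans (by simpa using h0)
  have a11 : s1.arr 11 = s.arr 11 := (hf1.arr 11 (by decide)).trans (by simp)
  have a12 : s1.arr 12 = s.arr 12 := (hf1.arr 12 (by decide)).trans (by simp)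
  have a13 : s1.arr 13 = s.arr 13 := (hf1.arr 13 (by decide)).trans (by simp)
  refine (wp_forBelow_const (N := k) (n * 8 + 6) (fun D s' => (∀ v : Fin n, s'.arr 16 v = 0) ∧
    ((s'.reg 33 = 1 ∧ IsOwner (s'.arr 14) fun (i : Fin k) v => i ∈ D ∧ v ∈ L.get (f i)) ∨
      (s'.reg 33 = 0 ∧ ¬ ∀ i j, i ≠ j → Disjoint (L.get (f i)) (L.get (f j)))))
    (by decide) (by decide) (by decide) h0' ?_ ?_).mono ?_
  · refine ⟨fun v => (hI1 v (Finset.mem_univ _)).2, .inl ⟨by simpa using h33, fun v => ?_⟩⟩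
    simp [(hI1 v (Finset.mem_univ _)).1]
  · rintro D i s2 hD hf2 h34 ⟨h16, hor⟩
    have hG2 := hG1.frame hf2 (by decide)
    have hiD := not_mem_of_mem_iff_lt hD
    have b11 : s2.arr 11 i = f i := by rw [hf2.arr 11 (by decide), a11, hf]
    have b12 : s2.arr 12 = s.arr 12 := (hf2.arr 12 (by decide)).trans a12
    have b13 : s2.arr 13 = s.arr 13 := (hf2.arr 13 (by decide)).trans a13
    refine wp_seq (wp_load (wp_seq (wp_load (wp_seq (wp_copy (wp_seq (wp_succ ?_)))))))
    set s3 := ((((s2.setReg 35 _).setReg 35 _).setReg 36 _).setReg 36 _) with hs3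
    have c35 : s3.reg 35 = s.arr 13 (f i) := by simp [hs3, h34, b11, b13]
    have c36 : s3.reg 36 = i + 1 := by simp [hs3, h34]
    have c1 : s3.reg 1 = n := by simp [hs3, hG2.regN]
    refine (wp_forBelow_const (N := n) 6 (fun D' s' => s'.reg 35 = s.arr 13 (f i) + D'.card ∧
      (∀ v : Fin n, s'.arr 16 v = 0) ∧
      ((s'.reg 33 = 1 ∧ IsOwner (s'.arr 14) fun (j : Fin k) v =>
        (j ∈ D ∨ j = i ∧ v ∈ D') ∧ v ∈ L.get (f j)) ∨
      (s'.reg 33 = 0 ∧ ¬ ∀ i j, i ≠ j → Disjoint (L.get (f i)) (L.get (f j)))))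
      (by decide) (by decide) (by decide) c1 ?_ ?_).mono ?_
    · refine ⟨by simp [c35], by simpa [hs3] using h16, ?_⟩
      simpa [hs3] using hor
    · rintro D' v s4 hD' hf4 h7 ⟨hI35, hI16, hIor⟩
      have hvD := not_mem_of_mem_iff_lt hD'
      have d12 : s4.arr 12 = s.arr 12 := (hf4.arr 12 (by decide)).trans (by simpa [hs3] using b12)
      have d3 : s4.reg 3 = 0 := (hf4.reg 3 (by decide)).trans (by simp [hs3, hG2.zero])
      have d4 : s4.reg 4 = 1 := (hf4.reg 4 (by decide)).trans (by simp [hs3, hG2.one])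
      have d36 : s4.reg 36 = i + 1 := (hf4.reg 36 (by decide)).trans c36
      have hbit : s4.arr 12 (s4.reg 35) = if v ∈ L.get (f i) then 1 else 0 := by
        rw [d12, hI35, card_of_mem_iff_lt hD']; exact hL.cells _ _ v
      refine wp_seq (wp_load (wp_seq (wp_ite (fun hb => wp_seq (wp_load (wp_ite
        (fun hb' => wp_store (wp_succ ?_)) (fun hb' => wp_const (wp_succ ?_)))))
        (fun hb => wp_skip (wp_succ ?_)))))
      all_goals
        refine ⟨by norm_num, ?_, by simpa [Function.update_apply] using hI16, ?_⟩
        · rw [Finset.card_insert_of_notMem hvD]; simp [hI35]; omega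
        have hbv : v ∈ L.get (f i) ↔ (s4.arr 12 (s4.reg 35) = 1) := by
          rw [hbit]; split_ifs <;> simp_all
        simp [Test.Holds, d4] at hb
        rcases hIor with ⟨hr33, ho⟩ | hIor
        swap
        · exact .inr ⟨by simp [hIor.1], hIor.2⟩
      · simp [Test.Holds, d3, h7] at hb'
        refine .inl ⟨by simpa using hr33, fun w => ?_⟩
        have hvU := hbv.2 hb
        simp only [arr_setReg, arr_setArr, reg_setReg]
        norm_num [h7, d36]
        by_cases hwv : w = v
        · subst hwv
          simp only [Function.update_self, true_or, and_true]
          refine ⟨fun j => ⟨fun h => ?_, fun h => ?_⟩, .inr ⟨i, rfl⟩⟩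
          · obtain rfl : i = j := Fin.ext (by omega)
            exact ⟨.inr rfl, hvU⟩
          · rcases h.1 with h' | h'
            · have := ((ho w).1 j).2 ⟨.inl h', h.2⟩
              omega
            · rw [h']
        · have hwv' : (w : ℕ) ≠ v := fun h => hwv (Fin.ext h)
          simpa [Function.update_of_ne hwv', hwv] using ho w
      · simp [Test.Holds, d3, h7] at hb'
        refine .inr ⟨by simp, fun hdis => ?_⟩
        obtain ⟨j, hj⟩ := (ho v).2.resolve_left hb'
        obtain ⟨hjD, hjU⟩ := ((ho v).1 j).1 hj
        have hji : j ≠ i := fun h => hiD (h ▸ hjD.resolve_right fun h => hvD h.2)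
        exact Finset.disjoint_left.1 (hdis j i hji) hjU (hbv.2 hb)
      · refine .inl ⟨by simpa using hr33, ?_⟩
        have hvU : v ∉ L.get (f i) := fun h => hb (hbv.1 h)
        have := ho.congr (M' := fun (j : Fin k) w =>
          (j ∈ D ∨ j = i ∧ w ∈ insert v D') ∧ w ∈ L.get (f j)) ?_
        · simpa using this
        · intro j w
          by_cases hj : j = i
          · subst hj
            by_cases hw : w = v
            · subst hw
              constructor
              · exact fun h => absurd h.2 hvU
              · exact fun h => absurd h.2 hvU
            · simp [hw]
          · simp [hj]
    · rintro t4 s4 - ⟨ht4, -, hI16, hIor⟩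
      refine ⟨by omega, by simpa using hI16, ?_⟩
      rcases hIor with ⟨h, ho⟩ | h
      · refine .inl ⟨by simpa using h, ?_⟩
        simpa [or_comm] using ho
      · exact .inr (by simpa using h)
  · rintro t2 s2 - ⟨ht2, hI16, hIor⟩
    refine ⟨by ring_nf at ht2 ⊢; omega, hI16, ?_⟩
    simpa using hIor

/-- The hyperedge meets two different members of the tuple. -/
def Multicolored (G : MultiHypergraph n m) (ow : Fin n → ℕ) (e : Fin m) : Prop :=
  ∃ v ∈ G.edge e, ∃ w ∈ G.edge e, ow v ≠ 0 ∧ ow w ≠ 0 ∧ ow v ≠ ow w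

/-- The hyperedge meets exactly one member of the tuple and is not contained in it. -/
def Unbalanced (G : MultiHypergraph n m) (ow : Fin n → ℕ) (e : Fin m) : Prop :=
  ¬ G.Multicolored ow e ∧ (∃ v ∈ G.edge e, ow v = 0) ∧ ∃ v ∈ G.edge e, ow v ≠ 0

/-- Enable the hyperedges that do not meet two members of the tuple; clear register `33` if some
hyperedge meets exactly one member and is not contained in it. -/
def testEdges : Prog :=
  forEdges (block [.const 9 0, .const 10 0, .const 11 0,
    scan (block [.load 12 14 7, .ite (.eq 12 3) (.const 11 1) (.ite (.eq 9 3) (.copy 9 12)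
      (.ite (.eq 9 12) .skip (.const 10 1)))]),
    .store 3 8 7, .store 4 8 7,
    .ite (.eq 10 4) (.store 5 8 3) (block [.store 5 8 4,
      .ite (.eq 11 4) (.ite (.eq 9 3) .skip (.const 33 0)) .skip])])

/-- During the scan register `9` keeps the first owner met, register `10` reports a second one, and
register `11` a vertex without owner. Tail and head get the same vertex, which lets `close` compute
components later. -/
theorem wp_testEdges (hne : ∀ e, (G.edge e).Nonempty) (hG : G.InMemory s) (h33 : s.reg 33 = 1)
    {ow : Fin n → ℕ} (how : ∀ v : Fin n, s.arr 14 v = ow v) :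
    wp testEdges s fun t s' => t ≤ 40 * G.size + 2 ∧
      (∃ tl : Fin m → Fin n, ∀ e, tl e ∈ G.edge e ∧ s'.arr 3 e = tl e ∧ s'.arr 4 e = tl e) ∧
      (∀ e : Fin m, s'.arr 5 e = 1 ↔ ¬ G.Multicolored ow e) ∧
      ((s'.reg 33 = 1 ∧ ∀ e, ¬ G.Unbalanced ow e) ∨
        (s'.reg 33 = 0 ∧ ∃ e, G.Unbalanced ow e)) := by
  classical
  refine (wp_forEdges (a := 8) (b := 20) hne hG (fun D s' =>
    (∀ e ∈ D, ∃ v ∈ G.edge e, s'.arr 3 e = v ∧ s'.arr 4 e = v) ∧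
      (∀ e ∈ D, s'.arr 5 e = 1 ↔ ¬ G.Multicolored ow e) ∧
      ((s'.reg 33 = 1 ∧ ∀ e ∈ D, ¬ G.Unbalanced ow e) ∨
        (s'.reg 33 = 0 ∧ ∃ e, G.Unbalanced ow e))) (by decide) (by decide)
    (by simp [h33]) ?_).mono ?_
  · rintro D e s1 hD hG1 hf1 h8 ⟨hI1, hI2, hI3⟩
    have h14 : ∀ v : Fin n, s1.arr 14 v = ow v := by rw [hf1.arr 14 (by decide)]; exact how
    refine wp_seq (wp_const (wp_seq (wp_const (wp_seq (wp_const (wp_seq ?_))))))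
    set s2 := (((s1.setReg 9 0).setReg 10 0).setReg 11 0) with hs2
    have hG2 : G.InMemory s2 := by
      repeat' first | exact hG1 | apply InMemory.setReg | norm_num
    refine (wp_scan (T := 5) hG2 e (by simpa [hs2] using h8) (fun D' s' =>
      (D'.Nonempty → ∃ v ∈ D', s'.reg 7 = v) ∧
      (s'.reg 11 = if ∃ v ∈ D', ow v = 0 then 1 else 0) ∧
      ((s'.reg 9 = 0 ∧ s'.reg 10 = 0 ∧ ∀ v ∈ D', ow v = 0) ∨
        (s'.reg 9 ≠ 0 ∧ ∃ v ∈ D', ow v = s'.reg 9 ∧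
          ((s'.reg 10 = 0 ∧ ∀ w ∈ D', ow w = 0 ∨ ow w = s'.reg 9) ∨
            (s'.reg 10 = 1 ∧ ∃ w ∈ D', ow w ≠ 0 ∧ ow w ≠ s'.reg 9))))) (by decide) (by decide)
      (by simp [hs2]) ?_).mono ?_
    · rintro D' v s3 q hv hvD hG3 hf3 ⟨-, hJ2, hJ3⟩
      have h14' : s3.arr 14 v = ow v := by
        rw [hf3.arr 14 (by decide)]; simpa [hs2] using h14 v
      have h3 := hG3.zero
      refine wp_seq (wp_load (wp_ite (fun hb => wp_const ?_) (fun hb => wp_ite (fun hb' => wp_copy ?_)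
        (fun hb' => wp_ite (fun hb'' => wp_skip ?_) (fun hb'' => wp_const ?_)))))
      all_goals
        refine ⟨by norm_num, fun _ => ⟨v, by simp, by simp⟩, ?_⟩
        simp [Test.Holds, h14', h3] at hb
        simp only [Finset.exists_mem_insert, Finset.forall_mem_insert, hb, true_or, false_or, true_and]
      · refine ⟨by simp, ?_⟩
        rcases hJ3 with h | ⟨h1, h2⟩
        · exact .inl (by simpa using h)
        · exact .inr ⟨by simpa using h1, .inr (by simpa using h2)⟩
      · simp [Test.Holds, h3] at hb'
        have hJ3' := hJ3.resolve_right fun h => h.1 hb'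
        refine ⟨by simpa using hJ2, .inr ⟨by simpa [h14'] using hb, .inl ⟨by simp [h14'], .inl ⟨?_, ?_⟩⟩⟩⟩
        · simpa using hJ3'.2.1
        · exact ⟨by simp [h14'], fun w hw => .inl (hJ3'.2.2 w hw)⟩
      · simp [Test.Holds, h3] at hb'
        simp [Test.Holds, h14'] at hb''
        refine ⟨by simpa using hJ2, .inr ⟨by simpa using hb', ?_⟩⟩
        obtain ⟨u, hu, hou, hJ⟩ := (hJ3.resolve_left fun h => hb' h.1).2
        refine .inr ⟨u, hu, by simpa using hou, ?_⟩
        rcases hJ with ⟨h, h'⟩ | ⟨h, h'⟩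
        · exact .inl ⟨by simpa using h, by simpa using hb''.symm, by simpa using h'⟩
        · exact .inr ⟨by simpa using h, .inr (by simpa using h')⟩
      · simp [Test.Holds, h3] at hb'
        simp [Test.Holds, h14'] at hb''
        refine ⟨by simpa using hJ2, .inr ⟨by simpa using hb', ?_⟩⟩
        obtain ⟨u, hu, hou, hJ⟩ := (hJ3.resolve_left fun h => hb' h.1).2
        exact .inr ⟨u, hu, by simpa using hou, .inr ⟨by simp, .inl ⟨hb, by simpa using Ne.symm hb''⟩⟩⟩
    · rintro t3 s3 hf3 ⟨ht3, hJ1, hJ2, hJ3⟩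
      have hG3 := hG2.frame hf3 (by decide)
      obtain ⟨v, hv, h7⟩ := hJ1 (hne e)
      have h8' : s3.reg 8 = e := (hf3.reg 8 (by decide)).trans (by simp [hs2, h8])
      have h33' : s3.reg 33 = s1.reg 33 := (hf3.reg 33 (by decide)).trans (by simp [hs2])
      have a3 : s3.arr 3 = s1.arr 3 := (hf3.arr 3 (by decide)).trans (by simp [hs2])
      have a4 : s3.arr 4 = s1.arr 4 := (hf3.arr 4 (by decide)).trans (by simp [hs2])
      have a5 : s3.arr 5 = s1.arr 5 := (hf3.arr 5 (by decide)).trans (by simp [hs2])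
      have hmult : s3.reg 10 = 1 ↔ G.Multicolored ow e := by
        rcases hJ3 with ⟨h1, h2, h3⟩ | ⟨h1, u, hu, hou, ⟨h2, h3⟩ | ⟨h2, w, hw, h3⟩⟩
        · constructor
          · intro h; omega
          · rintro ⟨v, hv, w, hw, hc, -⟩; exact absurd (h3 v hv) hc
        · constructor
          · intro h; omega
          · rintro ⟨v, hv, w, hw, hc1, hc2, hc3⟩
            have := (h3 v hv).resolve_left hc1
            have := (h3 w hw).resolve_left hc2
            omega
        · exact ⟨fun _ => ⟨u, hu, w, hw, by omega, h3.1, by omega⟩, fun _ => h2⟩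
      have hsome : s3.reg 9 = 0 ↔ ¬ ∃ v ∈ G.edge e, ow v ≠ 0 := by
        rcases hJ3 with ⟨h1, h2, h3⟩ | ⟨h1, u, hu, hou, -⟩
        · simpa [h1] using h3
        · simp only [h1, false_iff, not_not]
          exact ⟨u, hu, by omega⟩
      have hzero : s3.reg 11 = 1 ↔ ∃ v ∈ G.edge e, ow v = 0 := by
        rw [hJ2]; split_ifs with h <;> simp [h]
      have hne' : ∀ e' ∈ insert e D, e' ≠ e → e' ∈ D ∧ (e' : ℕ) ≠ e := fun e' h h' =>
        ⟨(Finset.mem_insert.1 h).resolve_left h', fun hc => h' (Fin.ext hc)⟩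
      refine wp_seq (wp_store (wp_seq (wp_store (wp_ite (fun hb => wp_store ?_) (fun hb => wp_seq
        (wp_store (wp_ite (fun hb1 => wp_ite (fun hb2 => wp_skip ?_) (fun hb2 => wp_const ?_))
          (fun hb1 => wp_skip ?_))))))))
      all_goals
        refine ⟨by omega, ?_, ?_, ?_⟩
        · intro e' he'
          by_cases hee : e' = e
          · subst hee
            exact ⟨v, hv, by simp [h8', h7], by simp [h8', h7]⟩
          · obtain ⟨h1, h2⟩ := hne' e' he' hee
            simpa [h8', Function.update_of_ne h2, a3, a4] using hI1 e' h1
        · intro e' he'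
          simp [Test.Holds, hG3.one, hmult] at hb
          by_cases hee : e' = e
          · subst hee
            simp [h8', hb, hG3.zero, hG3.one]
          · obtain ⟨h1, h2⟩ := hne' e' he' hee
            simpa [h8', Function.update_of_ne h2, a5] using hI2 e' h1
        simp [Test.Holds, hG3.one, hmult] at hb
        simp only [Finset.forall_mem_insert]
      · simpa [Unbalanced, hb, h33'] using hI3
      · simp [Test.Holds, hG3.zero, hsome] at hb2
        have : ¬ G.Unbalanced ow e := by rintro ⟨-, -, v, hv, h⟩; exact h (hb2 v hv)
        simpa [this, h33'] using hI3
      · simp only [Test.Holds, reg_setArr, hG3.zero, hsome, not_not] at hb2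
        simp only [Test.Holds, reg_setArr, hG3.one, hzero] at hb1
        exact .inr ⟨by simp, e, hb, hb1, hb2⟩
      · simp only [Test.Holds, reg_setArr, hG3.one, hzero] at hb1
        have : ¬ G.Unbalanced ow e := by rintro ⟨-, h, -⟩; exact hb1 h
        simpa [this, h33'] using hI3
  · rintro t1 s1 - ⟨ht1, hI1, hI2, hI3⟩
    choose tl htl1 htl2 htl3 using fun e => hI1 e (Finset.mem_univ _)
    exact ⟨by omega, ⟨tl, fun e => ⟨htl1 e, htl2 e, htl3 e⟩⟩, fun e => hI2 e (Finset.mem_univ _),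
      by simpa using hI3⟩

end MultiHypergraph

/-! ### Reading the criterion for representatives off the owners. -/

namespace MultiHypergraph

open Ram

variable {n m k : ℕ} {G : MultiHypergraph n m} {s s' : Store} {U : Fin k → Finset (Fin n)}
  {ow : Fin n → ℕ}

theorem multicolored_iff (how : IsOwner (fun v => if h : v < n then ow ⟨v, h⟩ else 0)
    fun i v => v ∈ U i) {e : Fin m} : G.Multicolored ow e ↔
      ∃ i j, i ≠ j ∧ ¬ Disjoint (G.edge e) (U i) ∧ ¬ Disjoint (G.edge e) (U j) := by
  have how' : ∀ v : Fin n, (∀ i : Fin k, ow v = i + 1 ↔ v ∈ U i) ∧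
      (ow v = 0 ∨ ∃ i : Fin k, ow v = i + 1) := fun v => by simpa using how v
  simp only [Finset.not_disjoint_iff]
  constructor
  · rintro ⟨v, hv, w, hw, h1, h2, h3⟩
    obtain ⟨i, hi⟩ := (how' v).2.resolve_left h1
    obtain ⟨j, hj⟩ := (how' w).2.resolve_left h2
    exact ⟨i, j, fun h => h3 (by rw [hi, hj, h]), ⟨v, hv, ((how' v).1 i).1 hi⟩,
      w, hw, ((how' w).1 j).1 hj⟩
  · rintro ⟨i, j, hij, ⟨v, hv, hvi⟩, w, hw, hwj⟩
    have h1 := ((how' v).1 i).2 hvi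
    have h2 := ((how' w).1 j).2 hwj
    have : (i : ℕ) ≠ j := fun h => hij (Fin.ext h)
    exact ⟨v, hv, w, hw, by omega, by omega, by omega⟩

theorem mem_delta_of_multicolored (how : IsOwner (fun v => if h : v < n then ow ⟨v, h⟩ else 0)
    fun i v => v ∈ U i) {e : Fin m} (he : G.Multicolored ow e) {i : Fin k}
    (hi : ¬ Disjoint (G.edge e) (U i)) : e ∈ G.delta (U i) := by
  obtain ⟨i', j', hij, h1, h2⟩ := (multicolored_iff how).1 he
  obtain ⟨v, hv, hvi⟩ := Finset.not_disjoint_iff.1 hi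
  refine G.mem_delta.2 ⟨⟨v, hv, hvi⟩, ?_⟩
  by_cases h : i' = i
  · obtain ⟨w, hw, hwj⟩ := Finset.not_disjoint_iff.1 h2
    exact ⟨w, hw, fun hwi => Finset.disjoint_left.1 (how.disjoint i j' (h ▸ hij)) hwi hwj⟩
  · obtain ⟨w, hw, hwj⟩ := Finset.not_disjoint_iff.1 h1
    exact ⟨w, hw, fun hwi => Finset.disjoint_left.1 (how.disjoint i i' (Ne.symm h)) hwi hwj⟩

theorem multicolored_or_unbalanced (how : IsOwner (fun v => if h : v < n then ow ⟨v, h⟩ else 0)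
    fun i v => v ∈ U i) {e : Fin m} {i : Fin k} (he : e ∈ G.delta (U i)) :
    G.Multicolored ow e ∨ G.Unbalanced ow e := by
  have how' : ∀ v : Fin n, (∀ i : Fin k, ow v = i + 1 ↔ v ∈ U i) ∧
      (ow v = 0 ∨ ∃ i : Fin k, ow v = i + 1) := fun v => by simpa using how v
  refine or_iff_not_imp_left.2 fun hm => ?_
  obtain ⟨⟨v, hv, hvi⟩, w, hw, hwi⟩ := G.mem_delta.1 he
  have h1 := ((how' v).1 i).2 hvi
  refine ⟨hm, ⟨w, hw, ?_⟩, v, hv, by omega⟩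
  by_contra h0
  exact hm ⟨v, hv, w, hw, by omega, h0, fun h => hwi (((how' w).1 i).1 (by omega))⟩

/-- A cut hyperedge meets either two members or one member that does not contain it; `hbal` excludes
the latter. -/
theorem mem_crossing_iff_multicolored (how : IsOwner (fun v => if h : v < n then ow ⟨v, h⟩ else 0)
    fun i v => v ∈ U i) (hbal : ∀ e, ¬ G.Unbalanced ow e) {e : Fin m} :
    e ∈ G.crossing U ↔ G.Multicolored ow e := by
  rw [mem_crossing]
  constructor
  · rintro ⟨i, hi⟩
    exact (multicolored_or_unbalanced how hi).resolve_right (hbal e)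
  · intro h
    obtain ⟨i, -, -, hi, -⟩ := (multicolored_iff how).1 h
    exact ⟨i, mem_delta_of_multicolored how h hi⟩

/-- This turns the first condition of `exists_partition_iff` into a test of the owners, hyperedge by
hyperedge. -/
theorem forall_not_unbalanced_iff (how : IsOwner (fun v => if h : v < n then ow ⟨v, h⟩ else 0)
    fun i v => v ∈ U i) : (∀ e, ¬ G.Unbalanced ow e) ↔ ∀ e ∈ G.crossing U, ∃ i j, i ≠ j ∧
      ¬ Disjoint (G.edge e) (U i) ∧ ¬ Disjoint (G.edge e) (U j) := by
  have how' : ∀ v : Fin n, (∀ i : Fin k, ow v = i + 1 ↔ v ∈ U i) ∧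
      (ow v = 0 ∨ ∃ i : Fin k, ow v = i + 1) := fun v => by simpa using how v
  constructor
  · intro h e he
    exact (multicolored_iff how).1 ((mem_crossing_iff_multicolored how h).1 he)
  · rintro h e ⟨hm, ⟨w, hw, hw0⟩, v, hv, hv0⟩
    obtain ⟨i, hi⟩ := (how' v).2.resolve_left hv0
    refine hm ((multicolored_iff how).2 (h e (G.mem_crossing.2 ⟨i, G.mem_delta.2
      ⟨⟨v, hv, ((how' v).1 i).1 hi⟩, w, hw, fun hwi => ?_⟩⟩)))
    have := ((how' w).1 i).2 hwi
    omega

/-- When tail and head coincide, an enabled hyperedge links all its vertices through that vertex in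
both directions. Closure then is reachability in `G - X`, so one procedure serves for flows and for
components. -/
theorem mem_isClosure_iff {en : Fin m → Prop} {tl : Fin m → Fin n} {S A : Finset (Fin n)}
    {X : Finset (Fin m)} (h : Preflow.IsClosure G en tl tl S A) (htl : ∀ e, tl e ∈ G.edge e)
    (hX : ∀ e, en e ↔ e ∉ X) {v : Fin n} :
    v ∈ A ↔ ∃ s ∈ S, Relation.ReflTransGen (G.AdjAvoiding X) s v := by
  classical
  obtain ⟨h1, h2, h3⟩ := h
  constructor
  · intro hv
    have := h3 (Finset.univ.filter fun v => ∃ s ∈ S, Relation.ReflTransGen (G.AdjAvoiding X) s v)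
      (fun s hs => by simpa using ⟨s, hs, .refl⟩) ?_ hv
    · simpa using this
    · intro e he
      simp only [Finset.mem_filter, Finset.mem_univ, true_and, Finset.subset_iff]
      rw [hX] at he
      refine ⟨?_, ?_⟩
      · rintro ⟨s, hs, hr⟩ w hw
        exact ⟨s, hs, hr.tail ⟨e, he, htl e, hw⟩⟩
      · rintro w hw ⟨s, hs, hr⟩
        exact ⟨s, hs, hr.tail ⟨e, he, hw, htl e⟩⟩
  · rintro ⟨s, hs, hr⟩
    induction hr with
    | refl => exact h1 hs
    | tail _ hadj ih =>
      obtain ⟨e, he, hu, hw⟩ := hadj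
      have he' := (hX e).2 he
      exact (h2 e he').1 ((h2 e he').2 _ hu ih) hw

/-- For the member of the tuple with index in register `34`: register `38` becomes the maximum of
its old value and the cut value of the member, and the vertices that may be added to the member are
marked in array `16`. -/
def testMember : Prog :=
  block [.copy 36 34, .succ 36, forBelow 7 1 (.store 6 7 3), .const 37 0,
    forEdges (block [.load 10 5 8, .ite (.eq 10 4) .skip (block [.const 11 0,
      scan (block [.load 12 14 7, .ite (.eq 12 36) (.const 11 1) .skip]),
      .ite (.eq 11 4) (.succ 37) (scan (.store 6 7 4))])]),
    .ite (.lt 38 37) (.copy 38 37) .skip, close,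
    forBelow 7 1 (block [.load 10 6 7, .ite (.eq 10 4) .skip (.store 16 7 4)])]

-- The closure starts from the vertices of the cut hyperedges that avoid `U i`, so it is the set of
-- blocked vertices. The other cut hyperedges are counted on the way; by `hcross` they are those of
-- `δ(U i)`.
open scoped Classical in
theorem wp_testMember (hne : ∀ e, (G.edge e).Nonempty) (hG : G.InMemory s) {i : Fin k}
    (h34 : s.reg 34 = i) (how : IsOwner (s.arr 14) fun i v => v ∈ U i)
    {tl : Fin m → Fin n} (htl : ∀ e, tl e ∈ G.edge e ∧ s.arr 3 e = tl e ∧ s.arr 4 e = tl e)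
    (hen : ∀ e : Fin m, s.arr 5 e = 1 ↔ e ∉ G.crossing U)
    (hcross : ∀ e i, e ∈ G.delta (U i) ↔ e ∈ G.crossing U ∧ ¬ Disjoint (G.edge e) (U i)) :
    wp testMember s fun t s' => t ≤ 150 * ((n + 1) * (G.size + 1)) ∧
      s'.reg 38 = max (s.reg 38) (G.d (U i)) ∧
      ∀ v : Fin n, s'.arr 16 v = if G.Blocked U i v then s.arr 16 v else 1 := by
  refine wp_seq (wp_copy (wp_seq (wp_succ (wp_seq ?_))))
  set s0 := ((s.setReg 36 _).setReg 36 _) with hs0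
  have hG0 : G.InMemory s0 := by
    repeat' first | exact hG | apply InMemory.setReg | norm_num
  refine (wp_forBelow_const (N := n) 1 (fun D s' => ∀ v ∈ D, s'.arr 6 v = 0) (by decide) (by decide)
    (by decide) hG0.regN (by simp) ?_).mono ?_
  · rintro D x s1 hD hf1 h7 hI
    have h3 : s1.reg 3 = 0 := (hf1.reg 3 (by decide)).trans hG0.zero
    refine wp_store ⟨le_rfl, fun v hv => ?_⟩
    by_cases hvx : v = x
    · subst hvx; simp [h7, h3]
    · have : (v : ℕ) ≠ x := fun h => hvx (Fin.ext h)
      simpa [h7, Function.update_of_ne this] using hI v ((Finset.mem_insert.1 hv).resolve_left hvx)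
  rintro t1 s1 hf1 ⟨ht1, hI1⟩
  have hG1 := hG0.frame hf1 (by decide)
  have h36 : s1.reg 36 = i + 1 := (hf1.reg 36 (by decide)).trans (by simp [hs0, h34])
  have b38 : s1.reg 38 = s.reg 38 := (hf1.reg 38 (by decide)).trans (by simp [hs0])
  have b : ∀ a, a = 3 ∨ a = 4 ∨ a = 5 ∨ a = 14 ∨ a = 16 → s1.arr a = s.arr a := by
    rintro a (rfl | rfl | rfl | rfl | rfl) <;> exact hf1.arr _ (by decide)
  refine wp_seq (wp_const (wp_seq ?_))
  set s2 := (s1.setReg 37 0) with hs2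
  have hG2 : G.InMemory s2 := hG1.setReg (by norm_num)
  refine (wp_forEdges (a := 10) (b := 20) hne hG2 (fun D s' =>
    s'.reg 37 = (D.filter fun e => e ∈ G.delta (U i)).card ∧
    IsIndicator (s'.arr 6) (Finset.univ.filter fun v => ∃ e ∈ D, e ∈ G.crossing U ∧
      v ∈ G.edge e ∧ Disjoint (G.edge e) (U i))) (by decide) (by decide) ?_ ?_).mono ?_
  · refine ⟨by simp [hs2], fun v => ?_⟩
    simpa [hs2] using hI1 v (Finset.mem_univ _)
  · rintro D e s3 hD hG3 hf3 h8 ⟨hJ1, hJ2⟩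
    have heD := not_mem_of_mem_iff_lt hD
    have a14 : s3.arr 14 = s.arr 14 := (hf3.arr 14 (by decide)).trans (by simp [hs2, b])
    have a5 : s3.arr 5 = s.arr 5 := (hf3.arr 5 (by decide)).trans (by simp [hs2, b])
    have h36' : s3.reg 36 = i + 1 := (hf3.reg 36 (by decide)).trans (by simp [hs2, h36])
    refine wp_seq (wp_load (wp_ite (fun hb => wp_skip ?_) (fun hb => wp_seq (wp_const (wp_seq ?_)))))
    all_goals
      simp only [Test.Holds, reg_setReg, if_true, h8, a5, hG3.one] at hb
      norm_num [hG3.one, hen] at hb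
    · have hdel : e ∉ G.delta (U i) := fun h => hb ((hcross e i).1 h).1
      refine ⟨by omega, ?_, ?_⟩
      · rw [Finset.filter_insert, if_neg hdel]
        simpa using hJ1
      · simpa [hb] using hJ2
    · set s4 := ((s3.setReg 10 _).setReg 11 0) with hs4
      have hG4 : G.InMemory s4 := by
        repeat' first | exact hG3 | apply InMemory.setReg | norm_num
      refine (wp_scan (T := 3) hG4 e (by simpa [hs4] using h8) (fun D' s' =>
        s'.reg 11 = if ∃ v ∈ D', v ∈ U i then 1 else 0) (by decide) (by decide) (by simp [hs4])
        ?_).mono ?_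
      · rintro D' v s5 q hv hvD hG5 hf5 hK
        have h36'' : s5.reg 36 = i + 1 := (hf5.reg 36 (by decide)).trans (by simp [hs4, h36'])
        have hiff : s5.arr 14 v = i + 1 ↔ v ∈ U i := by
          rw [hf5.arr 14 (by decide)]; simpa [hs4, a14] using (how v).1 i
        refine wp_seq (wp_load (wp_ite (fun hb => wp_const ⟨by norm_num, ?_⟩)
          (fun hb => wp_skip ⟨by norm_num, ?_⟩)))
        all_goals
          simp [Test.Holds, h36'', hiff] at hb
        · simp [hb]
        · simpa [hb] using hK
      · rintro t5 s5 hf5 ⟨ht5, hK⟩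
        have hG5 := hG4.frame hf5 (by decide)
        have r37 : s5.reg 37 = s3.reg 37 := (hf5.reg 37 (by decide)).trans (by simp [hs4])
        have r8 : s5.reg 8 = e := (hf5.reg 8 (by decide)).trans (by simp [hs4, h8])
        have a6 : s5.arr 6 = s3.arr 6 := (hf5.arr 6 (by decide)).trans (by simp [hs4])
        have hdis : (∃ v ∈ G.edge e, v ∈ U i) ↔ ¬ Disjoint (G.edge e) (U i) :=
          Finset.not_disjoint_iff.symm
        simp only [hdis] at hK
        refine wp_ite (fun hb' => wp_succ ?_) (fun hb' => ?_)
        all_goals simp only [Test.Holds, hG5.one, hK] at hb'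
        · have hd : ¬ Disjoint (G.edge e) (U i) := by
            intro h; simp [h] at hb'
          have hdel : e ∈ G.delta (U i) := (hcross e i).2 ⟨hb, hd⟩
          refine ⟨by omega, ?_, ?_⟩
          · rw [Finset.filter_insert, if_pos hdel, Finset.card_insert_of_notMem (by simp [heD])]
            simp [r37, hJ1]
          · simpa [hd, a6] using hJ2
        · have hd : Disjoint (G.edge e) (U i) := by
            by_contra h; simp [h] at hb'
          have hdel : e ∉ G.delta (U i) := fun h => ((hcross e i).1 h).2 hd
          refine (wp_scan (T := 1) hG5 e r8 (fun D' s' => IsIndicator (s'.arr 6)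
            ((Finset.univ.filter fun v => ∃ e ∈ D, e ∈ G.crossing U ∧
              v ∈ G.edge e ∧ Disjoint (G.edge e) (U i)) ∪ D')) (by decide) (by decide)
            (by simpa [a6] using hJ2) ?_).mono ?_
          · rintro D' v s6 q hv hvD hG6 hf6 hM
            refine wp_store ⟨le_rfl, ?_⟩
            rw [Finset.union_insert]
            simpa [hG6.one] using hM.insert v
          · rintro t6 s6 hf6 ⟨ht6, hM⟩
            refine ⟨by omega, ?_, ?_⟩
            · rw [Finset.filter_insert, if_neg hdel]
              simpa [hf6.reg 37 (by decide), r37] using hJ1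
            · intro v
              refine (hM v).trans (if_congr ?_ rfl rfl)
              simp only [Finset.mem_filter, Finset.mem_univ, true_and, Finset.exists_mem_insert,
                Finset.mem_union, hb, hd, and_true]
              rw [or_comm]
  rintro t3 s3 hf3 ⟨ht3, hJ1, hJ2⟩
  have hG3 := hG2.frame hf3 (by decide)
  have hd : s3.reg 37 = G.d (U i) := by
    rw [hJ1, d]; congr 1; ext e; simp
  have c38 : s3.reg 38 = s.reg 38 := (hf3.reg 38 (by decide)).trans (by simp [hs2, b38])
  have key : ∀ s4, G.InMemory s4 → s4.arr = s3.arr → s4.reg 38 = max (s.reg 38) (G.d (U i)) →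
      wp (.seq close (forBelow 7 1 (block [.load 10 6 7, .ite (.eq 10 4) .skip (.store 16 7 4)])))
        s4 fun t s' => t ≤ 60 * ((n + 1) * (G.size + 1)) ∧
          s'.reg 38 = max (s.reg 38) (G.d (U i)) ∧
          ∀ v : Fin n, s'.arr 16 v = if G.Blocked U i v then s.arr 16 v else 1 := by
    intro s4 hG4 harr h38
    have a3 : s4.arr 3 = s.arr 3 := by
      rw [harr]; exact (hf3.arr 3 (by decide)).trans (by simp [hs2, b])
    have a4 : s4.arr 4 = s.arr 4 := by
      rw [harr]; exact (hf3.arr 4 (by decide)).trans (by simp [hs2, b])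
    have a5 : s4.arr 5 = s.arr 5 := by
      rw [harr]; exact (hf3.arr 5 (by decide)).trans (by simp [hs2, b])
    have a16 : s4.arr 16 = s.arr 16 := by
      rw [harr]; exact (hf3.arr 16 (by decide)).trans (by simp [hs2, b])
    refine wp_seq ((wp_close hne hG4 (by rw [harr]; exact hJ2) (tl := tl) (hd := tl)
      (en := fun e => e ∉ G.crossing U) (fun e => by rw [a3]; exact (htl e).2.1)
      (fun e => by rw [a4]; exact (htl e).2.2) (fun e => by rw [a5]; exact hen e)).mono ?_)
    rintro t5 s5 hf5 ⟨ht5, A, hA, hcl⟩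
    have hG5 := hG4.frame hf5 (by decide)
    have hblk : ∀ v, v ∈ A ↔ G.Blocked U i v := by
      intro v
      rw [mem_isClosure_iff hcl (fun e => (htl e).1) (X := G.crossing U) (fun e => Iff.rfl)]
      simp [Blocked]
    refine (wp_forBelow_const (N := n) 3 (fun D s' => ∀ v : Fin n, s'.arr 16 v =
      if v ∉ D ∨ G.Blocked U i v then s.arr 16 v else 1) (by decide) (by decide) (by decide)
      hG5.regN ?_ ?_).mono ?_
    · intro v
      simp [hf5.arr 16 (by decide), a16]
    · rintro D v s6 hD hf6 h7 hM
      have hvD := not_mem_of_mem_iff_lt hD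
      have h4 : s6.reg 4 = 1 := (hf6.reg 4 (by decide)).trans hG5.one
      have h6 : s6.arr 6 v = 1 ↔ G.Blocked U i v := by
        rw [hf6.arr 6 (by decide), hA.eq_one_iff, hblk]
      refine wp_seq (wp_load (wp_ite (fun hb => wp_skip ?_) (fun hb => wp_store ?_)))
      all_goals
        simp [Test.Holds, h4, h7, h6] at hb
        refine ⟨by norm_num, fun w => ?_⟩
        have hMw := hM w
        by_cases hwv : w = v
      · subst hwv
        simpa [hb] using hMw
      · simpa [hwv] using hMw
      · subst hwv
        simp [h7, h4, hb]
      · have : (w : ℕ) ≠ v := fun h => hwv (Fin.ext h)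
        simpa [hwv, h7, Function.update_of_ne this] using hMw
    · rintro t6 s6 hf6 ⟨ht6, hM⟩
      refine ⟨?_, ?_, by simpa using hM⟩
      · have e1 : 50 * (n + 1) * (G.size + 1) = 50 * ((n + 1) * (G.size + 1)) := by ring
        have e2 : n + 1 ≤ (n + 1) * (G.size + 1) := Nat.le_mul_of_pos_right _ (by omega)
        omega
      · rw [hf6.reg 38 (by decide), hf5.reg 38 (by decide), h38]
  have e1 : n + 1 ≤ (n + 1) * (G.size + 1) := Nat.le_mul_of_pos_right _ (by omega)
  have e2 : G.size + 1 ≤ (n + 1) * (G.size + 1) := Nat.le_mul_of_pos_left _ (by omega)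
  refine wp_seq (wp_ite (fun hb => wp_copy ?_) (fun hb => wp_skip ?_))
  all_goals simp only [Test.Holds, c38, hd] at hb
  · refine (key _ (hG3.setReg (by norm_num)) rfl ?_).mono ?_
    · simp [hd]; omega
    · rintro t4 s4 - ⟨ht4, h4, h4'⟩
      exact ⟨by omega, h4, h4'⟩
  · refine (key _ hG3 rfl ?_).mono ?_
    · rw [c38]; omega
    · rintro t4 s4 - ⟨ht4, h4, h4'⟩
      exact ⟨by omega, h4, h4'⟩

/-- Clear register `33` if some vertex has no owner and no mark. -/
def testCovered : Prog :=
  forBelow 7 1 (block [.load 10 14 7, .load 11 16 7,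
    .ite (.eq 10 3) (.ite (.eq 11 3) (.const 33 0) .skip) .skip])

open scoped Classical in
theorem wp_testCovered (hG : G.InMemory s) (h33 : s.reg 33 = 1) :
    wp testCovered s fun t s' => t ≤ n * 7 + 2 ∧
      s'.reg 33 = if ∀ v : Fin n, s.arr 14 v ≠ 0 ∨ s.arr 16 v ≠ 0 then 1 else 0 := by
  refine (wp_forBelow_const (N := n) 5 (fun D s' =>
    s'.reg 33 = if ∀ v ∈ D, s.arr 14 v ≠ 0 ∨ s.arr 16 v ≠ 0 then 1 else 0) (by decide) (by decide)
    (by decide) hG.regN (by simp [h33]) ?_).mono ?_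
  · rintro D v s1 hD hf h7 hI
    have h3 : s1.reg 3 = 0 := (hf.reg 3 (by decide)).trans hG.zero
    have a14 : s1.arr 14 = s.arr 14 := hf.arr 14 (by decide)
    have a16 : s1.arr 16 = s.arr 16 := hf.arr 16 (by decide)
    refine wp_seq (wp_load (wp_seq (wp_load (wp_ite (fun hb => wp_ite (fun hb' => wp_const ?_)
      (fun hb' => wp_skip ?_)) (fun hb => wp_skip ?_)))))
    all_goals
      refine ⟨by norm_num, ?_⟩
      simp [Test.Holds, h7, h3, a14] at hb
      simp only [Finset.forall_mem_insert]
    · simp [Test.Holds, h7, h3, a16] at hb'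
      simp [hb, hb']
    · simp [Test.Holds, h7, h3, a16] at hb'
      simpa [hb'] using hI
    · simpa [hb] using hI
  · rintro t1 s1 - ⟨ht1, hI⟩
    exact ⟨by omega, by simpa using hI⟩

/-- Register `33` tells whether the tuple of the word in array `11` represents a partition. If so,
register `38` becomes its value. -/
def testTuple : Prog :=
  block [loadOwners, .ite (.eq 33 4) (block [testEdges, .ite (.eq 33 4)
    (block [.const 38 0, forBelow 34 0 testMember, testCovered]) .skip]) .skip]

/-- The stages decide disjointness and then the two conditions of `exists_partition_iff`. Each stage
relies on the earlier ones: owners require disjoint members, and the enabled hyperedges are the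
uncut ones only once no hyperedge is unbalanced. -/
theorem wp_testTuple (hk : 1 ≤ k) (hne : ∀ e, (G.edge e).Nonempty) (hG : G.InMemory s)
    (h0 : s.reg 0 = k) {L : List (Finset (Fin n))} (hL : Stored L s) (hLne : ∀ A ∈ L, A.Nonempty)
    (f : Fin k → Fin L.length) (hf : ∀ i : Fin k, s.arr 11 i = f i) :
    wp testTuple s fun t s' => t ≤ 300 * (k * ((n + 1) * (G.size + 1))) ∧
      ((s'.reg 33 = 1 ∧ (∃ P, IsKPartition P ∧ G.IsCutSetRep (fun i => L.get (f i)) P) ∧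
        s'.reg 38 = G.maxCut (fun i => L.get (f i)) ∧
        IsOwner (s'.arr 14) fun (i : Fin k) v => v ∈ L.get (f i)) ∨
      (s'.reg 33 = 0 ∧ ¬ ∃ P, IsKPartition P ∧ G.IsCutSetRep (fun i => L.get (f i)) P)) := by
  classical
  set U : Fin k → Finset (Fin n) := fun i => L.get (f i) with hU
  have hUne : ∀ i, (U i).Nonempty := fun i => hLne _ (List.get_mem _ _)
  have e1 : n + 1 ≤ (n + 1) * (G.size + 1) := Nat.le_mul_of_pos_right _ (by omega)
  have e2 : G.size + 1 ≤ (n + 1) * (G.size + 1) := Nat.le_mul_of_pos_left _ (by omega)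
  set N := (n + 1) * (G.size + 1) with hN
  have e3 : N ≤ k * N := Nat.le_mul_of_pos_left _ hk
  refine wp_seq ((wp_loadOwners hG h0 hL f hf).mono ?_)
  rintro t1 s1 hf1 ⟨ht1, h16, hor⟩
  have hG1 := hG.frame hf1 (by decide)
  have ht1' : t1 ≤ 8 * (k * N) + 4 * (k * N) + 5 := by
    have : k * (n * 8 + 8) ≤ k * (8 * N) := Nat.mul_le_mul_left _ (by omega)
    have e : k * (8 * N) = 8 * (k * N) := by ring
    omega
  have e4 : 1 ≤ k * N := by omega
  rcases hor with ⟨h33, how⟩ | ⟨h33, hnd⟩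
  swap
  · refine wp_ite (fun hb => ?_) (fun hb => wp_skip ⟨by omega, .inr ⟨h33, ?_⟩⟩)
    · simp [Test.Holds, h33, hG1.one] at hb
    · rintro ⟨P, -, h⟩
      exact hnd h.1
  refine wp_ite (fun hb => wp_seq ?_) (fun hb => absurd (h33.trans hG1.one.symm) hb)
  set ow : Fin n → ℕ := fun v => s1.arr 14 v with how'
  have hown : IsOwner (fun v => if h : v < n then ow ⟨v, h⟩ else 0) fun i v => v ∈ U i := by
    intro v
    simp only [dif_pos v.2]
    exact how v
  have hdisj := how.disjoint (U := U)
  refine (wp_testEdges hne hG1 h33 (ow := ow) (fun v => rfl)).mono ?_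
  rintro t2 s2 hf2 ⟨ht2, ⟨tl, htl⟩, hen, hor⟩
  have hG2 := hG1.frame hf2 (by decide)
  have ht2' : t2 ≤ 40 * (k * N) + 2 := by omega
  rcases hor with ⟨h33', hbal⟩ | ⟨h33', hunb⟩
  swap
  · refine wp_ite (fun hb => ?_) (fun hb => wp_skip ⟨by omega, .inr ⟨h33', ?_⟩⟩)
    · simp [Test.Holds, h33', hG2.one] at hb
    · rw [G.exists_partition_iff hUne hdisj, ← forall_not_unbalanced_iff hown]
      rintro ⟨h, -⟩
      obtain ⟨e, he⟩ := hunb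
      exact h e he
  refine wp_ite (fun hb => wp_seq (wp_const (wp_seq ?_)))
    (fun hb => absurd (h33'.trans hG2.one.symm) hb)
  set s3 := s2.setReg 38 0 with hs3
  have hG3 : G.InMemory s3 := hG2.setReg (by norm_num)
  have hcr : ∀ e, e ∈ G.crossing U ↔ G.Multicolored ow e := fun e =>
    mem_crossing_iff_multicolored hown hbal
  refine (wp_forBelow_const (N := k) (150 * N) (fun D s' =>
    s'.reg 38 = D.sup (fun i => G.d (U i)) ∧
    ∀ v : Fin n, s'.arr 16 v = if ∃ i ∈ D, ¬ G.Blocked U i v then 1 else 0) (by decide) (by decide)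
    (by decide) ?_ ?_ ?_).mono ?_
  · rw [hs3, reg_setReg, if_neg (by norm_num), hf2.reg 0 (by decide), hf1.reg 0 (by decide), h0]
  · refine ⟨by simp [hs3], fun v => ?_⟩
    simp [hs3, hf2.arr 16 (by decide), h16]
  · rintro D i s4 hD hf4 h34 ⟨hI1, hI2⟩
    have hG4 := hG3.frame hf4 (by decide)
    refine (wp_testMember (U := U) (tl := tl) hne hG4 h34 ?_ ?_ ?_ ?_).mono ?_
    · rw [hf4.arr 14 (by decide), hs3, arr_setReg, hf2.arr 14 (by decide)]
      exact how
    · intro e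
      rw [hf4.arr 3 (by decide), hf4.arr 4 (by decide)]
      exact htl e
    · intro e
      rw [hf4.arr 5 (by decide), hcr]
      exact hen e
    · intro e j
      rw [hcr]
      constructor
      · intro h
        refine ⟨(multicolored_or_unbalanced hown h).resolve_right (hbal e), ?_⟩
        obtain ⟨v, hv, hvj⟩ := (G.mem_delta.1 h).1
        exact Finset.not_disjoint_iff.2 ⟨v, hv, hvj⟩
      · rintro ⟨h, h'⟩
        exact mem_delta_of_multicolored hown h h'
    · rintro t5 s5 - ⟨ht5, hJ1, hJ2⟩
      refine ⟨ht5, ?_, fun v => ?_⟩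
      · rw [Finset.sup_insert]
        simp [hJ1, hI1, max_comm]
      · simp only [arr_setReg, hJ2, hI2, Finset.exists_mem_insert]
        by_cases h : G.Blocked U i v <;> simp [h]
  rintro t4 s4 hf4 ⟨ht4, hI1, hI2⟩
  have hG4 := hG3.frame hf4 (by decide)
  have ht4' : t4 ≤ 150 * (k * N) + 2 * (k * N) + 2 := by
    have e : k * (150 * N + 2) = 150 * (k * N) + 2 * k := by ring
    have : k ≤ k * N := Nat.le_mul_of_pos_right _ (by omega)
    omega
  have g14 : s4.arr 14 = s1.arr 14 := by
    rw [hf4.arr 14 (by decide), hs3, arr_setReg, hf2.arr 14 (by decide)]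
  have g33 : s4.reg 33 = 1 := by
    rw [hf4.reg 33 (by decide), hs3, reg_setReg, if_neg (by norm_num), h33']
  refine (wp_testCovered hG4 g33).mono ?_
  rintro t5 s5 hf5 ⟨ht5, hI⟩
  refine ⟨by omega, ?_⟩
  -- A vertex carries a mark exactly when it is unblocked for some index.
  have hiff : (∀ v : Fin n, s4.arr 14 v ≠ 0 ∨ s4.arr 16 v ≠ 0) ↔
      ∃ P, IsKPartition P ∧ G.IsCutSetRep U P := by
    rw [G.exists_partition_iff hUne hdisj, ← forall_not_unbalanced_iff hown,
      and_iff_right hbal]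
    refine forall_congr' fun v => or_congr ?_ ?_
    · rw [g14]
      constructor
      · intro h
        obtain ⟨i, hi⟩ := (how v).2.resolve_left h
        exact ⟨i, ((how v).1 i).1 hi⟩
      · rintro ⟨i, hi⟩
        have := ((how v).1 i).2 hi
        omega
    · rw [hI2]; simp
  simp only [hiff] at hI
  split_ifs at hI with h
  · refine .inl ⟨hI, h, ?_, ?_⟩
    · rw [hf5.reg 38 (by decide), hI1, maxCut]
    · rw [hf5.arr 14 (by decide), g14]; exact how
  · exact .inr ⟨hI, h⟩

end MultiHypergraph

/-! ### Enumerating the tuples -/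

namespace MultiHypergraph

open Ram

variable {n m k : ℕ} {G : MultiHypergraph n m} {s s' : Store} {U : Fin k → Finset (Fin n)}

/-- Write the tuple whose owners are in array `14`. -/
def writeTuple : Prog :=
  forBelow 34 0 (block [.copy 36 34, .succ 36, forBelow 7 1 (block [.load 10 14 7,
    .ite (.eq 10 36) (.write 4) (.write 3)])])

theorem wp_writeTuple (hG : G.InMemory s) (h0 : s.reg 0 = k)
    (how : IsOwner (s.arr 14) fun i v => v ∈ U i) :
    wp writeTuple s fun t s' => t ≤ k * (n * 5 + 6) + 2 ∧ s'.out = s.out ++ tupleWord U := by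
  classical
  let bits : Fin k → List ℕ := fun i => (List.finRange n).map fun v => if v ∈ U i then 1 else 0
  refine (wp_forBelow_const (N := k) (n * 5 + 4) (fun D s' =>
    s'.out = s.out ++ ((List.finRange k).take D.card).flatMap bits) (by decide) (by decide) (by decide)
    h0 (by simp) ?_).mono ?_
  · rintro D i s1 hD hf1 h34 hI
    have hG1 := hG.frame hf1 (by decide)
    refine wp_seq (wp_copy (wp_seq (wp_succ ?_)))
    set s2 := ((s1.setReg 36 _).setReg 36 _) with hs2
    have hG2 : G.InMemory s2 := by
      repeat' first | exact hG1 | apply InMemory.setReg | norm_num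
    have h36 : s2.reg 36 = i + 1 := by simp [hs2, h34]
    have a14 : s2.arr 14 = s.arr 14 := by simp [hs2, hf1.arr 14 (by decide)]
    refine (wp_forBelow_const (N := n) 3 (fun D' s' => s'.out = s1.out ++
      ((List.finRange n).take D'.card).map fun v => if v ∈ U i then 1 else 0) (by decide) (by decide)
      (by decide) hG2.regN (by simp [hs2]) ?_).mono ?_
    · rintro D' v s3 hD' hf3 h7 hJ
      have hG3 := hG2.frame hf3 (by decide)
      have h36' : s3.reg 36 = i + 1 := (hf3.reg 36 (by decide)).trans h36
      have hiff : s3.arr 14 v = i + 1 ↔ v ∈ U i := by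
        rw [hf3.arr 14 (by decide), a14]; exact (how v).1 i
      have htake : (List.finRange n).take (v + 1) = (List.finRange n).take v ++ [v] := by
        rw [List.take_succ_eq_append_getElem (by simp)]; simp
      rw [card_of_mem_iff_lt hD'] at hJ
      refine wp_seq (wp_load (wp_ite (fun hb => wp_write ?_) (fun hb => wp_write ?_)))
      all_goals
        simp [Test.Holds, h7, h36', hiff] at hb
        refine ⟨le_rfl, ?_⟩
        rw [Finset.card_insert_of_notMem (not_mem_of_mem_iff_lt hD'), card_of_mem_iff_lt hD', htake]
        simp [hJ, hb, hG3.one, hG3.zero]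
    · rintro t3 s3 - ⟨ht3, hJ⟩
      refine ⟨by omega, ?_⟩
      have htake : (List.finRange k).take (i + 1) = (List.finRange k).take i ++ [i] := by
        rw [List.take_succ_eq_append_getElem (by simp)]; simp
      rw [Finset.card_insert_of_notMem (not_mem_of_mem_iff_lt hD), card_of_mem_iff_lt hD, htake,
        out_setReg, hJ, hI, card_of_mem_iff_lt hD]
      simp [bits, List.take_of_length_le]
  · rintro t1 s1 - ⟨ht1, hI⟩
    refine ⟨by omega, ?_⟩
    rw [hI]
    simp [tupleWord, bits, List.take_of_length_le]

/-- The tuple represents a partition. -/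
def Represents (G : MultiHypergraph n m) (U : Fin k → Finset (Fin n)) : Prop :=
  ∃ P, IsKPartition P ∧ G.IsCutSetRep U P

/-- Register `40` becomes the least value of a tuple that represents a partition. -/
def minValue : Prog :=
  block [.const 39 0, forWords (block [testTuple, .ite (.eq 33 4) (.ite (.eq 39 3)
    (block [.const 39 1, .copy 40 38]) (.ite (.lt 38 40) (.copy 40 38) .skip)) .skip])]

/-- Write the tuples that represent a partition and have the value in register `40`. -/
def writeTuples : Prog :=
  forWords (block [testTuple, .ite (.eq 33 4) (.ite (.eq 38 40) writeTuple .skip) .skip])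

/-- Register `40` has a meaning only after register `39` reports a first success, so the conclusion
is conditional on some tuple representing a partition. -/
theorem wp_minValue (hk : 1 ≤ k) (hne : ∀ e, (G.edge e).Nonempty) (hG : G.InMemory s)
    (h0 : s.reg 0 = k) {L : List (Finset (Fin n))} (hL : Stored L s) (hLne : ∀ A ∈ L, A.Nonempty)
    (h24 : s.reg 24 = k) (h25 : s.reg 25 = L.length) (hpos : 0 < L.length) :
    wp minValue s fun t s' =>
      t ≤ L.length ^ k * (350 * (k * ((n + 1) * (G.size + 1)))) + k * 3 + 5 ∧
      ∀ f : Fin k → Fin L.length, G.Represents (fun i => L.get (f i)) →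
        s'.reg 40 ≤ G.maxCut (fun i => L.get (f i)) ∧ ∃ g : Fin k → Fin L.length,
          G.Represents (fun i => L.get (g i)) ∧ s'.reg 40 = G.maxCut (fun i => L.get (g i)) := by
  classical
  refine wp_seq (wp_const ?_)
  set s0 := s.setReg 39 0 with hs0
  have hG0 : G.InMemory s0 := hG.setReg (by norm_num)
  have hL0 : Stored L s0 := hL.congr (by simp [hs0]) (by simp [hs0]) rfl rfl
  set N := (n + 1) * (G.size + 1) with hN
  have hN1 : 1 ≤ N := Nat.mul_pos (by omega) (by omega)
  have hkN : k ≤ k * N := Nat.le_mul_of_pos_right _ hN1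
  refine (wp_forWords (L := k) (B := L.length) (T := 300 * (k * N) + 5) hG0.zero hG0.one
    (by simpa [hs0] using h24) (by simpa [hs0] using h25) hpos (by decide) (fun D s' =>
      (s'.reg 39 = 0 ∧ ∀ f ∈ D, ¬ G.Represents (fun i => L.get (f i))) ∨ (s'.reg 39 = 1 ∧
        (∃ f ∈ D, G.Represents (fun i => L.get (f i)) ∧
          s'.reg 40 = G.maxCut (fun i => L.get (f i))) ∧
        ∀ f ∈ D, G.Represents (fun i => L.get (f i)) →
          s'.reg 40 ≤ G.maxCut (fun i => L.get (f i)))) ?_ ?_ ?_).mono ?_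
  · intro D s1 s2 hr _ _ h
    rw [hr 39 (by decide) (by decide) (by decide), hr 40 (by decide) (by decide) (by decide)]
    exact h
  · exact .inl ⟨by simp [hs0], by simp⟩
  · rintro D f s1 hfD hf1 h11 hI
    have hG1 := hG0.frame hf1 (by decide)
    have hL1 := hL0.congr (hf1.reg 27 (by decide)) (hf1.reg 28 (by decide)) (hf1.arr 12 (by decide))
      (hf1.arr 13 (by decide))
    refine wp_seq ((wp_testTuple hk hne hG1 ?_ hL1 hLne f h11).mono ?_)
    · rw [hf1.reg 0 (by decide)]; simpa [hs0] using h0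
    rintro t2 s2 hf2 ⟨ht2, hor⟩
    rw [← hN] at ht2
    have hG2 := hG1.frame hf2 (by decide)
    have r39 : s2.reg 39 = s1.reg 39 := hf2.reg 39 (by decide)
    have r40 : s2.reg 40 = s1.reg 40 := hf2.reg 40 (by decide)
    refine wp_ite (fun hb => wp_ite (fun hb' => wp_seq (wp_const (wp_copy ?_)))
      (fun hb' => wp_ite (fun hb'' => wp_copy ?_) (fun hb'' => wp_skip ?_))) (fun hb => wp_skip ?_)
    all_goals
      refine ⟨by omega, ?_⟩
      simp only [Test.Holds, hG2.one] at hb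
      simp only [Finset.exists_mem_insert, Finset.forall_mem_insert]
    · obtain ⟨-, hrep, hval, -⟩ := hor.resolve_right (by omega)
      simp only [Test.Holds, hG2.zero, r39] at hb'
      have hI := (hI.resolve_right (by omega)).2
      refine .inr ⟨by simp, .inl ⟨hrep, by simpa using hval⟩, fun _ => by simp [hval], ?_⟩
      intro g hg hgr
      exact absurd hgr (hI g hg)
    · obtain ⟨-, hrep, hval, -⟩ := hor.resolve_right (by omega)
      simp only [Test.Holds, hG2.zero, r39, r40] at hb' hb''
      obtain ⟨hI1, hI2, hI3⟩ := hI.resolve_left (by omega)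
      refine .inr ⟨by simpa [r39] using hI1, .inl ⟨hrep, by simpa using hval⟩,
        fun _ => by simp [hval], fun g hg hgr => ?_⟩
      have := hI3 g hg hgr
      rw [reg_setReg, if_pos rfl]
      omega
    · obtain ⟨-, hrep, hval, -⟩ := hor.resolve_right (by omega)
      simp only [Test.Holds, hG2.zero, r39, r40] at hb' hb''
      obtain ⟨hI1, hI2, hI3⟩ := hI.resolve_left (by omega)
      rw [r39, r40]
      exact .inr ⟨hI1, .inr hI2, fun _ => by omega, hI3⟩
    · obtain ⟨-, hrep⟩ := hor.resolve_left (by omega)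
      have hrep : ¬ G.Represents (fun i => L.get (f i)) := hrep
      rw [r39, r40]
      rcases hI with ⟨h1, h2⟩ | ⟨h1, h2, h3⟩
      · exact .inl ⟨h1, hrep, h2⟩
      · exact .inr ⟨h1, .inr h2, fun h => absurd h hrep, h3⟩
  · rintro t1 s1 - ⟨ht1, hI⟩
    refine ⟨?_, fun f hf => ?_⟩
    · have : L.length ^ k * (300 * (k * N) + 5 + k * 9 + 4) ≤
          L.length ^ k * (350 * (k * N)) := Nat.mul_le_mul_left _ (by omega)
      omega
    · rcases hI with ⟨-, h⟩ | ⟨-, ⟨g, -, hg⟩, h⟩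
      · exact absurd hf (h f (Finset.mem_univ _))
      · exact ⟨h f (Finset.mem_univ _) hf, g, hg⟩

/-- A second sweep is needed because the least value is known only after the first. Every word is
visited once, which keeps `K` free of repetitions. -/
theorem wp_writeTuples (hk : 1 ≤ k) (hne : ∀ e, (G.edge e).Nonempty) (hG : G.InMemory s)
    (h0 : s.reg 0 = k) {L : List (Finset (Fin n))} (hL : Stored L s) (hLne : ∀ A ∈ L, A.Nonempty)
    (h24 : s.reg 24 = k) (h25 : s.reg 25 = L.length) (hpos : 0 < L.length) (hout : s.out = []) :
    wp writeTuples s fun t s' =>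
      t ≤ L.length ^ k * (350 * (k * ((n + 1) * (G.size + 1)))) + k * 3 + 5 ∧
      ∃ K : List (Fin k → Fin L.length), K.Nodup ∧
        (∀ f, f ∈ K ↔ G.Represents (fun i => L.get (f i)) ∧
          G.maxCut (fun i => L.get (f i)) = s.reg 40) ∧
        s'.out = K.flatMap fun f => tupleWord fun i => L.get (f i) := by
  classical
  set N := (n + 1) * (G.size + 1) with hN
  have hN1 : n + 1 ≤ N := Nat.le_mul_of_pos_right _ (by omega)
  have hkN : k ≤ k * N := Nat.le_mul_of_pos_right _ (by omega)
  have hwr : k * (n * 5 + 6) ≤ k * (6 * N) := Nat.mul_le_mul_left _ (by omega)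
  have hwr' : k * (6 * N) = 6 * (k * N) := by ring
  refine (wp_forWords (L := k) (B := L.length) (T := 310 * (k * N) + 5) hG.zero hG.one
    h24 h25 hpos (by decide) (fun D s' => ∃ K : List (Fin k → Fin L.length), K.Nodup ∧
        (∀ f, f ∈ K ↔ f ∈ D ∧ G.Represents (fun i => L.get (f i)) ∧
          G.maxCut (fun i => L.get (f i)) = s.reg 40) ∧
        s'.out = K.flatMap fun f => tupleWord fun i => L.get (f i)) ?_ ?_ ?_).mono ?_
  · intro D s1 s2 _ _ ho h
    rw [ho]
    exact h
  · exact ⟨[], List.nodup_nil, by simp, by simpa using hout⟩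
  · rintro D f s1 hfD hf1 h11 ⟨K, hK1, hK2, hK3⟩
    have hG1 := hG.frame hf1 (by decide)
    have hL1 := hL.congr (hf1.reg 27 (by decide)) (hf1.reg 28 (by decide)) (hf1.arr 12 (by decide))
      (hf1.arr 13 (by decide))
    have h0' : s1.reg 0 = k := (hf1.reg 0 (by decide)).trans h0
    refine wp_seq ((wp_testTuple hk hne hG1 h0' hL1 hLne f h11).mono ?_)
    rintro t2 s2 hf2 ⟨ht2, hor⟩
    rw [← hN] at ht2
    have hG2 := hG1.frame hf2 (by decide)
    have r40 : s2.reg 40 = s.reg 40 := (hf2.reg 40 (by decide)).trans (hf1.reg 40 (by decide))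
    have ro : s2.out = s1.out := hf2.out (by decide)
    refine wp_ite (fun hb => wp_ite (fun hb' => ?_) (fun hb' => wp_skip ?_)) (fun hb => wp_skip ?_)
    all_goals simp only [Test.Holds, hG2.one] at hb
    · obtain ⟨-, hrep, hval, how⟩ := hor.resolve_right (by omega)
      simp only [Test.Holds, hval, r40] at hb'
      refine (wp_writeTuple hG2 ((hf2.reg 0 (by decide)).trans h0') how).mono ?_
      rintro t3 s3 - ⟨ht3, ho3⟩
      refine ⟨by omega, K ++ [f], ?_, fun g => ?_, ?_⟩
      · rw [List.nodup_append]
        refine ⟨hK1, by simp, ?_⟩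
        rintro a ha b hb rfl
        rw [List.mem_singleton] at hb
        exact hfD ((hK2 f).1 (hb ▸ ha)).1
      · rw [List.mem_append, hK2, List.mem_singleton, Finset.mem_insert]
        constructor
        · rintro (h | rfl)
          · exact ⟨.inr h.1, h.2⟩
          · exact ⟨.inl rfl, hrep, hb'⟩
        · rintro ⟨rfl | h, h'⟩
          · exact .inr rfl
          · exact .inl ⟨h, h'⟩
      · rw [ho3, ro, hK3]; simp
    all_goals refine ⟨by omega, K, hK1, fun g => ?_, by rw [ro, hK3]⟩
    · obtain ⟨-, hrep, hval, how⟩ := hor.resolve_right (by omega)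
      simp only [Test.Holds, hval, r40] at hb'
      rw [hK2, Finset.mem_insert]
      refine ⟨fun h => ⟨.inr h.1, h.2⟩, ?_⟩
      rintro ⟨rfl | h, h'⟩
      · exact absurd h'.2 hb'
      · exact ⟨h, h'⟩
    · obtain ⟨-, hrep⟩ := hor.resolve_left (by omega)
      rw [hK2, Finset.mem_insert]
      refine ⟨fun h => ⟨.inr h.1, h.2⟩, ?_⟩
      rintro ⟨rfl | h, h'⟩
      · exact absurd h'.1 hrep
      · exact ⟨h, h'⟩
  · rintro t1 s1 - ⟨ht1, K, hK1, hK2, hK3⟩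
    refine ⟨?_, K, hK1, by simpa using hK2, hK3⟩
    have : L.length ^ k * (310 * (k * N) + 5 + k * 9 + 4) ≤
        L.length ^ k * (350 * (k * N)) := Nat.mul_le_mul_left _ (by omega)
    omega

/-- Algorithm Enum-MinMax-Reps. -/
def enumReps : Prog :=
  block [readInput, listCandidates, .ite (.lt 3 27) (block [.copy 24 0, .copy 25 27, minValue,
    writeTuples]) .skip]

/-- The sweeps over the tuples set the scale `X`. Computing the cuts costs exponent `4k + 2`, and
the search for duplicates `2 (4k - 2) + 1 = 8k - 3`. Both are within `4k² - 2k + 1`; for `k = 2` the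
second one attains it. -/
theorem enumReps_time_le {c : ℕ} (hk : 2 ≤ k) (hn : 1 ≤ n) {p : ℕ} (hp : 1 ≤ p)
    (hc : c ^ k ≤ n ^ (4 * k ^ 2 - 2 * k)) :
    20 * (p + 1) + (n ^ (4 * k - 2) * (1000 * (n + 1) ^ 4 * (p + 1) + n ^ (4 * k - 2) * (n * 7 + 9) +
        n * 20 + k * 50 + 50) + k * 20 + 20) +
      2 * (c ^ k * (350 * (k * ((n + 1) * (p + 1)))) + k * 3 + 5) + 10 ≤
      100000 * (k * n ^ (4 * k ^ 2 - 2 * k + 1) * p) := by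
  set X := k * n ^ (4 * k ^ 2 - 2 * k + 1) * p with hX
  have hexp : 8 * k - 3 ≤ 4 * k ^ 2 - 2 * k + 1 := by
    obtain ⟨j, rfl⟩ := Nat.exists_eq_add_of_le hk
    have e : 4 * (2 + j) ^ 2 - 2 * (2 + j) = 12 + 14 * j + 4 * j ^ 2 := by
      have : 4 * (2 + j) ^ 2 = 12 + 14 * j + 4 * j ^ 2 + 2 * (2 + j) := by ring
      omega
    rw [e]; omega
  have pow_le : ∀ a, a ≤ 8 * k - 3 → n ^ a ≤ n ^ (4 * k ^ 2 - 2 * k + 1) := fun a ha =>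
    Nat.pow_le_pow_right hn (by omega)
  have key : ∀ a, a ≤ 8 * k - 3 → k * n ^ a * p ≤ X := fun a ha =>
    Nat.mul_le_mul_right _ (Nat.mul_le_mul_left _ (pow_le a ha))
  have keyp : ∀ a, a ≤ 8 * k - 3 → n ^ a * p ≤ X := fun a ha =>
    (Nat.mul_le_mul_right _ (Nat.le_mul_of_pos_left _ (by omega))).trans (key a ha)
  have keyk : ∀ a, a ≤ 8 * k - 3 → k * n ^ a ≤ X := fun a ha =>
    (Nat.le_mul_of_pos_right _ hp).trans (key a ha)
  have key1 : ∀ a, a ≤ 8 * k - 3 → n ^ a ≤ X := fun a ha =>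
    (Nat.le_mul_of_pos_left _ (by omega)).trans (keyk a ha)
  have hp' : p ≤ X := by simpa using keyp 0 (by omega)
  have hk' : k ≤ X := by simpa using keyk 0 (by omega)
  have a1 : n ^ (4 * k - 2) * (1000 * (n + 1) ^ 4 * (p + 1)) ≤ 32000 * X := by
    calc n ^ (4 * k - 2) * (1000 * (n + 1) ^ 4 * (p + 1))
        ≤ n ^ (4 * k - 2) * (1000 * (2 * n) ^ 4 * (2 * p)) := by gcongr <;> omega
      _ = 32000 * (n ^ (4 * k - 2 + 4) * p) := by rw [pow_add]; ring
      _ ≤ 32000 * X := Nat.mul_le_mul_left _ (keyp _ (by omega))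
  have a2 : n ^ (4 * k - 2) * (n ^ (4 * k - 2) * (n * 7 + 9)) ≤ 16 * X := by
    calc n ^ (4 * k - 2) * (n ^ (4 * k - 2) * (n * 7 + 9))
        ≤ n ^ (4 * k - 2) * (n ^ (4 * k - 2) * (16 * n)) := by gcongr; omega
      _ = 16 * n ^ (4 * k - 2 + (4 * k - 2) + 1) := by rw [pow_add, pow_add]; ring
      _ ≤ 16 * X := Nat.mul_le_mul_left _ (key1 _ (by omega))
  have a3 : n ^ (4 * k - 2) * (n * 20) ≤ 20 * X := by
    calc n ^ (4 * k - 2) * (n * 20) = 20 * n ^ (4 * k - 2 + 1) := by rw [pow_add]; ring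
      _ ≤ 20 * X := Nat.mul_le_mul_left _ (key1 _ (by omega))
  have a4 : n ^ (4 * k - 2) * (k * 50) ≤ 50 * X := by
    calc n ^ (4 * k - 2) * (k * 50) = 50 * (k * n ^ (4 * k - 2)) := by ring
      _ ≤ 50 * X := Nat.mul_le_mul_left _ (keyk _ (by omega))
  have a5 : n ^ (4 * k - 2) * 50 ≤ 50 * X := by
    have := key1 (4 * k - 2) (by omega)
    omega
  have a6 : c ^ k * (350 * (k * ((n + 1) * (p + 1)))) ≤ 1400 * X := by
    calc c ^ k * (350 * (k * ((n + 1) * (p + 1))))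
        ≤ n ^ (4 * k ^ 2 - 2 * k) * (350 * (k * ((2 * n) * (2 * p)))) := by gcongr <;> omega
      _ = 1400 * X := by rw [hX, pow_succ]; ring
  have a0 : ∀ q x₁ x₂ x₃ x₄ x₅ : ℕ,
      q * (x₁ + x₂ + x₃ + x₄ + x₅) = q * x₁ + q * x₂ + q * x₃ + q * x₄ + q * x₅ := by
    intros; ring
  rw [a0]
  omega

theorem computes_enumReps (hk : 2 ≤ k) (hne : ∀ e, (G.edge e).Nonempty) (hp : 1 ≤ G.size) :
    ∃ (t : ℕ) (o : List ℕ), Computes enumReps (G.inputWord k) t o ∧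
      ListsFamily o (G.enumMinMaxReps k) ∧
      t ≤ 100000 * (k * n ^ (4 * k ^ 2 - 2 * k + 1) * G.size) := by
  classical
  have hn : 1 ≤ n := by
    obtain ⟨e, -, he⟩ := Finset.exists_ne_zero_of_sum_ne_zero (show ∑ e, (G.edge e).card ≠ 0 by
      unfold size at hp; omega)
    obtain ⟨v, -⟩ := Finset.card_pos.1 (Nat.pos_of_ne_zero he)
    exact v.pos
  suffices h : wp enumReps (initial (G.inputWord k)) fun t s' =>
      t ≤ 100000 * (k * n ^ (4 * k ^ 2 - 2 * k + 1) * G.size) ∧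
        ListsFamily s'.out (G.enumMinMaxReps k) by
    obtain ⟨t, s', he, ht, hl⟩ := h
    exact ⟨t, s'.out, ⟨s', he, rfl⟩, hl, ht⟩
  refine wp_seq ((wp_readInput hne).mono ?_)
  rintro t1 s1 - ⟨ht1, hG1, h0, ho1⟩
  refine wp_seq ((wp_listCandidates hk hn hne hG1 h0).mono ?_)
  rintro t2 s2 hf2 ⟨ht2, L, hnd, hL, hmem⟩
  have hG2 := hG1.frame hf2 (by decide)
  have h0' : s2.reg 0 = k := (hf2.reg 0 (by decide)).trans h0
  have ho2 : s2.out = [] := (hf2.out (by decide)).trans ho1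
  have hlen : L.length = (G.candidates k).card := by
    rw [← List.toFinset_card_of_nodup hnd]
    congr 1
    ext U
    rw [List.mem_toFinset, hmem]
  have htime := enumReps_time_le (c := L.length) hk hn hp (by
    rw [hlen]; exact G.card_candidates_pow_le)
  refine wp_ite (fun hb => wp_seq (wp_copy (wp_seq (wp_copy (wp_seq ?_))))) (fun hb => wp_skip ?_)
  all_goals simp only [Test.Holds, hG2.zero, hL.count] at hb
  · set s3 := ((s2.setReg 24 _).setReg 25 _) with hs3
    have hG3 : G.InMemory s3 := by
      repeat' first | exact hG2 | apply InMemory.setReg | norm_num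
    have hL3 : Stored L s3 := hL.congr (by simp [hs3]) (by simp [hs3]) rfl rfl
    have hLne : ∀ A ∈ L, A.Nonempty := fun A hA => G.candidates_nonempty ((hmem A).1 hA)
    have r0 : s3.reg 0 = k := by simpa [hs3] using h0'
    have r24 : s3.reg 24 = k := by simpa [hs3] using h0'
    have r25 : s3.reg 25 = L.length := by simpa [hs3] using hL.count
    refine (wp_minValue (by omega) hne hG3 r0 hL3 hLne r24 r25 hb).mono ?_
    rintro t4 s4 hf4 ⟨ht4, hmin⟩
    have hL4 : Stored L s4 := hL3.congr (hf4.reg 27 (by decide)) (hf4.reg 28 (by decide))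
      (hf4.arr 12 (by decide)) (hf4.arr 13 (by decide))
    refine (wp_writeTuples (by omega) hne (hG3.frame hf4 (by decide))
      ((hf4.reg 0 (by decide)).trans r0) hL4 hLne ((hf4.reg 24 (by decide)).trans r24)
      ((hf4.reg 25 (by decide)).trans r25) hb ?_).mono ?_
    · rw [hf4.out (by decide)]; exact ho2
    rintro t5 s5 - ⟨ht5, K, hK1, hK2, hK3⟩
    have hget : ∀ f : Fin k → Fin L.length, ∀ i, L.get (f i) ∈ G.candidates k := fun f i =>
      (hmem _).1 (List.get_mem _ _)
    -- Index words into the list of candidates stand for candidate tuples, so `𝒟` corresponds to the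
    -- words whose tuples represent a partition.
    have hrec : ∀ W, W ∈ G.recoverableTuples k ↔ ∃ f : Fin k → Fin L.length,
        (fun i => L.get (f i)) = W ∧ G.Represents (fun i => L.get (f i)) := by
      intro W
      rw [mem_recoverableTuples]
      constructor
      · rintro ⟨h1, h2⟩
        choose f hf using fun i => List.mem_iff_get.1 ((hmem _).2 (h1 i))
        obtain rfl : (fun i => L.get (f i)) = W := funext hf
        exact ⟨f, rfl, h2⟩
      · rintro ⟨f, rfl, h⟩
        exact ⟨hget f, h⟩
    refine ⟨by omega, K.map fun f i => L.get (f i), ?_, fun U => ?_, ?_⟩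
    · refine hK1.map fun f g h => funext fun i => ?_
      exact (List.nodup_iff_injective_get.1 hnd) (congrFun h i)
    · rw [List.mem_map, mem_enumMinMaxReps, hrec]
      constructor
      · rintro ⟨f, hf, rfl⟩
        obtain ⟨h1, h2⟩ := (hK2 f).1 hf
        refine ⟨⟨f, rfl, h1⟩, fun W hW => ?_⟩
        obtain ⟨g, rfl, hg⟩ := (hrec W).1 hW
        rw [h2]
        exact (hmin g hg).1
      · rintro ⟨⟨f, rfl, hf⟩, h⟩
        refine ⟨f, (hK2 f).2 ⟨hf, ?_⟩, rfl⟩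
        obtain ⟨h1, g, hg, hg'⟩ := hmin f hf
        have := h _ ((hrec _).2 ⟨g, rfl, hg⟩)
        omega
    · rw [hK3, List.flatMap_map]
  -- Without candidates there are no letters to form words from. The family is empty then, since a
  -- tuple has at least one entry and that entry would be a candidate.
  · refine ⟨by omega, [], List.nodup_nil, fun U => ?_, by simpa using ho2⟩
    have hL0 : L = [] := List.length_eq_zero_iff.1 (by omega)
    subst hL0
    simp only [List.not_mem_nil, false_iff, mem_enumMinMaxReps, mem_recoverableTuples, not_and]
    rintro ⟨h, -⟩
    exact absurd ((hmem _).2 (h ⟨0, by omega⟩)) (by simp)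

end MultiHypergraph

theorem mainTheorem4 :
    -- correctness of the algorithm
    (∀ k : ℕ, 2 ≤ k → ∀ (n m : ℕ) (G : MultiHypergraph n m),
      G.SolvesEnumReps (G.enumMinMaxReps k)) ∧
    -- the cardinality of the returned family
    (∃ A : ℕ, ∀ k : ℕ, 2 ≤ k → ∀ (n m : ℕ) (G : MultiHypergraph n m),
      (G.enumMinMaxReps k).card ≤ A * n ^ (4 * k ^ 2 - 2 * k)) ∧
    -- an implementation of the algorithm and its running time
    (∃ (P : Ram.Prog) (B : ℕ), ∀ k : ℕ, 2 ≤ k → ∀ (n m : ℕ) (G : MultiHypergraph n m),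
      (∀ e, (G.edge e).Nonempty) → 1 ≤ G.size →
      ∃ (t : ℕ) (o : List ℕ), Ram.Computes P (G.inputWord k) t o ∧
        ListsFamily o (G.enumMinMaxReps k) ∧
        t ≤ B * (k * n ^ (4 * k ^ 2 - 2 * k + 1) * G.size)) := by
  refine ⟨fun k hk n m G => G.solvesEnumReps hk, ⟨1, fun k hk n m G => ?_⟩,
    ⟨MultiHypergraph.enumReps, 100000, fun k hk n m G hne hp =>
      MultiHypergraph.computes_enumReps hk hne hp⟩⟩
  simpa using G.card_enumMinMaxReps_le
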